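/- **Setting.** Let $H_{\mathbf R}$ be a real separable Hilbert space and $(U_t)_{t\in\mathbf R}$ a strongly continuous one-parameter group of orthogonal transformations of $H_{\mathbf R}$. Let $H=H_{\mathbf R}\otimes_{\mathbf R}\mathbf C$ with its canonical conjugation $J(\xi+i\eta)=\xi-i\eta$, extend $U_t$ to $H$, and let $A$ be the positive nonsingular self-adjoint operator on $H$ with $U_t=A^{it}$. (Thus $\zeta\in\operatorname{dom}(A^{-1/2})$ with $A^{-1/2}\zeta=\eta$ if and only if $t\mapsto U_t\zeta$ extends to a continuous function $F$ on $\{0\le \operatorname{Im} z\le 1/2\}$, holomorphic in the interior, with $F(i/2)=\eta$.) Put $I=JA^{-1/2}$, a closed conjugate-linear involution, and $K_{\mathbf R}=\{\xi\in\operatorname{dom}(I): I\xi=\xi\}$, so that $\operatorname{dom}(I)=K_{\mathbf R}+iK_{\mathbf R}$. Let $\mathcal F(H)=\mathbf C\Omega\oplus\bigoplus_{n\ge1}H^{\otimes n}$ be the full Fock space, $\ell(\xi)$ the left creation operators, $s(\xi)=\frac12(\ell(\xi)+\ell(\xi)^*)$, and let $$\mathcal M=\Gamma(H_{\mathbf R},U_t)''=\{s(\xi):\xi\in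 K_{\mathbf R}\}''\subset \mathbf B(\mathcal F(H))$$ be the free Araki–Woods von Neumann algebra. For $x\in\mathcal M$ write $x=W(\xi)$ if $x\Omega=\xi$; the vacuum $\Omega$ is separating for $\mathcal M$, so that $x$ is determined by $\xi$. For $\varphi:\mathbf N\to\mathbf C$, a *radial multiplier* $\mathrm m_\varphi$ on $\mathcal M$ is a normal completely bounded map $\mathcal M\to\mathcal M$ with $\mathrm m_\varphi(W(e_1\otimes\cdots\otimes e_n))=\varphi(n)\,W(e_1\otimes\cdots\otimes e_n)$ for all $n\ge0$ and $e_1,\dots,e_n\in\operatorname{dom}(I)$ (the elements $W(e_1\otimes\cdots\otimes e_n)\in\mathcal M$ exist). For a contraction $T$ on $H$ with $ITI=T$ on $\operatorname{dom}(I)$, the *second quantization* $\Gamma(T)$ is the normal unital completely positive map on $\mathcal M$ with $\Gamma(T)W(\xi)=W\big((1\oplus\bigoplus_{n\ge1}T^{\otimes n})\xi\big)$ for all $\xi\in\mathcal M\Omega$. **Theorem A.** Every free Araki–Woods von Neumann algebra $\mathcal M=\Gamma(H_{\mathbf R},U_t)''$ has the complete metric approximation property: there is a net of normal finite rank maps $\Phi_i:\mathcal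 M\to\mathcal M$ with $\|\Phi_i\|_{\mathrm{cb}}\le1$ and $\Phi_i(x)\to x$ $*$-strongly for every $x\in\mathcal M$. Equivalently, the Cowling–Haagerup constant is $\Lambda_{\mathrm{cb}}(\mathcal M)=1$, where $\Lambda_{\mathrm{cb}}(\mathcal M)$ is the infimum of the $C\ge1$ for which there is a net of normal finite rank completely bounded maps $\Phi_i$ on $\mathcal M$ that converges pointwise $*$-strongly to the identity, with $\limsup_i\|\Phi_i\|_{\mathrm{cb}}\le C$. More precisely, there are finitely supported functions $\varphi_n:\mathbf N\to\mathbf R$ $(n\in\mathbf N)$ with radial multipliers $\mathrm m_{\varphi_n}$ on $\mathcal M$ such that $\varphi_n(k)\to1$ for every $k$ and $\|\mathrm m_{\varphi_n}\|_{\mathrm{cb}}\to1$, and there is a net $(T_k)_k$ of finite rank contractions of $H$ with $IT_kI=T_k$ on $\operatorname{dom}(I)$, converging pointwise to the identity and having second quantizations $\Gamma(T_k)$ on $\mathcal M$, such that the maps $\mathrm m_{\varphi_n}\circ\Gamma(T_k)$ are normal and of finite rank and, along the net of pairs $(n,k)$ (product order), $$\|\mathrm m_{\varphi_n}\circ\Gamma(T_k)\|_{\mathrm{cb}}\to1,\qquad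 (\mathrm m_{\varphi_n}\circ\Gamma(T_k))(x)\to x\ \ *\text{-strongly for every }x\in\mathcal M.$$ -/

import Mathlib

open Filter Topology
open scoped ENNReal ComplexConjugate InnerProductSpace

universe u

noncomputable section

/-! ### Complexification of a real Hilbert space -/

/-- The complexification `E ⊗_ℝ ℂ` of a real Hilbert space; the pair `(x, y)` is `x + i y`. -/
def Complexification (E : Type u) : Type u := WithLp 2 (E × E)

namespace Complexification

variable {E : Type u}

/-- The vector `x + i y`. -/
def mk (x y : E) : Complexification E := WithLp.toLp 2 (x, y)

/-- The real part of a vector. -/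
def re (z : Complexification E) : E := (WithLp.ofLp z).1

/-- The imaginary part of a vector. -/
def im (z : Complexification E) : E := (WithLp.ofLp z).2

theorem ext' {z w : Complexification E} (h₁ : z.re = w.re) (h₂ : z.im = w.im) : z = w :=
  WithLp.ofLp_injective 2 (Prod.ext h₁ h₂)

@[simp] theorem re_mk (x y : E) : (mk x y).re = x := rfl
@[simp] theorem im_mk (x y : E) : (mk x y).im = y := rfl

variable [NormedAddCommGroup E]

instance : NormedAddCommGroup (Complexification E) :=
  inferInstanceAs (NormedAddCommGroup (WithLp 2 (E × E)))

instance [CompleteSpace E] : CompleteSpace (Complexification E) :=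
  inferInstanceAs (CompleteSpace (WithLp 2 (E × E)))

@[simp] theorem re_add (z w : Complexification E) : (z + w).re = z.re + w.re := rfl
@[simp] theorem im_add (z w : Complexification E) : (z + w).im = z.im + w.im := rfl
@[simp] theorem re_zero : (0 : Complexification E).re = 0 := rfl
@[simp] theorem im_zero : (0 : Complexification E).im = 0 := rfl

theorem norm_sq_eq (z : Complexification E) : ‖z‖ ^ 2 = ‖z.re‖ ^ 2 + ‖z.im‖ ^ 2 :=
  WithLp.prod_norm_sq_eq_of_L2 (α := E) (β := E) z

variable [InnerProductSpace ℝ E]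

/-- `(a + i b) (x + i y) = (a x - b y) + i (a y + b x)`. -/
instance : SMul ℂ (Complexification E) where
  smul c z := mk (c.re • z.re - c.im • z.im) (c.re • z.im + c.im • z.re)

@[simp] theorem re_smul (c : ℂ) (z : Complexification E) :
    (c • z).re = c.re • z.re - c.im • z.im := rfl
@[simp] theorem im_smul (c : ℂ) (z : Complexification E) :
    (c • z).im = c.re • z.im + c.im • z.re := rfl

instance : Module ℂ (Complexification E) where
  one_smul z := by apply ext' <;> simp
  mul_smul c d z := by
    apply ext' <;> simp only [re_smul, im_smul, Complex.mul_re, Complex.mul_im] <;> module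
  smul_zero c := by apply ext' <;> simp
  smul_add c z w := by apply ext' <;> simp <;> module
  add_smul c d z := by apply ext' <;> simp <;> module
  zero_smul z := by apply ext' <;> simp

/-- The inner product, conjugate linear in the first variable, extending the one of `E`. -/
instance : Inner ℂ (Complexification E) where
  inner z w := ⟨⟪z.re, w.re⟫_ℝ + ⟪z.im, w.im⟫_ℝ, ⟪z.re, w.im⟫_ℝ - ⟪z.im, w.re⟫_ℝ⟩

theorem inner_def (z w : Complexification E) : ⟪z, w⟫_ℂ =
    ⟨⟪z.re, w.re⟫_ℝ + ⟪z.im, w.im⟫_ℝ, ⟪z.re, w.im⟫_ℝ - ⟪z.im, w.re⟫_ℝ⟩ := rfl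

instance : InnerProductSpace ℂ (Complexification E) where
  norm_smul_le c z := by
    have h : ‖c • z‖ ^ 2 = (‖c‖ * ‖z‖) ^ 2 := by
      rw [mul_pow, norm_sq_eq, norm_sq_eq, re_smul, im_smul, norm_sub_sq_real, norm_add_sq_real,
        Complex.sq_norm, Complex.normSq_apply]
      simp only [norm_smul, inner_smul_left, inner_smul_right, mul_pow, Real.norm_eq_abs, sq_abs,
        real_inner_comm z.re z.im, conj_trivial]
      ring
    exact ((sq_eq_sq₀ (norm_nonneg _) (by positivity)).1 h).le
  norm_sq_eq_re_inner z := by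
    simp [inner_def, norm_sq_eq]
  conj_inner_symm z w := by
    apply Complex.ext <;> simp [inner_def, real_inner_comm]
  add_left x y z := by
    apply Complex.ext <;> simp [inner_def, inner_add_left] <;> ring
  smul_left x y c := by
    apply Complex.ext <;>
      simp [inner_def, inner_add_left, inner_sub_left, inner_smul_left] <;> ring

/-- The canonical conjugation `J (x + i y) = x - i y`. -/
def conjJ (z : Complexification E) : Complexification E := mk z.re (-z.im)

/-- The complexification of an orthogonal transformation. -/
def mapIso (u : E ≃ₗᵢ[ℝ] E) (z : Complexification E) : Complexification E :=
  mk (u z.re) (u z.im)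

end Complexification

/-! ### Orthogonal representations of `ℝ` and the associated involution -/

/-- A strongly continuous one-parameter group `(U_t)` of orthogonal transformations. -/
structure OrthogonalRep (E : Type u) [NormedAddCommGroup E] [InnerProductSpace ℝ E] where
  /-- the orthogonal transformation `U_t` -/
  toFun : ℝ → E ≃ₗᵢ[ℝ] E
  map_add : ∀ s t x, toFun (s + t) x = toFun s (toFun t x)
  continuous_apply : ∀ x, Continuous fun t => toFun t x

namespace OrthogonalRep

variable {E : Type u} [NormedAddCommGroup E] [InnerProductSpace ℝ E]

/-- Let `A` be the positive nonsingular self-adjoint operator on the complexification with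
`U_t = A ^ (i t)` (the analytic generator of the group). For `s > 0`, this is the graph of
`A ^ (-s)`: the pair `(ζ, η)` belongs to it if the orbit `t ↦ U_t ζ` has a continuous extension
`F` to the strip `0 ≤ Im z ≤ s`, holomorphic in its interior (so that `F z = A ^ (i z) ζ`),
with `F (i s) = η`. -/
def NegPowGraph (U : OrthogonalRep E) (s : ℝ) (ζ η : Complexification E) : Prop :=
  ∃ F : ℂ → Complexification E,
    DiffContOnCl ℂ F {z : ℂ | 0 < z.im ∧ z.im < s} ∧
    (∀ t : ℝ, F t = Complexification.mapIso (U.toFun t) ζ) ∧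
    F (s * Complex.I) = η

/-- The graph of the closed conjugate linear involution `I = J A ^ (-1/2)`. -/
def InvolutionGraph (U : OrthogonalRep E) (ζ η : Complexification E) : Prop :=
  ∃ θ, U.NegPowGraph (1 / 2) ζ θ ∧ η = Complexification.conjJ θ

/-- The domain of `I`, that is `K_ℝ + i K_ℝ`. -/
def domI (U : OrthogonalRep E) : Set (Complexification E) :=
  {ζ | ∃ η, U.InvolutionGraph ζ η}

/-- The real subspace `K_ℝ = {ξ ∈ dom I | I ξ = ξ}`. -/
def realPart (U : OrthogonalRep E) : Set (Complexification E) :=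
  {ξ | U.InvolutionGraph ξ ξ}

/-- `I T I = T` on the domain of `I`: whenever `I ζ = η`, the vector `T η` belongs to the domain
of `I` and `I (T η) = T ζ`. -/
def CommutesWithI (U : OrthogonalRep E)
    (T : Complexification E →L[ℂ] Complexification E) : Prop :=
  ∀ ζ η, U.InvolutionGraph ζ η → U.InvolutionGraph (T η) (T ζ)

end OrthogonalRep

/-! ### The full Fock space -/

section Fock

/-- Formal linear combinations of words `e₁ ⋯ eₙ` in vectors of `H`, `n ≥ 0`; the word
`e₁ ⋯ eₙ` stands for the elementary tensor `e₁ ⊗ ⋯ ⊗ eₙ`, the empty word for the vacuum. -/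
abbrev PreFock (H : Type u) : Type u := List H →₀ ℂ

variable {H : Type u} [NormedAddCommGroup H] [InnerProductSpace ℂ H]

/-- `⟨e₁ ⊗ ⋯ ⊗ eₙ, f₁ ⊗ ⋯ ⊗ fₘ⟩ = δ_{n,m} ⟨e₁, f₁⟩ ⋯ ⟨eₙ, fₙ⟩`. -/
def wordInner : List H → List H → ℂ
  | [], [] => 1
  | e :: a, f :: b => ⟪e, f⟫_ℂ * wordInner a b
  | _, _ => 0

theorem conj_wordInner : ∀ a b : List H, conj (wordInner b a) = wordInner a b
  | [], [] => by simp [wordInner]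
  | [], _ :: _ => by simp [wordInner]
  | _ :: _, [] => by simp [wordInner]
  | e :: a, f :: b => by simp [wordInner, conj_wordInner a b]

/-- The kernel `wordInner`, truncated to words of length at most `n`. -/
def wordInnerTrunc : ℕ → Matrix (List H) (List H) ℂ
  | 0 => fun a b => (if a = [] then 1 else 0) * (if b = [] then 1 else 0)
  | n + 1 => fun a b => (if a = [] then 1 else 0) * (if b = [] then 1 else 0) +
      ⟪a.headD 0, b.headD 0⟫_ℂ * wordInnerTrunc n a.tail b.tail

open scoped ComplexOrder in
theorem posSemidef_gram_aux {ι V : Type*} [NormedAddCommGroup V] [InnerProductSpace ℂ V]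
    (v : ι → V) : (Matrix.gram ℂ v).PosSemidef := by
  refine ⟨Matrix.isHermitian_gram ℂ v, fun x => ?_⟩
  have e : (x.sum fun i xi => x.sum fun j xj => star xi * Matrix.gram ℂ v i j * xj) =
      ⟪x.sum fun i c => c • v i, x.sum fun i c => c • v i⟫_ℂ := by
    simp only [Finsupp.sum]
    rw [sum_inner]
    refine Finset.sum_congr rfl fun i _ => ?_
    rw [inner_sum]
    refine Finset.sum_congr rfl fun j _ => ?_
    rw [inner_smul_left, inner_smul_right, Matrix.gram_apply, starRingEnd_apply]
    ring
  rw [e, inner_self_eq_norm_sq_to_K, ← RCLike.ofReal_pow]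
  exact RCLike.ofReal_nonneg.2 (sq_nonneg _)

open scoped ComplexOrder in
theorem posSemidef_wordInnerTrunc (n : ℕ) : (wordInnerTrunc (H := H) n).PosSemidef := by
  have h0 : Matrix.PosSemidef (fun a b : List H =>
      (if a = [] then (1 : ℂ) else 0) * (if b = [] then 1 else 0)) := by
    have := posSemidef_gram_aux (fun a : List H => if a = [] then (1 : ℂ) else 0)
    refine (congrArg Matrix.PosSemidef ?_).mp this
    ext a b
    by_cases ha : a = [] <;> by_cases hb : b = [] <;> simp [ha, hb, Matrix.gram]
  induction n with
  | zero => exact h0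
  | succ n ih =>
    have h1 := (posSemidef_gram_aux (fun a : List H => a.headD 0)).hadamard
      (ih.submatrix List.tail)
    exact h0.add h1

theorem wordInnerTrunc_eq (n : ℕ) (a b : List H) (ha : a.length ≤ n) :
    wordInnerTrunc n a b = wordInner a b := by
  induction n generalizing a b with
  | zero =>
    obtain rfl : a = [] := by simpa using ha
    cases b <;> simp [wordInnerTrunc, wordInner]
  | succ n ih =>
    cases a with
    | nil => cases b <;> simp [wordInnerTrunc, wordInner]
    | cons e a =>
      cases b with
      | nil => simp [wordInnerTrunc, wordInner]
      | cons f b => simp [wordInnerTrunc, wordInner, ih a b (by simpa using ha)]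

/-- The sesquilinear extension of `wordInner`. -/
instance : PreInnerProductSpace.Core ℂ (PreFock H) where
  inner x y := Finsupp.sum x fun a c => Finsupp.sum y fun b d => conj c * d * wordInner a b
  conj_inner_symm x y := by
    rw [Finsupp.sum_comm]
    simp only [map_finsuppSum, map_mul, conj_wordInner, Complex.conj_conj]
    refine Finsupp.sum_congr fun a _ => Finsupp.sum_congr fun b _ => ?_
    ring
  add_left x y z := by
    refine Finsupp.sum_add_index' (by simp) fun a c d => ?_
    rw [← Finsupp.sum_add]
    refine Finsupp.sum_congr fun b _ => ?_
    simp only [map_add]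
    ring
  smul_left x y r := by
    refine (Finsupp.sum_smul_index (by simp)).trans ?_
    rw [Finsupp.mul_sum]
    refine Finsupp.sum_congr fun a _ => ?_
    rw [Finsupp.mul_sum]
    refine Finsupp.sum_congr fun b _ => ?_
    simp only [map_mul]
    ring
  re_inner_nonneg x := by
    obtain ⟨n, hn⟩ : ∃ n, ∀ a ∈ Finsupp.support x, a.length ≤ n :=
      ⟨(Finsupp.support x).sup List.length, fun a ha => Finset.le_sup ha⟩
    have h := (posSemidef_wordInnerTrunc (H := H) n).2 x
    have e : (Finsupp.sum x fun a c => Finsupp.sum x fun b d => conj c * d * wordInner a b) =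
        Finsupp.sum x fun a c => Finsupp.sum x fun b d => star c * wordInnerTrunc n a b * d := by
      refine Finsupp.sum_congr fun a ha => Finsupp.sum_congr fun b _ => ?_
      rw [wordInnerTrunc_eq n a b (hn a ha)]
      simp only [starRingEnd_apply]
      ring
    exact (Complex.le_def.1 (e ▸ h)).1

instance : SeminormedAddCommGroup (PreFock H) :=
  InnerProductSpace.Core.toSeminormedAddCommGroup (𝕜 := ℂ)

instance : InnerProductSpace ℂ (PreFock H) := .ofCore _

theorem PreFock.inner_def (x y : PreFock H) :
    ⟪x, y⟫_ℂ = Finsupp.sum x fun a c => Finsupp.sum y fun b d => conj c * d * wordInner a b :=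
  rfl

variable (H) in
/-- The full Fock space `ℂ Ω ⊕ ⨁_{n ≥ 1} H^{⊗ n}`, as the Hilbert space completion
(after dividing by the null vectors) of the span of the elementary tensors. -/
abbrev Fock : Type u := UniformSpace.Completion (PreFock H)

/-- The elementary tensor `e₁ ⊗ ⋯ ⊗ eₙ` of a list of vectors. -/
def Fock.tensor (a : List H) : Fock H :=
  ((Finsupp.single a 1 : PreFock H) : Fock H)

variable (H) in
/-- The vacuum vector `Ω`. -/
def Fock.vacuum : Fock H := Fock.tensor []

/-- The map `e₁ ⊗ ⋯ ⊗ eₙ ↦ ξ ⊗ e₁ ⊗ ⋯ ⊗ eₙ`. -/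
def PreFock.consₗ (ξ : H) : PreFock H →ₗ[ℂ] PreFock H :=
  Finsupp.lmapDomain ℂ ℂ (List.cons ξ)

theorem PreFock.norm_consₗ (ξ : H) (x : PreFock H) : ‖PreFock.consₗ ξ x‖ = ‖ξ‖ * ‖x‖ := by
  have h : ⟪PreFock.consₗ ξ x, PreFock.consₗ ξ x⟫_ℂ = ⟪ξ, ξ⟫_ℂ * ⟪x, x⟫_ℂ := by
    have e : PreFock.consₗ ξ x = Finsupp.mapDomain (List.cons ξ) x := rfl
    rw [PreFock.inner_def, PreFock.inner_def, e, Finsupp.sum_mapDomain_index, Finsupp.mul_sum]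
    · refine Finsupp.sum_congr fun a _ => ?_
      rw [Finsupp.sum_mapDomain_index, Finsupp.mul_sum]
      · refine Finsupp.sum_congr fun b _ => ?_
        simp only [wordInner]
        ring
      · simp
      · intros; ring
    · simp
    · intro a c d
      rw [← Finsupp.sum_add]
      refine Finsupp.sum_congr fun b _ => ?_
      simp only [map_add]
      ring
  have h2 : ‖PreFock.consₗ ξ x‖ ^ 2 = (‖ξ‖ * ‖x‖) ^ 2 := by
    have h3 := h
    simp only [inner_self_eq_norm_sq_to_K] at h3
    rw [mul_pow]
    exact_mod_cast h3
  exact (sq_eq_sq₀ (norm_nonneg _) (by positivity)).1 h2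

/-- The left creation operator `ℓ(ξ)`. -/
def Fock.creation (ξ : H) : Fock H →L[ℂ] Fock H :=
  ContinuousLinearMap.completion
    (LinearMap.mkContinuous (PreFock.consₗ ξ) ‖ξ‖ fun x => (PreFock.norm_consₗ ξ x).le)

theorem Fock.creation_tensor (ξ : H) (a : List H) :
    Fock.creation ξ (Fock.tensor a) = Fock.tensor (ξ :: a) := by
  have e : PreFock.consₗ ξ (Finsupp.single a 1 : List H →₀ ℂ) =
      (Finsupp.single (ξ :: a) 1 : List H →₀ ℂ) := Finsupp.mapDomain_single
  simp only [Fock.creation, Fock.tensor]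
  rw [ContinuousLinearMap.completion_apply_coe, LinearMap.mkContinuous_apply, e]

/-- `s(ξ) = (ℓ(ξ) + ℓ(ξ)^*) / 2`. -/
def Fock.semicircular (ξ : H) : Fock H →L[ℂ] Fock H :=
  (2⁻¹ : ℂ) • (Fock.creation ξ + star (Fock.creation ξ))

/-- `S` is the first quantization of `T`, that is `S = 1 ⊕ ⨁_{n ≥ 1} T^{⊗ n}`. -/
def Fock.IsFirstQuantization (T : H →L[ℂ] H) (S : Fock H →L[ℂ] Fock H) : Prop :=
  ∀ a : List H, S (Fock.tensor a) = Fock.tensor (a.map T)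

end Fock

/-! ### Maps on von Neumann algebras -/

section VonNeumann

variable {K : Type u} [NormedAddCommGroup K] [InnerProductSpace ℂ K] [CompleteSpace K]

/-- The von Neumann algebra generated by a set of operators: the double commutant of the set and
its adjoints. -/
def VonNeumannAlgebra.generated (S : Set (K →L[ℂ] K)) : VonNeumannAlgebra K where
  toStarSubalgebra := StarSubalgebra.centralizer ℂ (StarSubalgebra.centralizer ℂ S : Set _)
  centralizer_centralizer' := by
    have h := StarSubalgebra.coe_centralizer_centralizer ℂ S
    refine (congrArg (fun X => Set.centralizer (Set.centralizer X)) h).trans ?_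
    exact (Set.centralizer_centralizer_centralizer _).trans h.symm

/-- The type of elements of a von Neumann algebra. -/
abbrev VonNeumannAlgebra.Elem (N : VonNeumannAlgebra K) : Type u := N.toStarSubalgebra

variable (K) in
/-- The ultraweak topology on `B(K)`, defined by the functionals `x ↦ ∑ₙ ⟨ηₙ, x ξₙ⟩` with
`(ξₙ)`, `(ηₙ)` square summable. -/
@[reducible] def ultraweakTopology : TopologicalSpace (K →L[ℂ] K) :=
  ⨅ p : lp (fun _ : ℕ => K) 2 × lp (fun _ : ℕ => K) 2,
    TopologicalSpace.induced (fun x => ∑' n, ⟪p.2 n, x (p.1 n)⟫_ℂ) inferInstance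

/-- The ultraweak topology of a von Neumann algebra. -/
@[reducible] def VonNeumannAlgebra.ultraweak (N : VonNeumannAlgebra K) : TopologicalSpace N.Elem :=
  TopologicalSpace.induced Subtype.val (ultraweakTopology K)

/-- The operator on `K ⊕ ⋯ ⊕ K` given by a matrix of operators on `K`. -/
def matrixOp {n : ℕ} (x : Matrix (Fin n) (Fin n) (K →L[ℂ] K)) :
    PiLp 2 (fun _ : Fin n => K) →L[ℂ] PiLp 2 (fun _ : Fin n => K) :=
  (PiLp.continuousLinearEquiv 2 ℂ (fun _ : Fin n => K)).symm.toContinuousLinearMap ∘L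
    (ContinuousLinearMap.pi fun i => ∑ j, x i j ∘L ContinuousLinearMap.proj j) ∘L
    (PiLp.continuousLinearEquiv 2 ℂ (fun _ : Fin n => K)).toContinuousLinearMap

namespace VonNeumannAlgebra

variable {N : VonNeumannAlgebra K}

/-- A matrix over `N` as an operator on `K ⊕ ⋯ ⊕ K`. -/
def matrixOp {n : ℕ} (x : Matrix (Fin n) (Fin n) N.Elem) :
    PiLp 2 (fun _ : Fin n => K) →L[ℂ] PiLp 2 (fun _ : Fin n => K) :=
  _root_.matrixOp (x.map Subtype.val)

/-- A map is normal if it is ultraweakly continuous. -/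
def IsNormalMap (Φ : N.Elem →ₗ[ℂ] N.Elem) : Prop :=
  Continuous[N.ultraweak, N.ultraweak] Φ

/-- A map has finite rank if its range is finite dimensional. -/
def IsFiniteRank (Φ : N.Elem →ₗ[ℂ] N.Elem) : Prop :=
  FiniteDimensional ℂ (LinearMap.range Φ)

/-- The completely bounded norm `supₙ ‖id ⊗ Φ : Mₙ(N) → Mₙ(N)‖`, possibly infinite. -/
def cbNorm (Φ : N.Elem →ₗ[ℂ] N.Elem) : ℝ≥0∞ :=
  ⨆ (n : ℕ) (x : Matrix (Fin n) (Fin n) N.Elem) (_ : ‖matrixOp x‖ ≤ 1), ‖matrixOp (x.map Φ)‖ₑ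

/-- Complete positivity. -/
def IsCompletelyPositive (Φ : N.Elem →ₗ[ℂ] N.Elem) : Prop :=
  ∀ (n : ℕ) (x : Matrix (Fin n) (Fin n) N.Elem),
    (matrixOp x).IsPositive → (matrixOp (x.map Φ)).IsPositive

/-- The family `Φ` converges pointwise `*`-strongly to the identity of `N` along `l`. -/
def TendstoIdStarStrongly {ι : Type*} (l : Filter ι) (Φ : ι → N.Elem →ₗ[ℂ] N.Elem) : Prop :=
  ∀ (x : N.Elem) (v : K),
    Tendsto (fun i => (Φ i x : K →L[ℂ] K) v) l (𝓝 ((x : K →L[ℂ] K) v)) ∧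
    Tendsto (fun i => star (Φ i x : K →L[ℂ] K) v) l (𝓝 (star (x : K →L[ℂ] K) v))

/-- The complete metric approximation property: there is a net of normal finite rank complete
contractions that converges pointwise `*`-strongly to the identity. -/
def HasCMAP (N : VonNeumannAlgebra K) : Prop :=
  ∃ (ι : Type u) (_ : Preorder ι) (_ : IsDirectedOrder ι) (_ : Nonempty ι)
    (Φ : ι → N.Elem →ₗ[ℂ] N.Elem),
    (∀ i, IsNormalMap (Φ i) ∧ IsFiniteRank (Φ i) ∧ cbNorm (Φ i) ≤ 1) ∧
    TendstoIdStarStrongly atTop Φ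

/-- There is a net of normal finite rank completely bounded maps `Φ_i` that converges pointwise
`*`-strongly to the identity, with `limsup ‖Φ_i‖_cb ≤ C`. -/
def HasCBAPWith (N : VonNeumannAlgebra K) (C : ℝ≥0∞) : Prop :=
  ∃ (ι : Type u) (_ : Preorder ι) (_ : IsDirectedOrder ι) (_ : Nonempty ι)
    (Φ : ι → N.Elem →ₗ[ℂ] N.Elem),
    (∀ i, IsNormalMap (Φ i) ∧ IsFiniteRank (Φ i) ∧ cbNorm (Φ i) < ∞) ∧
    TendstoIdStarStrongly atTop Φ ∧
    limsup (fun i => cbNorm (Φ i)) atTop ≤ C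

/-- The Cowling–Haagerup constant `Λ_cb(N)`, with value `∞` if there is no finite constant. -/
def cowlingHaagerup (N : VonNeumannAlgebra K) : ℝ≥0∞ :=
  sInf {C : ℝ≥0∞ | 1 ≤ C ∧ C < ∞ ∧ HasCBAPWith N C}

end VonNeumannAlgebra

end VonNeumann

/-! ### Free Araki–Woods von Neumann algebras -/

section ArakiWoods

variable {E : Type u} [NormedAddCommGroup E] [InnerProductSpace ℝ E]

/-- The free Araki–Woods von Neumann algebra `Γ(H_ℝ, U_t)'' = {s(ξ) | ξ ∈ K_ℝ}''`. -/
def freeArakiWoods (U : OrthogonalRep E) : VonNeumannAlgebra (Fock (Complexification E)) :=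
  VonNeumannAlgebra.generated (Fock.semicircular '' U.realPart)

/-- `x = W(ξ)`, that is `x Ω = ξ`. -/
def IsW {U : OrthogonalRep E} (ξ : Fock (Complexification E))
    (x : (freeArakiWoods U).Elem) : Prop :=
  (x : Fock (Complexification E) →L[ℂ] Fock (Complexification E)) (Fock.vacuum _) = ξ

/-- `m` is the radial multiplier of symbol `φ`: the normal completely bounded map with
`m (W(e₁ ⊗ ⋯ ⊗ eₙ)) = φ(n) W(e₁ ⊗ ⋯ ⊗ eₙ)` for all `e₁, …, eₙ ∈ K_ℝ + i K_ℝ`. -/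
structure IsRadialMultiplier (U : OrthogonalRep E) (φ : ℕ → ℂ)
    (m : (freeArakiWoods U).Elem →ₗ[ℂ] (freeArakiWoods U).Elem) : Prop where
  normal : VonNeumannAlgebra.IsNormalMap m
  cb : VonNeumannAlgebra.cbNorm m < ∞
  exists_W : ∀ a : List (Complexification E), (∀ e ∈ a, e ∈ U.domI) →
    ∃ x : (freeArakiWoods U).Elem, IsW (Fock.tensor a) x
  map_W : ∀ a : List (Complexification E), (∀ e ∈ a, e ∈ U.domI) →
    ∀ x : (freeArakiWoods U).Elem, IsW (Fock.tensor a) x → m x = φ a.length • x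

/-- `G` is the second quantization `Γ(T)` of `T` on the free Araki–Woods algebra: the normal
unital completely positive map with `Γ(T) W(ξ) = W((1 ⊕ ⨁_{n ≥ 1} T^{⊗ n}) ξ)`. -/
structure IsSecondQuantization (U : OrthogonalRep E)
    (T : Complexification E →L[ℂ] Complexification E)
    (G : (freeArakiWoods U).Elem →ₗ[ℂ] (freeArakiWoods U).Elem) : Prop where
  normal : VonNeumannAlgebra.IsNormalMap G
  unital : G 1 = 1
  completelyPositive : VonNeumannAlgebra.IsCompletelyPositive G
  map_W : ∃ S : Fock (Complexification E) →L[ℂ] Fock (Complexification E),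
    Fock.IsFirstQuantization T S ∧
    ∀ ξ, ∀ x : (freeArakiWoods U).Elem, IsW ξ x → IsW (S ξ) (G x)

end ArakiWoods

end

set_option linter.unusedSectionVars false

/-! ### Elementary tensors and operators on the full Fock space -/

namespace Fock

variable {H : Type u} [NormedAddCommGroup H] [InnerProductSpace ℂ H]
variable {X : Type*} [NormedAddCommGroup X] [InnerProductSpace ℂ X]

/-! The approximating maps compose two kinds of maps: a truncated radial multiplier, which cuts off
large degrees, and the second quantization of a finite rank contraction, which makes every remaining
degree finite dimensional. The algebra is studied for an arbitrary standard subspace `S` of a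
complex Hilbert space and specialized to `K_ℝ` at the end.

The basic maps on `B(F(H))` are `x ↦ A^* (x ⊗ 1) B` (`sandwich`). They are normal, their completely
bounded norm is at most `‖A‖ ‖B‖`, and a linear combination of them leaves the algebra invariant
once it sends Wick operators into the algebra (`StandardSubspace.map_mem`). Because the vacuum is
separating (`StandardSubspace.eq_of_vacuum_eq`), identities between elements of the algebra can be
tested on the vacuum.

Radial part. The terms `ℓ(e₁) ⋯ ℓ(eₖ) ℓ(fₖ₊₁)^* ⋯ ℓ(fₙ)^*` of a given bidegree are extracted by at
most two maps of the above form, so the projection to degree `d` has norm at most `2 (d + 1)`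
(`Fock.isNormalCB_degreeMap`). The untruncated symbol `r ^ k` is the second quantization of the
scalar `r`, a complete contraction. Linear growth against geometric decay makes the tail small, so
truncating costs an arbitrarily small amount (`StandardSubspace.isCBBound_truncMap`).

Finite rank part. The contraction must preserve `S`, although the involution of `S` is unbounded.
Let `P`, `Q` be the real orthogonal projections onto `S` and `i S`. Then `R = P + Q` is complex
linear with spectrum in `[0, 2]`, `D = P - Q` is conjugate linear, `D R = (2 - R) D`, `D² = R (2 -
R)`, and `D x = (2 - R) x` on `S`. Take a partition of unity `∑ fⱼ²` on `[1/m, 2 - 1/m]` by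
functions of very small support, and finite rank projections `pⱼ`. The operator `∑ (fⱼ(R) pⱼ fⱼ(R) +
D (fⱼ/r)(R) pⱼ (fⱼ/(2 - r))(R) D)` equals `2 P y` on `x ∈ S`, with `y = ∑ (fⱼ/r)(R) pⱼ fⱼ(R) x`, so
it preserves `S`. Each half has norm close to at most one, since `(2 - r)/r` is nearly constant on
the support of `fⱼ` (`StandardSubspace.norm_approxId_le`).

Standardness of `K_ℝ` comes from complex analysis on the strip: the involution is well defined by
uniqueness of continuation, closed by Phragmén–Lindelöf, involutive by reflection, and densely
defined by Gaussian smoothing (`OrthogonalRep.standardSubspace`). -/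

theorem inner_tensor (a b : List H) : ⟪tensor a, tensor b⟫_ℂ = wordInner a b := by
  simp [tensor, UniformSpace.Completion.inner_coe, PreFock.inner_def]

theorem span_tensor_eq_range :
    (Submodule.span ℂ (Set.range (tensor : List H → Fock H)) : Set (Fock H)) =
      Set.range ((↑) : PreFock H → Fock H) := by
  let j : PreFock H →ₗ[ℂ] Fock H :=
    (UniformSpace.Completion.toComplL : PreFock H →L[ℂ] Fock H).toLinearMap
  have h1 : Set.range (tensor : List H → Fock H) =
      j '' Set.range (fun a : List H => (Finsupp.single a 1 : List H →₀ ℂ)) := by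
    rw [← Set.range_comp]; rfl
  rw [h1, Submodule.span_image]
  have h2 : Submodule.span ℂ (Set.range fun a : List H => (Finsupp.single a 1 : List H →₀ ℂ)) = ⊤ := by
    have := (Finsupp.basisSingleOne (R := ℂ) (ι := List H)).span_eq
    simpa using this
  have h3 : Submodule.map j
      (Submodule.span ℂ (Set.range fun a : List H => (Finsupp.single a 1 : List H →₀ ℂ)))
      = LinearMap.range j := by
    rw [LinearMap.range_eq_map]
    exact congrArg (Submodule.map j) h2
  exact (congrArg SetLike.coe h3).trans rfl

theorem dense_span_tensor :
    Dense (Submodule.span ℂ (Set.range (tensor : List H → Fock H)) : Set (Fock H)) := by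
  rw [span_tensor_eq_range]
  exact UniformSpace.Completion.denseRange_coe

theorem clm_ext {Y : Type*} [NormedAddCommGroup Y] [NormedSpace ℂ Y] {A B : Fock H →L[ℂ] Y}
    (h : ∀ a, A (tensor a) = B (tensor a)) : A = B := by
  refine ContinuousLinearMap.ext_on dense_span_tensor ?_
  rintro _ ⟨a, rfl⟩
  exact h a

theorem eq_of_inner_tensor {x y : Fock H} (h : ∀ a, ⟪tensor a, x⟫_ℂ = ⟪tensor a, y⟫_ℂ) :
    x = y := by
  have : innerSL ℂ x = innerSL ℂ y := clm_ext fun a => by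
    rw [innerSL_apply_apply, innerSL_apply_apply, ← inner_conj_symm, h, inner_conj_symm]
  exact (innerSL_inj (𝕜 := ℂ)).1 this

theorem wordInner_eq_zero : ∀ {a b : List H}, a.length ≠ b.length → wordInner a b = 0
  | [], [], h => absurd rfl h
  | [], _ :: _, _ => rfl
  | _ :: _, [], _ => rfl
  | _ :: a, _ :: b, h => by
    simp only [List.length_cons, ne_eq, add_left_inj] at h
    simp [wordInner, wordInner_eq_zero h]

theorem inner_linearCombination {ι : Type*} (f : ι → X) (x : ι →₀ ℂ) :
    ⟪Finsupp.linearCombination ℂ f x, Finsupp.linearCombination ℂ f x⟫_ℂ =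
      Finsupp.sum x fun a c => Finsupp.sum x fun b d => conj c * d * ⟪f a, f b⟫_ℂ := by
  simp only [Finsupp.linearCombination_apply, Finsupp.sum]
  rw [sum_inner]
  refine Finset.sum_congr rfl fun i _ => ?_
  rw [inner_sum]
  refine Finset.sum_congr rfl fun j _ => ?_
  rw [inner_smul_left, inner_smul_right]
  ring

/-- An operator on the Fock space is determined by a family of vectors indexed by words whose Gram
matrix is that of the elementary tensors, weighted by a function of the length of the words. -/
theorem exists_clm [CompleteSpace X] (f : List H → X) (c : ℕ → ℝ) (h1 : ∀ n, c n ≤ 1)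
    (h : ∀ a b, ⟪f a, f b⟫_ℂ = c a.length * wordInner a b) :
    ∃ A : Fock H →L[ℂ] X, ‖A‖ ≤ 1 ∧ ∀ a, A (tensor a) = f a := by
  -- The complementary family, with weight `1 - c`. The squared norms of the combinations of `f` and
  -- of `g` add up to that of the elementary tensors, so contractivity needs no separate positivity
  -- argument.
  let g : List H → Fock H := fun a => (Real.sqrt (1 - c a.length) : ℂ) • tensor a
  have hg : ∀ a b, ⟪g a, g b⟫_ℂ = (1 - c a.length) * wordInner a b := fun a b => by
    simp only [g]
    rw [inner_smul_left, inner_smul_right, inner_tensor]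
    by_cases hab : a.length = b.length
    · rw [← hab, Complex.conj_ofReal, ← mul_assoc, ← Complex.ofReal_mul,
        Real.mul_self_sqrt (sub_nonneg.2 (h1 _))]
      push_cast; ring
    · simp [wordInner_eq_zero hab]
  have key : ∀ x : PreFock H, ‖Finsupp.linearCombination ℂ f x‖ ≤ 1 * ‖(x : Fock H)‖ := fun x => by
    have e : ⟪Finsupp.linearCombination ℂ f x, Finsupp.linearCombination ℂ f x⟫_ℂ +
        ⟪Finsupp.linearCombination ℂ g x, Finsupp.linearCombination ℂ g x⟫_ℂ =
        ⟪(x : Fock H), (x : Fock H)⟫_ℂ := by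
      rw [inner_linearCombination, inner_linearCombination, UniformSpace.Completion.inner_coe,
        PreFock.inner_def, ← Finsupp.sum_add]
      refine Finsupp.sum_congr fun a _ => ?_
      rw [← Finsupp.sum_add]
      refine Finsupp.sum_congr fun b _ => ?_
      rw [h, hg]
      ring
    simp only [inner_self_eq_norm_sq_to_K] at e
    have e' : ‖Finsupp.linearCombination ℂ f x‖ ^ 2 + ‖Finsupp.linearCombination ℂ g x‖ ^ 2 =
        ‖(x : Fock H)‖ ^ 2 := by exact_mod_cast e
    rw [one_mul]
    exact le_of_sq_le_sq (by nlinarith [sq_nonneg ‖Finsupp.linearCombination ℂ g x‖])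
      (norm_nonneg _)
  let j : PreFock H →ₗ[ℂ] Fock H :=
    (UniformSpace.Completion.toComplL : PreFock H →L[ℂ] Fock H).toLinearMap
  have hj : DenseRange j := UniformSpace.Completion.denseRange_coe
  refine ⟨LinearMap.extendOfNorm (Finsupp.linearCombination ℂ f) j,
    LinearMap.opNorm_extendOfNorm_le hj zero_le_one key, fun a => ?_⟩
  refine (LinearMap.extendOfNorm_eq hj ⟨1, key⟩ (Finsupp.single a 1 : List H →₀ ℂ)).trans ?_
  simp

theorem tensor_cons (e : H) (a : List H) : tensor (e :: a) = creation e (tensor a) :=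
  (creation_tensor e a).symm

theorem norm_creation_le (ξ : H) : ‖creation ξ‖ ≤ ‖ξ‖ := by
  refine ContinuousLinearMap.opNorm_le_bound _ (norm_nonneg _) fun x => ?_
  refine UniformSpace.Completion.induction_on x (isClosed_le (by fun_prop) (by fun_prop)) fun y => ?_
  rw [creation, ContinuousLinearMap.completion_apply_coe, UniformSpace.Completion.norm_coe,
    UniformSpace.Completion.norm_coe]
  exact (PreFock.norm_consₗ ξ y).le

theorem creation_add (ξ η : H) : creation (ξ + η) = creation ξ + creation η := by
  refine clm_ext fun a => eq_of_inner_tensor fun b => ?_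
  rw [add_apply, inner_add_right]
  simp only [creation_tensor, inner_tensor]
  cases b <;> simp [wordInner, add_mul]

theorem creation_smul (c : ℂ) (ξ : H) : creation (c • ξ) = c • creation ξ := by
  refine clm_ext fun a => eq_of_inner_tensor fun b => ?_
  rw [smul_apply, inner_smul_right]
  simp only [creation_tensor, inner_tensor]
  cases b <;> simp [wordInner, mul_assoc]

/-- The creation operators as a continuous linear map. -/
noncomputable def creationL : H →L[ℂ] Fock H →L[ℂ] Fock H :=
  LinearMap.mkContinuous
    { toFun := creation, map_add' := creation_add, map_smul' := creation_smul } 1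
    fun ξ => by simpa using norm_creation_le ξ

@[simp] theorem creationL_apply (ξ : H) : creationL ξ = creation ξ := rfl

theorem inner_creation_left (ξ : H) (x y : Fock H) :
    ⟪creation ξ x, y⟫_ℂ = ⟪x, star (creation ξ) y⟫_ℂ :=
  (ContinuousLinearMap.adjoint_inner_right _ _ _).symm

theorem star_creation_nil (ξ : H) : star (creation ξ) (tensor []) = 0 := by
  refine eq_of_inner_tensor fun b => ?_
  rw [← inner_creation_left, creation_tensor, inner_tensor]
  simp [wordInner]

theorem star_creation_vacuum (ξ : H) : star (creation ξ) (vacuum H) = 0 := star_creation_nil ξ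

theorem star_creation_mul_creation (f e : H) :
    star (creation f) * creation e = ⟪f, e⟫_ℂ • (1 : Fock H →L[ℂ] Fock H) := by
  refine clm_ext fun a => eq_of_inner_tensor fun b => ?_
  change ⟪tensor b, star (creation f) (creation e (tensor a))⟫_ℂ =
    ⟪tensor b, ⟪f, e⟫_ℂ • tensor a⟫_ℂ
  rw [← inner_creation_left, creation_tensor, creation_tensor, inner_tensor, inner_smul_right,
    inner_tensor]
  rfl

theorem star_creation_cons (f e : H) (a : List H) :
    star (creation f) (tensor (e :: a)) = ⟪f, e⟫_ℂ • tensor a := by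
  rw [tensor_cons]
  exact congrArg (fun x : Fock H →L[ℂ] Fock H => x (tensor a)) (star_creation_mul_creation f e)

/-- A closed subspace that contains the elementary tensors of the vectors of a total set is the
whole Fock space. -/
theorem eq_top_of_tensor_mem (D : Set H) (hD : Dense (Submodule.span ℂ D : Set H))
    (V : Submodule ℂ (Fock H)) (hV : IsClosed (V : Set (Fock H)))
    (h : ∀ a : List H, (∀ e ∈ a, e ∈ D) → tensor a ∈ V) : V = ⊤ := by
  -- Quantifying over all closed subspaces lets the induction replace `W` by its preimage under a
  -- creation operator; the first letter is then reached by continuity of `e ↦ ℓ(e)`.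
  have key : ∀ (a : List H) (W : Submodule ℂ (Fock H)), IsClosed (W : Set (Fock H)) →
      (∀ b : List H, (∀ e ∈ b, e ∈ D) → tensor b ∈ W) → tensor a ∈ W := by
    intro a
    induction a with
    | nil => exact fun W _ hW => hW [] (by simp)
    | cons e a ih =>
      intro W hWc hW
      have h1 : ∀ d ∈ D, creation d (tensor a) ∈ W := fun d hd => by
        refine ih (W.comap (creation d).toLinearMap) (hWc.preimage (creation d).continuous)
          fun b hb => ?_
        change creation d (tensor b) ∈ W
        rw [creation_tensor]
        exact hW _ (by simpa [hd] using hb)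
      let φ : H →L[ℂ] Fock H := (ContinuousLinearMap.apply ℂ (Fock H) (tensor a)).comp creationL
      have h2 : Submodule.span ℂ D ≤ W.comap φ.toLinearMap := Submodule.span_le.2 h1
      have h3 : closure (Submodule.span ℂ D : Set H) ⊆ (W.comap φ.toLinearMap : Submodule ℂ H) :=
        closure_minimal h2 (hWc.preimage φ.continuous)
      have h4 := h3 (hD e)
      rw [tensor_cons]
      exact h4
  have h2 : Submodule.span ℂ (Set.range (tensor : List H → Fock H)) ≤ V :=
    Submodule.span_le.2 (by rintro _ ⟨a, rfl⟩; exact key a V hV h)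
  rw [eq_top_iff]
  intro x _
  exact closure_minimal h2 hV (dense_span_tensor x)

end Fock

/-! ### Amplifications and the completely bounded maps they define -/

section Amplification

variable {ι κ : Type*} {K : Type u} [NormedAddCommGroup K] [InnerProductSpace ℂ K]

theorem lp_two_norm_sq (f : lp (fun _ : ι => K) 2) : ‖f‖ ^ 2 = ∑' i, ‖f i‖ ^ 2 := by
  simpa using lp.norm_rpow_eq_tsum (p := 2) (by simp) f

theorem lp_two_summable (f : lp (fun _ : ι => K) 2) : Summable fun i => ‖f i‖ ^ 2 := by
  simpa using (lp.memℓp f).summable (by simp)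

theorem memℓp_two {f : ι → K} (h : Summable fun i => ‖f i‖ ^ 2) : Memℓp f 2 :=
  memℓp_gen (by simpa using h)

variable (ι) in
/-- The operator `x ⊗ 1` on `ℓ²(ι, K)`, as a continuous linear map. -/
noncomputable def ampCLM (x : K →L[ℂ] K) : lp (fun _ : ι => K) 2 →L[ℂ] lp (fun _ : ι => K) 2 :=
  have hs : ∀ (f : lp (fun _ : ι => K) 2) (i : ι), ‖x (f i)‖ ^ 2 ≤ ‖x‖ ^ 2 * ‖f i‖ ^ 2 :=
    fun f i => by
      rw [← mul_pow]
      exact pow_le_pow_left₀ (norm_nonneg _) (x.le_opNorm _) 2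
  have hm : ∀ f : lp (fun _ : ι => K) 2, Summable fun i => ‖x (f i)‖ ^ 2 := fun f =>
    Summable.of_nonneg_of_le (fun _ => by positivity) (hs f) ((lp_two_summable f).mul_left _)
  LinearMap.mkContinuous
    { toFun := fun f => ⟨fun i => x (f i), memℓp_two (hm f)⟩
      map_add' := fun f g => lp.ext (funext fun i => x.map_add (f i) (g i))
      map_smul' := fun c f => lp.ext (funext fun i => x.map_smul c (f i)) }
    ‖x‖ fun f => by
      refine le_of_sq_le_sq ?_ (by positivity)
      rw [mul_pow, lp_two_norm_sq, lp_two_norm_sq, ← tsum_mul_left]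
      exact (hm f).tsum_le_tsum (hs f) ((lp_two_summable f).mul_left _)

variable [CompleteSpace K]

variable (ι K) in
/-- The amplification `x ↦ x ⊗ 1` from `B(K)` to the operators on `ℓ²(ι, K)`. -/
noncomputable def amp : (K →L[ℂ] K) →⋆ₐ[ℂ]
    (lp (fun _ : ι => K) 2 →L[ℂ] lp (fun _ : ι => K) 2) where
  toFun := ampCLM ι
  map_one' := rfl
  map_mul' _ _ := rfl
  map_zero' := rfl
  map_add' _ _ := rfl
  commutes' _ := rfl
  map_star' x := by
    refine ContinuousLinearMap.eq_adjoint_iff _ _ |>.2 fun f g => ?_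
    rw [lp.inner_eq_tsum, lp.inner_eq_tsum]
    exact tsum_congr fun i => ContinuousLinearMap.adjoint_inner_left _ _ _

@[simp] theorem amp_apply (x : K →L[ℂ] K) (f : lp (fun _ : ι => K) 2) (i : ι) :
    amp ι K x f i = x (f i) := rfl

theorem amp_norm_le (x : K →L[ℂ] K) : ‖amp ι K x‖ ≤ ‖x‖ :=
  NonUnitalStarAlgHom.norm_apply_le (amp ι K) x

/-- The map `x ↦ A^* (x ⊗ 1) B`. -/
noncomputable def sandwich (A B : K →L[ℂ] lp (fun _ : ι => K) 2) :
    (K →L[ℂ] K) →ₗ[ℂ] (K →L[ℂ] K) where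
  toFun x := ContinuousLinearMap.adjoint A ∘L amp ι K x ∘L B
  map_add' x y := by ext v; simp
  map_smul' c x := by ext v; simp

theorem sandwich_apply (A B : K →L[ℂ] lp (fun _ : ι => K) 2) (x : K →L[ℂ] K) :
    sandwich A B x = ContinuousLinearMap.adjoint A ∘L amp ι K x ∘L B := rfl

theorem inner_sandwich (A B : K →L[ℂ] lp (fun _ : ι => K) 2) (x : K →L[ℂ] K) (u v : K) :
    ⟪u, sandwich A B x v⟫_ℂ = ⟪A u, amp ι K x (B v)⟫_ℂ :=
  ContinuousLinearMap.adjoint_inner_right A u (amp ι K x (B v))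

theorem star_sandwich (A B : K →L[ℂ] lp (fun _ : ι => K) 2) (x : K →L[ℂ] K) :
    star (sandwich A B x) = sandwich B A (star x) := by
  rw [sandwich_apply, sandwich_apply, map_star, ContinuousLinearMap.star_eq_adjoint,
    ContinuousLinearMap.star_eq_adjoint, ContinuousLinearMap.adjoint_comp,
    ContinuousLinearMap.adjoint_comp, ContinuousLinearMap.adjoint_adjoint,
    ContinuousLinearMap.comp_assoc]

/-! #### Ultraweak continuity -/

/-- A square summable family has countable support, so an arbitrary index set reduces to the
sequences in the definition of the topology; entries where `ξ` vanishes do not matter. -/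
theorem continuous_ultraweak_functional (η ξ : lp (fun _ : ι => K) 2) :
    Continuous[ultraweakTopology K, inferInstance]
      fun x : K →L[ℂ] K => ∑' i, ⟪η i, x (ξ i)⟫_ℂ := by
  let s : Set ι := Function.support fun i => ‖ξ i‖ ^ 2
  have hs : s.Countable := (lp_two_summable ξ).countable_support
  have : Countable s := hs
  obtain ⟨e, hinj⟩ := exists_injective_nat s
  have hsum : ∀ f : lp (fun _ : ι => K) 2,
      Memℓp (Function.extend e (fun i : s => f i) 0 : ℕ → K) 2 := fun f => by
    refine memℓp_two ?_
    have h1 : (fun n => ‖Function.extend e (fun i : s => f i) 0 n‖ ^ 2) =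
        Function.extend e (fun i : s => ‖f i‖ ^ 2) 0 := by
      funext n
      by_cases hn : ∃ i : s, e i = n
      · obtain ⟨i, rfl⟩ := hn
        rw [hinj.extend_apply (fun i : s => f i) 0 i,
          hinj.extend_apply (fun i : s => ‖f i‖ ^ 2) 0 i]
      · rw [Function.extend_apply' _ _ _ hn, Function.extend_apply' _ _ _ hn]
        simp
    rw [h1]
    exact (summable_extend_zero hinj).2 ((lp_two_summable f).subtype s)
  have key : ∀ x : K →L[ℂ] K, (∑' i, ⟪η i, x (ξ i)⟫_ℂ) =
      ∑' n, ⟪(⟨_, hsum η⟩ : lp (fun _ : ℕ => K) 2) n, x ((⟨_, hsum ξ⟩ : lp (fun _ : ℕ => K) 2) n)⟫_ℂ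
      := fun x => by
    rw [← tsum_subtype_eq_of_support_subset (s := s), ← tsum_extend_zero hinj]
    · refine tsum_congr fun n => ?_
      by_cases hn : ∃ i : s, e i = n
      · obtain ⟨i, rfl⟩ := hn
        change _ = ⟪Function.extend e (fun i : s => η i) 0 (e i),
          x (Function.extend e (fun i : s => ξ i) 0 (e i))⟫_ℂ
        rw [hinj.extend_apply (fun i : s => η i) 0 i, hinj.extend_apply (fun i : s => ξ i) 0 i,
          hinj.extend_apply (fun i : s => ⟪η i, x (ξ i)⟫_ℂ) 0 i]
      · change _ = ⟪Function.extend e (fun i : s => η i) 0 n, _⟫_ℂ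
        rw [Function.extend_apply' _ _ _ hn, Function.extend_apply' _ _ _ hn]
        simp
    · intro i hi
      simp only [s, Function.mem_support] at hi ⊢
      contrapose! hi
      have : ξ i = 0 := by simpa using hi
      simp [this]
  rw [show (fun x : K →L[ℂ] K => ∑' i, ⟪η i, x (ξ i)⟫_ℂ) = _ from funext key]
  exact continuous_iInf_dom (i := ((⟨_, hsum ξ⟩, ⟨_, hsum η⟩) :
    lp (fun _ : ℕ => K) 2 × lp (fun _ : ℕ => K) 2)) continuous_induced_dom

/-- The vector of `ℓ²(κ × ι, K)` obtained by applying `B : K → ℓ²(ι, K)` to the entries of a vector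
of `ℓ²(κ, K)`. -/
noncomputable def lpProd (B : K →L[ℂ] lp (fun _ : ι => K) 2) (ξ : lp (fun _ : κ => K) 2) :
    lp (fun _ : κ × ι => K) 2 :=
  ⟨fun p => B (ξ p.1) p.2, memℓp_two <| by
    refine (summable_prod_of_nonneg (fun _ => by positivity)).2
      ⟨fun k => lp_two_summable (B (ξ k)), ?_⟩
    simp only [← lp_two_norm_sq]
    refine Summable.of_nonneg_of_le (fun _ => by positivity) (fun k => ?_)
      ((lp_two_summable ξ).mul_left (‖B‖ ^ 2))
    rw [← mul_pow]
    exact pow_le_pow_left₀ (norm_nonneg _) (B.le_opNorm _) 2⟩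

/-- The reason why such maps are normal: an ultraweak functional composed with one is again an
ultraweak functional, with index set `κ × ι`. -/
theorem tsum_inner_sandwich (A B : K →L[ℂ] lp (fun _ : ι => K) 2) (η ξ : lp (fun _ : κ => K) 2)
    (x : K →L[ℂ] K) :
    ∑' k, ⟪η k, sandwich A B x (ξ k)⟫_ℂ = ∑' p, ⟪lpProd A η p, x (lpProd B ξ p)⟫_ℂ := by
  have h : Summable fun p => ⟪lpProd A η p, x (lpProd B ξ p)⟫_ℂ :=
    lp.summable_inner (lpProd A η) (amp (κ × ι) K x (lpProd B ξ))
  rw [h.tsum_prod]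
  refine tsum_congr fun k => ?_
  rw [inner_sandwich, lp.inner_eq_tsum]
  rfl

/-! #### Matrices of operators -/

theorem matrixOp_apply {n : ℕ} (X : Matrix (Fin n) (Fin n) (K →L[ℂ] K))
    (v : PiLp 2 (fun _ : Fin n => K)) (i : Fin n) : matrixOp X v i = ∑ j, X i j (v j) := by
  simp [matrixOp]

/-- The operator `K ⊕ ⋯ ⊕ K → ℓ²(ι, K ⊕ ⋯ ⊕ K)` that acts as `A` on each summand. -/
noncomputable def columnOp (n : ℕ) (A : K →L[ℂ] lp (fun _ : ι => K) 2) :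
    PiLp 2 (fun _ : Fin n => K) →L[ℂ] lp (fun _ : ι => PiLp 2 (fun _ : Fin n => K)) 2 :=
  have hs : ∀ v : PiLp 2 (fun _ : Fin n => K), (fun i : ι =>
      ‖(WithLp.toLp 2 fun j => A (v j) i : PiLp 2 (fun _ : Fin n => K))‖ ^ 2) =
      fun i => ∑ j, ‖A (v j) i‖ ^ 2 := fun v => funext fun i => by
    rw [PiLp.norm_sq_eq_of_L2]
  have hm : ∀ v : PiLp 2 (fun _ : Fin n => K), Summable (fun i : ι =>
      ‖(WithLp.toLp 2 fun j => A (v j) i : PiLp 2 (fun _ : Fin n => K))‖ ^ 2) := fun v => by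
    rw [hs]
    exact summable_sum fun j _ => lp_two_summable (A (v j))
  LinearMap.mkContinuous
    { toFun := fun v => ⟨fun i => WithLp.toLp 2 fun j => A (v j) i, memℓp_two (hm v)⟩
      map_add' := fun v w => lp.ext (funext fun i => by
        ext j; exact congrArg (fun f : lp (fun _ => K) 2 => f i) (A.map_add (v j) (w j)))
      map_smul' := fun c v => lp.ext (funext fun i => by
        ext j; exact congrArg (fun f : lp (fun _ => K) 2 => f i) (A.map_smul c (v j))) }
    ‖A‖ fun v => by
      refine le_of_sq_le_sq ?_ (by positivity)
      rw [mul_pow, lp_two_norm_sq, PiLp.norm_sq_eq_of_L2, Finset.mul_sum]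
      refine (congrArg tsum (hs v)).trans_le ?_
      rw [Summable.tsum_finsetSum fun j _ => lp_two_summable (A (v j))]
      refine Finset.sum_le_sum fun j _ => ?_
      rw [← lp_two_norm_sq, ← mul_pow]
      exact pow_le_pow_left₀ (norm_nonneg _) (A.le_opNorm _) 2

theorem columnOp_norm_le (n : ℕ) (A : K →L[ℂ] lp (fun _ : ι => K) 2) : ‖columnOp n A‖ ≤ ‖A‖ := by
  unfold columnOp
  exact LinearMap.mkContinuous_norm_le _ (norm_nonneg A) _

/-- Matrix amplification keeps the form `A^* (x ⊗ 1) B`, with column operators of no larger norm.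
Both the completely bounded estimate and complete positivity follow from this. -/
theorem matrixOp_sandwich {n : ℕ} (A B : K →L[ℂ] lp (fun _ : ι => K) 2)
    (X : Matrix (Fin n) (Fin n) (K →L[ℂ] K)) :
    matrixOp (X.map (sandwich A B)) = ContinuousLinearMap.adjoint (columnOp n A) ∘L
      amp ι (PiLp 2 (fun _ : Fin n => K)) (matrixOp X) ∘L columnOp n B := by
  refine ContinuousLinearMap.ext fun v => ext_inner_left ℂ fun u => ?_
  rw [ContinuousLinearMap.comp_apply, ContinuousLinearMap.adjoint_inner_right,
    ContinuousLinearMap.comp_apply, lp.inner_eq_tsum, PiLp.inner_apply]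
  have h1 : ∀ i j, HasSum (fun k => ⟪A (u i) k, X i j (B (v j) k)⟫_ℂ)
      ⟪u i, sandwich A B (X i j) (v j)⟫_ℂ := fun i j => by
    rw [inner_sandwich]
    exact lp.hasSum_inner (A (u i)) (amp ι K (X i j) (B (v j)))
  have h2 : HasSum (fun k => ∑ i, ∑ j, ⟪A (u i) k, X i j (B (v j) k)⟫_ℂ)
      (∑ i, ∑ j, ⟪u i, sandwich A B (X i j) (v j)⟫_ℂ) :=
    hasSum_sum fun i _ => hasSum_sum fun j _ => h1 i j
  have h3 : ∀ k, ⟪columnOp n A u k,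
      amp ι (PiLp 2 (fun _ : Fin n => K)) (matrixOp X) (columnOp n B v) k⟫_ℂ =
      ∑ i, ∑ j, ⟪A (u i) k, X i j (B (v j) k)⟫_ℂ := fun k => by
    rw [PiLp.inner_apply]
    refine Finset.sum_congr rfl fun i _ => ?_
    rw [amp_apply, matrixOp_apply, inner_sum]
    rfl
  rw [tsum_congr h3, h2.tsum_eq]
  refine Finset.sum_congr rfl fun i _ => ?_
  rw [matrixOp_apply, inner_sum]
  rfl

theorem norm_matrixOp_sandwich_le {n : ℕ} (A B : K →L[ℂ] lp (fun _ : ι => K) 2)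
    (X : Matrix (Fin n) (Fin n) (K →L[ℂ] K)) :
    ‖matrixOp (X.map (sandwich A B))‖ ≤ ‖A‖ * ‖B‖ * ‖matrixOp X‖ := by
  rw [matrixOp_sandwich]
  calc _ ≤ ‖ContinuousLinearMap.adjoint (columnOp n A)‖ *
        (‖amp ι (PiLp 2 (fun _ : Fin n => K)) (matrixOp X)‖ * ‖columnOp n B‖) :=
        (ContinuousLinearMap.opNorm_comp_le _ _).trans (by
          gcongr; exact ContinuousLinearMap.opNorm_comp_le _ _)
    _ ≤ ‖A‖ * (‖matrixOp X‖ * ‖B‖) := by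
        rw [LinearIsometryEquiv.norm_map]
        gcongr
        · exact columnOp_norm_le n A
        · exact amp_norm_le _
        · exact columnOp_norm_le n B
    _ = _ := by ring

theorem isPositive_matrixOp_sandwich {n : ℕ} (A : K →L[ℂ] lp (fun _ : ι => K) 2)
    (X : Matrix (Fin n) (Fin n) (K →L[ℂ] K)) (hX : (matrixOp X).IsPositive) :
    (matrixOp (X.map (sandwich A A))).IsPositive := by
  rw [matrixOp_sandwich]
  refine ContinuousLinearMap.IsPositive.adjoint_conj ?_ _
  rw [← ContinuousLinearMap.nonneg_iff_isPositive] at hX ⊢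
  exact map_nonneg (amp ι _) hX

end Amplification

/-! ### Completely bounded maps of a von Neumann algebra -/

namespace VonNeumannAlgebra

variable {K : Type u} [NormedAddCommGroup K] [InnerProductSpace ℂ K] [CompleteSpace K]
variable {N : VonNeumannAlgebra K}

/-- The amplifications of `Φ` to matrices over `N` are bounded by `C`. -/
def IsCBBound (Φ : N.Elem →ₗ[ℂ] N.Elem) (C : ℝ) : Prop :=
  ∀ (n : ℕ) (x : Matrix (Fin n) (Fin n) N.Elem), ‖matrixOp (x.map Φ)‖ ≤ C * ‖matrixOp x‖

theorem IsCBBound.cbNorm_le {Φ : N.Elem →ₗ[ℂ] N.Elem} {C : ℝ} (hC : 0 ≤ C) (h : IsCBBound Φ C) :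
    cbNorm Φ ≤ ENNReal.ofReal C := by
  refine iSup_le fun n => iSup_le fun x => iSup_le fun hx => ?_
  rw [← ofReal_norm]
  refine ENNReal.ofReal_le_ofReal ((h n x).trans ?_)
  exact mul_le_of_le_one_right hC hx

theorem matrixOp_apply {n : ℕ} (x : Matrix (Fin n) (Fin n) N.Elem)
    (v : PiLp 2 (fun _ : Fin n => K)) (i : Fin n) :
    matrixOp x v i = ∑ j, (x i j : K →L[ℂ] K) (v j) :=
  _root_.matrixOp_apply _ v i

theorem matrixOp_smul {n : ℕ} (c : ℂ) (x : Matrix (Fin n) (Fin n) N.Elem) :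
    matrixOp (c • x) = c • matrixOp x := by
  ext v i
  simp [matrixOp_apply, Finset.smul_sum]

theorem IsCBBound.smul {Φ : N.Elem →ₗ[ℂ] N.Elem} {C : ℝ} (c : ℂ) (h : IsCBBound Φ C) :
    IsCBBound (c • Φ) (‖c‖ * C) := fun n x => by
  have : x.map (c • Φ) = c • x.map Φ := by ext; rfl
  rw [this, matrixOp_smul, norm_smul, mul_assoc]
  exact mul_le_mul_of_nonneg_left (h n x) (norm_nonneg _)

theorem IsCBBound.comp {Φ Ψ : N.Elem →ₗ[ℂ] N.Elem} {C D : ℝ} (hC : 0 ≤ C) (h : IsCBBound Φ C)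
    (h' : IsCBBound Ψ D) : IsCBBound (Φ ∘ₗ Ψ) (C * D) := fun n x => by
  have : x.map (Φ ∘ₗ Ψ) = (x.map Ψ).map Φ := by ext; rfl
  rw [this, mul_assoc]
  exact (h n _).trans (mul_le_mul_of_nonneg_left (h' n x) hC)

theorem matrixOp_one_fin_apply (x : N.Elem) (v : PiLp 2 (fun _ : Fin 1 => K)) :
    matrixOp (Matrix.of fun _ _ => x : Matrix (Fin 1) (Fin 1) N.Elem) v =
      WithLp.toLp 2 fun i => (x : K →L[ℂ] K) (v i) := by
  ext i
  rw [matrixOp_apply]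
  simp [Subsingleton.elim i 0]

theorem norm_matrixOp_one_fin (x : N.Elem) :
    ‖matrixOp (Matrix.of fun _ _ => x : Matrix (Fin 1) (Fin 1) N.Elem)‖ = ‖(x : K →L[ℂ] K)‖ := by
  refine le_antisymm ?_ ?_
  · refine ContinuousLinearMap.opNorm_le_bound _ (norm_nonneg _) fun v => ?_
    refine le_of_sq_le_sq ?_ (by positivity)
    rw [matrixOp_one_fin_apply, mul_pow, PiLp.norm_sq_eq_of_L2, PiLp.norm_sq_eq_of_L2]
    simp only [Finset.univ_unique, Finset.sum_singleton, ← mul_pow]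
    exact pow_le_pow_left₀ (norm_nonneg _) (ContinuousLinearMap.le_opNorm _ _) 2
  · refine ContinuousLinearMap.opNorm_le_bound _ (norm_nonneg _) fun v => ?_
    have h := (matrixOp (Matrix.of fun _ _ => x : Matrix (Fin 1) (Fin 1) N.Elem)).le_opNorm
      (WithLp.toLp 2 fun _ => v)
    rw [matrixOp_one_fin_apply] at h
    have hn : ∀ w : K, ‖(WithLp.toLp 2 fun _ => w : PiLp 2 (fun _ : Fin 1 => K))‖ = ‖w‖ := fun w => by
      rw [PiLp.norm_eq_of_L2]
      simp
    rw [hn v] at h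
    exact (hn _).ge.trans h

theorem IsCBBound.norm_le {Φ : N.Elem →ₗ[ℂ] N.Elem} {C : ℝ} (h : IsCBBound Φ C) (x : N.Elem) :
    ‖(Φ x : K →L[ℂ] K)‖ ≤ C * ‖(x : K →L[ℂ] K)‖ := by
  have := h 1 (Matrix.of fun _ _ => x)
  rwa [norm_matrixOp_one_fin, show (Matrix.map (Matrix.of fun _ _ => x : Matrix (Fin 1) (Fin 1) N.Elem) Φ) =
    Matrix.of fun _ _ => Φ x from rfl, norm_matrixOp_one_fin] at this

/-- The lower half of the limits of completely bounded norms: all the maps used are unital, so only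
upper estimates remain to be found. -/
theorem one_le_cbNorm [Nontrivial K] {Φ : N.Elem →ₗ[ℂ] N.Elem} (h : Φ 1 = 1) : 1 ≤ cbNorm Φ := by
  have h1 : ‖matrixOp (Matrix.of fun _ _ => 1 : Matrix (Fin 1) (Fin 1) N.Elem)‖ = 1 := by
    rw [norm_matrixOp_one_fin]
    exact norm_one
  refine le_trans ?_ (le_iSup_of_le 1 (le_iSup_of_le (Matrix.of fun _ _ => 1) (le_iSup_of_le h1.le le_rfl)))
  rw [show (Matrix.map (Matrix.of fun _ _ => 1 : Matrix (Fin 1) (Fin 1) N.Elem) Φ) =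
    Matrix.of fun _ _ => 1 from funext fun _ => funext fun _ => h, ← ofReal_norm, h1]
  simp

theorem IsNormalMap.comp {Φ Ψ : N.Elem →ₗ[ℂ] N.Elem} (h : IsNormalMap Φ) (h' : IsNormalMap Ψ) :
    IsNormalMap (Φ ∘ₗ Ψ) :=
  @Continuous.comp _ _ _ N.ultraweak N.ultraweak N.ultraweak Ψ Φ h h'

theorem isNormalMap_iff {Φ : N.Elem →ₗ[ℂ] N.Elem} :
    IsNormalMap Φ ↔ ∀ η ξ : lp (fun _ : ℕ => K) 2, Continuous[N.ultraweak, inferInstance]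
      fun x => ∑' n, ⟪η n, (Φ x : K →L[ℂ] K) (ξ n)⟫_ℂ := by
  refine Iff.trans (continuous_induced_rng (t₂ := ultraweakTopology K)) ?_
  refine Iff.trans continuous_iInf_rng ?_
  refine ⟨fun h η ξ => ?_, fun h p => continuous_induced_rng.2 (h p.2 p.1)⟩
  exact continuous_induced_rng.1 (h (ξ, η))

theorem summable_inner_apply (η ξ : lp (fun _ : ℕ => K) 2) (x : K →L[ℂ] K) :
    Summable fun n => ⟪η n, x (ξ n)⟫_ℂ :=
  lp.summable_inner η (amp ℕ K x ξ)

theorem IsNormalMap.smul {Φ : N.Elem →ₗ[ℂ] N.Elem} (c : ℂ) (h : IsNormalMap Φ) :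
    IsNormalMap (c • Φ) := by
  rw [isNormalMap_iff] at *
  intro η ξ
  let _ := N.ultraweak
  refine ((h η ξ).const_mul c).congr fun x => ?_
  refine tsum_mul_left.symm.trans (tsum_congr fun n => ?_)
  exact (inner_smul_right _ _ _).symm

end VonNeumannAlgebra

/-! ### Ultraweakly continuous maps and generated von Neumann algebras -/

section Density

variable {K : Type u} [NormedAddCommGroup K] [InnerProductSpace ℂ K] [CompleteSpace K]

theorem VonNeumannAlgebra.mem_generated_iff {𝒮 : Set (K →L[ℂ] K)} {x : K →L[ℂ] K} :
    x ∈ (VonNeumannAlgebra.generated 𝒮).toStarSubalgebra ↔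
      ∀ y ∈ StarSubalgebra.centralizer ℂ 𝒮, y * x = x * y := by
  refine (StarSubalgebra.mem_centralizer_iff ℂ).trans ⟨fun h y hy => (h y hy).1, fun h y hy => ?_⟩
  exact ⟨h y hy, h _ (star_mem hy)⟩

theorem VonNeumannAlgebra.subset_generated {𝒮 : Set (K →L[ℂ] K)} {x : K →L[ℂ] K} (hx : x ∈ 𝒮) :
    x ∈ (VonNeumannAlgebra.generated 𝒮).toStarSubalgebra :=
  mem_generated_iff.2 fun _ hy => (((StarSubalgebra.mem_centralizer_iff ℂ).1 hy x hx).1).symm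

/-- An operator of the bicommutant of a set of selfadjoint operators is approximated, on each
vector of an amplification, by the elements of any linear space that contains the identity and is
stable under left multiplication by the elements of that set. -/
theorem amp_mem_topologicalClosure {ι : Type*} {𝒮 : Set (K →L[ℂ] K)}
    (hsa : ∀ s ∈ 𝒮, IsSelfAdjoint s) (𝒲 : Submodule ℂ (K →L[ℂ] K)) (h1 : 1 ∈ 𝒲)
    (hmul : ∀ s ∈ 𝒮, ∀ w ∈ 𝒲, s * w ∈ 𝒲) {x : K →L[ℂ] K}
    (hx : x ∈ (VonNeumannAlgebra.generated 𝒮).toStarSubalgebra) (ξ : lp (fun _ : ι => K) 2) :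
    amp ι K x ξ ∈ (𝒲.map ((ContinuousLinearMap.apply ℂ _ ξ).toLinearMap ∘ₗ
      (amp ι K).toAlgHom.toLinearMap)).topologicalClosure := by
  classical
  set V := (𝒲.map ((ContinuousLinearMap.apply ℂ _ ξ).toLinearMap ∘ₗ
      (amp ι K).toAlgHom.toLinearMap)).topologicalClosure with hV
  have : CompleteSpace V := (Submodule.isClosed_topologicalClosure _).completeSpace_coe
  have hstable : ∀ s ∈ 𝒮, ∀ v ∈ V, amp ι K s v ∈ V := fun s hs v hv => by
    have hc : IsClosed ((amp ι K s) ⁻¹' (V : Set (lp (fun _ : ι => K) 2))) :=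
      (Submodule.isClosed_topologicalClosure _).preimage (amp ι K s).continuous
    refine closure_minimal ?_ hc hv
    rintro _ ⟨w, hw, rfl⟩
    refine Submodule.le_topologicalClosure _ ⟨s * w, hmul s hs w hw, ?_⟩
    change amp ι K (s * w) ξ = amp ι K s (amp ι K w ξ)
    rw [map_mul]
    rfl
  have hcomm : ∀ s ∈ 𝒮, ∀ v, V.starProjection (amp ι K s v) = amp ι K s (V.starProjection v) :=
    fun s hs v => by
    refine Submodule.eq_starProjection_of_mem_orthogonal
      (hstable s hs _ (Submodule.starProjection_apply_mem _ _)) ?_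
    rw [← map_sub, Submodule.mem_orthogonal]
    intro u hu
    have e : star (amp ι K s) = amp ι K s := by rw [← map_star, (hsa s hs).star_eq]
    rw [← e, ContinuousLinearMap.star_eq_adjoint, ContinuousLinearMap.adjoint_inner_right]
    exact Submodule.inner_right_of_mem_orthogonal (hstable s hs u hu)
      (Submodule.sub_starProjection_mem_orthogonal v)
  have hsing : ∀ (j : ι) (s : K →L[ℂ] K) (b : K), (lp.single 2 j (s b) : lp (fun _ : ι => K) 2) =
      amp ι K s (lp.single 2 j b) := fun j s b => by
    refine lp.ext (funext fun k => ?_)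
    rw [amp_apply]
    by_cases hk : k = j
    · subst hk; simp
    · rw [lp.single_apply_ne _ _ _ hk, lp.single_apply_ne _ _ _ hk, map_zero]
  -- The projection onto the stable subspace `V` commutes with each `s ⊗ 1`, so its matrix entries
  -- lie in the commutant of `𝒮` and therefore commute with `x`. This is the double commutant
  -- argument in an amplification.
  have hentry : ∀ i j (a : K), (V.starProjection (lp.single 2 j (x a))) i =
      x (V.starProjection (lp.single 2 j a) i) := fun i j a => by
    let y : K →L[ℂ] K := lp.evalCLM ℂ (fun _ : ι => K) 2 i ∘L V.starProjection ∘L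
      lp.singleContinuousLinearMap ℂ (fun _ : ι => K) 2 j
    have hy : ∀ s ∈ 𝒮, s * y = y * s := fun s hs => by
      ext b
      change s ((V.starProjection (lp.single 2 j b)) i) = V.starProjection (lp.single 2 j (s b)) i
      rw [hsing, hcomm s hs, amp_apply]
    have hyc : y ∈ StarSubalgebra.centralizer ℂ 𝒮 :=
      (StarSubalgebra.mem_centralizer_iff ℂ).2 fun s hs =>
        ⟨hy s hs, by rw [(hsa s hs).star_eq]; exact hy s hs⟩
    exact congrArg (fun T : K →L[ℂ] K => T a) (VonNeumannAlgebra.mem_generated_iff.1 hx y hyc)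
  have hcommx : V.starProjection ∘L amp ι K x = amp ι K x ∘L V.starProjection := by
    refine lp.ext_continuousLinearMap (by simp) fun j => ?_
    ext a i
    change V.starProjection (amp ι K x (lp.single 2 j a)) i =
      x (V.starProjection (lp.single 2 j a) i)
    rw [← hentry, hsing]
  have hξ : ξ ∈ V := Submodule.le_topologicalClosure _ ⟨1, h1, by
    change amp ι K 1 ξ = ξ
    rw [map_one]; rfl⟩
  have h2 := congrArg (fun T : lp (fun _ : ι => K) 2 →L[ℂ] lp (fun _ : ι => K) 2 => T ξ) hcommx
  simp only [ContinuousLinearMap.comp_apply, Submodule.starProjection_eq_self_iff.2 hξ] at h2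
  exact Submodule.starProjection_eq_self_iff.1 h2

/-- Functionals of the form `x ↦ ⟨η, (x ⊗ 1) ξ⟩`. -/
def IsUltraweakFunctional (f : (K →L[ℂ] K) → ℂ) : Prop :=
  ∃ (ι : Type u) (η ξ : lp (fun _ : ι => K) 2), ∀ x, f x = ⟪η, amp ι K x ξ⟫_ℂ

theorem IsUltraweakFunctional.add {f g : (K →L[ℂ] K) → ℂ} (hf : IsUltraweakFunctional f)
    (hg : IsUltraweakFunctional g) : IsUltraweakFunctional fun x => f x + g x := by
  obtain ⟨ι, η, ξ, h⟩ := hf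
  obtain ⟨ι', η', ξ', h'⟩ := hg
  have hs : ∀ (a : lp (fun _ : ι => K) 2) (b : lp (fun _ : ι' => K) 2),
      Memℓp (Sum.elim a b : ι ⊕ ι' → K) 2 := fun a b =>
    memℓp_two (Summable.sum _ (lp_two_summable a) (lp_two_summable b))
  refine ⟨ι ⊕ ι', ⟨_, hs η η'⟩, ⟨_, hs ξ ξ'⟩, fun x => ?_⟩
  rw [lp.inner_eq_tsum]
  refine (congrArg₂ (· + ·) (h x) (h' x)).trans (HasSum.tsum_eq ?_).symm
  exact HasSum.sum (lp.hasSum_inner η (amp ι K x ξ)) (lp.hasSum_inner η' (amp ι' K x ξ'))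

theorem IsUltraweakFunctional.smul {f : (K →L[ℂ] K) → ℂ} (c : ℂ) (hf : IsUltraweakFunctional f) :
    IsUltraweakFunctional fun x => c * f x := by
  obtain ⟨ι, η, ξ, h⟩ := hf
  exact ⟨ι, η, c • ξ, fun x =>
    by rw [map_smul, inner_smul_right, ← h]⟩

theorem IsUltraweakFunctional.eq_zero {𝒮 : Set (K →L[ℂ] K)} (hsa : ∀ s ∈ 𝒮, IsSelfAdjoint s)
    (𝒲 : Submodule ℂ (K →L[ℂ] K)) (h1 : 1 ∈ 𝒲) (hmul : ∀ s ∈ 𝒮, ∀ w ∈ 𝒲, s * w ∈ 𝒲)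
    {f : (K →L[ℂ] K) → ℂ} (hf : IsUltraweakFunctional f) (h0 : ∀ w ∈ 𝒲, f w = 0)
    {x : K →L[ℂ] K} (hx : x ∈ (VonNeumannAlgebra.generated 𝒮).toStarSubalgebra) : f x = 0 := by
  obtain ⟨ι, η, ξ, h⟩ := hf
  have hc : IsClosed {v : lp (fun _ : ι => K) 2 | ⟪η, v⟫_ℂ = 0} :=
    isClosed_eq (by fun_prop) continuous_const
  rw [h]
  refine closure_minimal ?_ hc (amp_mem_topologicalClosure hsa 𝒲 h1 hmul hx ξ)
  rintro _ ⟨w, hw, rfl⟩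
  exact (h w).symm.trans (h0 w hw)

/-- Maps all of whose matrix coefficients are ultraweakly continuous functionals. -/
def IsUltraweakMap (Φ : (K →L[ℂ] K) →ₗ[ℂ] (K →L[ℂ] K)) : Prop :=
  ∀ u v : K, IsUltraweakFunctional fun x => ⟪u, Φ x v⟫_ℂ

theorem isUltraweakMap_sandwich {ι : Type u} (A B : K →L[ℂ] lp (fun _ : ι => K) 2) :
    IsUltraweakMap (sandwich A B) := fun u v =>
  ⟨ι, A u, B v, fun x => inner_sandwich A B x u v⟩

theorem IsUltraweakMap.add {Φ Ψ : (K →L[ℂ] K) →ₗ[ℂ] (K →L[ℂ] K)} (h : IsUltraweakMap Φ)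
    (h' : IsUltraweakMap Ψ) : IsUltraweakMap (Φ + Ψ) := fun u v => by
  convert (h u v).add (h' u v) using 2 with x
  simp

theorem IsUltraweakMap.smul {Φ : (K →L[ℂ] K) →ₗ[ℂ] (K →L[ℂ] K)} (c : ℂ) (h : IsUltraweakMap Φ) :
    IsUltraweakMap (c • Φ) := fun u v => by
  convert (h u v).smul c using 2 with x
  simp

/-- For `y` in the commutant, the coefficients of `y Φ(z) - Φ(z) y` are ultraweak functionals of `z`
that vanish on `𝒲`, hence on the whole generated algebra. -/
theorem IsUltraweakMap.map_mem {𝒮 : Set (K →L[ℂ] K)} (hsa : ∀ s ∈ 𝒮, IsSelfAdjoint s)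
    (𝒲 : Submodule ℂ (K →L[ℂ] K)) (h1 : 1 ∈ 𝒲) (hmul : ∀ s ∈ 𝒮, ∀ w ∈ 𝒲, s * w ∈ 𝒲)
    {Φ : (K →L[ℂ] K) →ₗ[ℂ] (K →L[ℂ] K)} (hΦ : IsUltraweakMap Φ)
    (h : ∀ w ∈ 𝒲, Φ w ∈ (VonNeumannAlgebra.generated 𝒮).toStarSubalgebra)
    {x : K →L[ℂ] K} (hx : x ∈ (VonNeumannAlgebra.generated 𝒮).toStarSubalgebra) :
    Φ x ∈ (VonNeumannAlgebra.generated 𝒮).toStarSubalgebra := by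
  refine VonNeumannAlgebra.mem_generated_iff.2 fun y hy => ?_
  refine ContinuousLinearMap.ext fun v => ext_inner_left ℂ fun u => ?_
  have hf : IsUltraweakFunctional fun z => ⟪star y u, Φ z v⟫_ℂ + (-1) * ⟪u, Φ z (y v)⟫_ℂ :=
    (hΦ _ _).add ((hΦ _ _).smul _)
  have hstar : ∀ z, ⟪star y u, z⟫_ℂ = ⟪u, y z⟫_ℂ := fun z => by
    rw [ContinuousLinearMap.star_eq_adjoint, ContinuousLinearMap.adjoint_inner_left]
  have := hf.eq_zero hsa 𝒲 h1 hmul (fun w hw => ?_) hx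
  · rw [hstar, neg_one_mul, add_neg_eq_zero] at this
    exact this
  · rw [hstar, neg_one_mul, add_neg_eq_zero]
    exact congrArg (fun T : K →L[ℂ] K => ⟪u, T v⟫_ℂ)
      (VonNeumannAlgebra.mem_generated_iff.1 (h w hw) y hy)

end Density

/-! ### Wick operators -/

namespace Fock

variable {H : Type u} [NormedAddCommGroup H] [InnerProductSpace ℂ H]

/-- The product `ℓ(f₁)^* ⋯ ℓ(fₙ)^*` attached to a list of pairs `(eᵢ, fᵢ)`. -/
noncomputable def annihilation : List (H × H) → (Fock H →L[ℂ] Fock H)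
  | [] => 1
  | p :: a => star (creation p.2) * annihilation a

/-- The Wick operator `∑ₖ ℓ(e₁) ⋯ ℓ(eₖ) ℓ(fₖ₊₁)^* ⋯ ℓ(fₙ)^*` of a list of pairs `(eᵢ, fᵢ)`. -/
noncomputable def wick : List (H × H) → (Fock H →L[ℂ] Fock H)
  | [] => 1
  | p :: a => creation p.1 * wick a + annihilation (p :: a)

/-- The operator `ℓ(e) + ℓ(f)^*`. -/
noncomputable def field (p : H × H) : Fock H →L[ℂ] Fock H := creation p.1 + star (creation p.2)

theorem annihilation_cons_vacuum (p : H × H) (a : List (H × H)) :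
    annihilation (p :: a) (vacuum H) = 0 := by
  induction a generalizing p with
  | nil => exact star_creation_vacuum p.2
  | cons q a ih =>
    change star (creation p.2) (annihilation (q :: a) (vacuum H)) = 0
    rw [ih, map_zero]

theorem wick_vacuum (a : List (H × H)) : wick a (vacuum H) = tensor (a.map Prod.fst) := by
  induction a with
  | nil => rfl
  | cons p a ih =>
    change creation p.1 (wick a (vacuum H)) + annihilation (p :: a) (vacuum H) = _
    rw [ih, annihilation_cons_vacuum, add_zero, creation_tensor]
    rfl

theorem wick_singleton (p : H × H) : wick [p] = field p := by
  simp [wick, field, annihilation]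

/-- The product `ℓ(p.2)^* ℓ(q.1)` is a scalar and produces the correction term; the other products
are exactly the terms of the longer Wick operator. Solving for that operator gives the recursion
used in `StandardSubspace.wick_mem`. -/
theorem field_mul_wick (p q : H × H) (a : List (H × H)) :
    field p * wick (q :: a) = wick (p :: q :: a) + ⟪p.2, q.1⟫_ℂ • wick a := by
  have h : star (creation p.2) * (creation q.1 * wick a) = ⟪p.2, q.1⟫_ℂ • wick a := by
    rw [← mul_assoc, star_creation_mul_creation, smul_one_mul]
  simp only [wick, field, annihilation, add_mul, mul_add, h]
  abel

/-- Since `ζ ↦ I ζ` and the adjoint are both conjugate linear, `ℓ(ζ) + ℓ(I ζ)^*` is complex linear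
in `ζ`, which brings it back to fixed points of `I`. -/
theorem field_eq_semicircular (a b : H) : field (a + Complex.I • b, a - Complex.I • b) =
    (2 : ℂ) • semicircular a + (2 * Complex.I) • semicircular b := by
  have h : creation (a - Complex.I • b) = creation a - Complex.I • creation b := by
    rw [sub_eq_add_neg, ← neg_smul, creation_add, creation_smul, neg_smul, ← sub_eq_add_neg]
  simp only [field, semicircular, creation_add, creation_smul, h, star_sub, star_smul,
    smul_smul, smul_add]
  norm_num
  simp only [mul_assoc, mul_comm Complex.I]
  module

theorem isSelfAdjoint_semicircular (ξ : H) : IsSelfAdjoint (semicircular ξ) := by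
  simp [IsSelfAdjoint, semicircular, add_comm]

end Fock

/-! ### The von Neumann algebra of a standard subspace -/

section Standard

open Fock ClosedSubmodule

variable {H : Type u} [NormedAddCommGroup H] [InnerProductSpace ℂ H]

namespace StandardSubspace

/-- The graph of the involution `a + i b ↦ a - i b` of a standard subspace. -/
def involutionGraph (S : StandardSubspace H) : Set (H × H) :=
  {p | ∃ a ∈ S.toClosedSubmodule, ∃ b ∈ S.toClosedSubmodule,
    p = (a + Complex.I • b, a - Complex.I • b)}

/-- The von Neumann algebra generated by the semicircular operators of a standard subspace. -/
noncomputable def freeAlgebra (S : StandardSubspace H) : VonNeumannAlgebra (Fock H) :=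
  VonNeumannAlgebra.generated (semicircular '' (S.toClosedSubmodule : Set H))

/-- The span of the Wick operators of a standard subspace. -/
noncomputable def wickSpan (S : StandardSubspace H) : Submodule ℂ (Fock H →L[ℂ] Fock H) :=
  Submodule.span ℂ {w | ∃ a : List (H × H), (∀ p ∈ a, p ∈ S.involutionGraph) ∧ w = wick a}

variable (S : StandardSubspace H)

theorem mem_involutionGraph_self {a : H} (ha : a ∈ S.toClosedSubmodule) :
    (a, a) ∈ S.involutionGraph :=
  ⟨a, ha, 0, zero_mem _, by simp⟩

theorem field_mem {p : H × H} (hp : p ∈ S.involutionGraph) :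
    field p ∈ S.freeAlgebra.toStarSubalgebra := by
  obtain ⟨a, ha, b, hb, rfl⟩ := hp
  rw [field_eq_semicircular]
  exact add_mem (SMulMemClass.smul_mem _ (VonNeumannAlgebra.subset_generated ⟨a, ha, rfl⟩))
    (SMulMemClass.smul_mem _ (VonNeumannAlgebra.subset_generated ⟨b, hb, rfl⟩))

theorem wick_mem (a : List (H × H)) (ha : ∀ p ∈ a, p ∈ S.involutionGraph) :
    wick a ∈ S.freeAlgebra.toStarSubalgebra := by
  -- The recursion has two steps, so the induction carries a word together with all its extensions
  -- by one letter.
  have key : ∀ a : List (H × H), (∀ p ∈ a, p ∈ S.involutionGraph) →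
      wick a ∈ S.freeAlgebra.toStarSubalgebra ∧
      ∀ p ∈ S.involutionGraph, wick (p :: a) ∈ S.freeAlgebra.toStarSubalgebra := by
    intro a
    induction a with
    | nil =>
      refine fun _ => ⟨one_mem _, fun p hp => ?_⟩
      rw [wick_singleton]
      exact S.field_mem hp
    | cons q a ih =>
      intro h
      obtain ⟨h1, h2⟩ := ih fun p hp => h p (by simp [hp])
      have h3 := h2 q (h q (by simp))
      refine ⟨h3, fun p hp => ?_⟩
      rw [← add_sub_cancel_right (wick (p :: q :: a)) (⟪p.2, q.1⟫_ℂ • wick a), ← field_mul_wick]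
      exact sub_mem (mul_mem (S.field_mem hp) h3) (SMulMemClass.smul_mem _ h1)
  exact (key a ha).1

theorem one_mem_wickSpan : 1 ∈ S.wickSpan :=
  Submodule.subset_span ⟨[], by simp, rfl⟩

theorem field_mul_mem_wickSpan {p : H × H} (hp : p ∈ S.involutionGraph)
    {w : Fock H →L[ℂ] Fock H} (hw : w ∈ S.wickSpan) : field p * w ∈ S.wickSpan := by
  induction hw using Submodule.span_induction with
  | mem w hw =>
    obtain ⟨a, ha, rfl⟩ := hw
    cases a with
    | nil =>
      rw [show wick ([] : List (H × H)) = 1 from rfl, mul_one, ← wick_singleton]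
      exact Submodule.subset_span ⟨[p], by simpa using hp, rfl⟩
    | cons q a =>
      rw [field_mul_wick]
      refine add_mem (Submodule.subset_span ⟨p :: q :: a, ?_, rfl⟩)
        (Submodule.smul_mem _ _ (Submodule.subset_span ⟨a, fun r hr => ha r (by simp [hr]), rfl⟩))
      rintro r hr
      rcases List.mem_cons.1 hr with rfl | hr
      exacts [hp, ha r hr]
  | zero => rw [mul_zero]; exact zero_mem _
  | add x y _ _ hx hy => rw [mul_add]; exact add_mem hx hy
  | smul c x _ hx => rw [mul_smul_comm]; exact Submodule.smul_mem _ _ hx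

theorem semicircular_mul_mem_wickSpan : ∀ s ∈ semicircular '' (S.toClosedSubmodule : Set H),
    ∀ w ∈ S.wickSpan, s * w ∈ S.wickSpan := by
  rintro _ ⟨ξ, hξ, rfl⟩ w hw
  have h := S.field_mul_mem_wickSpan (S.mem_involutionGraph_self hξ) hw
  rw [semicircular, smul_mul_assoc]
  exact Submodule.smul_mem _ _ h

theorem isSelfAdjoint_of_mem_semicircular :
    ∀ s ∈ semicircular '' (S.toClosedSubmodule : Set H), IsSelfAdjoint s := by
  rintro _ ⟨ξ, _, rfl⟩
  exact isSelfAdjoint_semicircular ξ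

/-- An ultraweakly continuous map that sends the Wick operators into the algebra leaves the algebra
invariant. -/
theorem map_mem {Φ : (Fock H →L[ℂ] Fock H) →ₗ[ℂ] (Fock H →L[ℂ] Fock H)} (hΦ : IsUltraweakMap Φ)
    (h : ∀ a : List (H × H), (∀ p ∈ a, p ∈ S.involutionGraph) →
      Φ (wick a) ∈ S.freeAlgebra.toStarSubalgebra)
    {x : Fock H →L[ℂ] Fock H} (hx : x ∈ S.freeAlgebra.toStarSubalgebra) :
    Φ x ∈ S.freeAlgebra.toStarSubalgebra := by
  refine hΦ.map_mem S.isSelfAdjoint_of_mem_semicircular S.wickSpan S.one_mem_wickSpan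
    S.semicircular_mul_mem_wickSpan (fun w hw => ?_) hx
  induction hw using Submodule.span_induction with
  | mem w hw =>
    obtain ⟨a, ha, rfl⟩ := hw
    exact h a ha
  | zero => rw [map_zero]; exact zero_mem _
  | add x y _ _ hx hy => rw [map_add]; exact add_mem hx hy
  | smul c x _ hx => rw [map_smul]; exact SMulMemClass.smul_mem _ hx

theorem dense_span : Dense (Submodule.span ℂ (S.toClosedSubmodule : Set H) : Set H) := by
  let V : ClosedSubmodule ℝ H :=
    ⟨((Submodule.span ℂ (S.toClosedSubmodule : Set H)).topologicalClosure).restrictScalars ℝ,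
      Submodule.isClosed_topologicalClosure _⟩
  have h1 : S.toClosedSubmodule ≤ V := fun x hx =>
    Submodule.le_topologicalClosure _ (Submodule.subset_span hx)
  have h2 : S.toClosedSubmodule.mulI ≤ V := fun x hx => by
    have hx' := (mem_mapEquiv_iff (scalarSMulCLE H Complex.UnitI) _ _).1 hx
    rw [scalarSMulCLE_symm_apply] at hx'
    have h3 := Submodule.le_topologicalClosure _ (Submodule.smul_mem _ Complex.I
      (Submodule.subset_span (R := ℂ) hx'))
    have h4 : Complex.I • (Complex.UnitI⁻¹ • x) = x := by
      rw [Units.smul_def, smul_smul]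
      exact (congrArg (· • x) Complex.UnitI.mul_inv).trans (one_smul ℂ x)
    rwa [h4] at h3
  have h3 : (⊤ : ClosedSubmodule ℝ H) ≤ V := S.IsCyclic ▸ sup_le h1 h2
  exact fun x => h3 (show x ∈ (⊤ : ClosedSubmodule ℝ H) from trivial)

end StandardSubspace

/-! ### The vacuum vector is separating -/

theorem Fock.wordInner_append : ∀ {a c : List H} (b d : List H), a.length = c.length →
    wordInner (a ++ b) (c ++ d) = wordInner a c * wordInner b d
  | [], [], b, d, _ => by simp [wordInner]
  | [], _ :: _, _, _, h => by simp at h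
  | _ :: _, [], _, _, h => by simp at h
  | e :: a, f :: c, b, d, h => by
    simp only [List.length_cons, add_left_inj] at h
    simp [wordInner, wordInner_append b d h, mul_assoc]

theorem Fock.wordInner_reverse : ∀ a b : List H, wordInner a.reverse b.reverse = wordInner a b
  | [], [] => rfl
  | [], f :: b => by rw [wordInner_eq_zero (by simp), wordInner_eq_zero (by simp)]
  | e :: a, [] => by rw [wordInner_eq_zero (by simp), wordInner_eq_zero (by simp)]
  | e :: a, f :: b => by
    by_cases h : a.length = b.length
    · rw [List.reverse_cons, List.reverse_cons, wordInner_append _ _ (by simpa using h),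
        wordInner_reverse a b]
      simp [wordInner, mul_comm]
    · rw [wordInner_eq_zero (by simpa using h), wordInner_eq_zero (by simpa using h)]

theorem Fock.exists_flip : ∃ V : Fock H →L[ℂ] Fock H, ∀ a, V (tensor a) = tensor a.reverse := by
  obtain ⟨V, _, h⟩ := exists_clm (fun a : List H => tensor a.reverse) (fun _ => 1)
    (fun _ => le_rfl) (fun a b => by simp [inner_tensor, wordInner_reverse])
  exact ⟨V, h⟩

/-- The flip `e₁ ⊗ ⋯ ⊗ eₙ ↦ eₙ ⊗ ⋯ ⊗ e₁`. -/
noncomputable def Fock.flip : Fock H →L[ℂ] Fock H := exists_flip.choose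

theorem Fock.flip_tensor (a : List H) : flip (tensor a) = tensor a.reverse :=
  exists_flip.choose_spec a

theorem Fock.star_flip : star (flip : Fock H →L[ℂ] Fock H) = flip := by
  refine clm_ext fun a => eq_of_inner_tensor fun b => ?_
  rw [ContinuousLinearMap.star_eq_adjoint, ContinuousLinearMap.adjoint_inner_right, flip_tensor,
    flip_tensor, inner_tensor, inner_tensor, ← wordInner_reverse, List.reverse_reverse]

/-- The right creation operator `e₁ ⊗ ⋯ ⊗ eₙ ↦ e₁ ⊗ ⋯ ⊗ eₙ ⊗ η`. -/
noncomputable def Fock.rightCreation (η : H) : Fock H →L[ℂ] Fock H := flip * creation η * flip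

theorem Fock.rightCreation_tensor (η : H) (a : List H) :
    rightCreation η (tensor a) = tensor (a ++ [η]) := by
  change flip (creation η (flip (tensor a))) = _
  rw [flip_tensor, creation_tensor, flip_tensor]
  simp

theorem Fock.star_rightCreation (η : H) :
    star (rightCreation η) = flip * star (creation η) * flip := by
  simp [rightCreation, star_flip, mul_assoc]

theorem Fock.creation_mul_rightCreation (ξ η : H) :
    creation ξ * rightCreation η = rightCreation η * creation ξ :=
  clm_ext fun a => by
    change creation ξ (rightCreation η (tensor a)) = rightCreation η (creation ξ (tensor a))
    rw [rightCreation_tensor, creation_tensor, creation_tensor, rightCreation_tensor]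
    rfl

/-- The commutator is `⟪ξ, η⟫` times the projection onto the vacuum: on longer words the left
annihilator and the right creator act on different ends. -/
theorem Fock.isSelfAdjoint_commutator {ξ η : H} (h : (⟪ξ, η⟫_ℂ).im = 0) :
    IsSelfAdjoint (star (creation ξ) * rightCreation η - rightCreation η * star (creation ξ)) := by
  have hnil : (star (creation ξ) * rightCreation η - rightCreation η * star (creation ξ))
      (tensor []) = ⟪ξ, η⟫_ℂ • tensor [] := by
    change star (creation ξ) (rightCreation η (tensor [])) -
      rightCreation η (star (creation ξ) (tensor [])) = _
    rw [rightCreation_tensor, star_creation_nil, map_zero, sub_zero]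
    exact star_creation_cons ξ η []
  have hcons : ∀ e a, (star (creation ξ) * rightCreation η - rightCreation η * star (creation ξ))
      (tensor (e :: a)) = 0 := fun e a => by
    change star (creation ξ) (rightCreation η (tensor (e :: a))) -
      rightCreation η (star (creation ξ) (tensor (e :: a))) = _
    rw [rightCreation_tensor, star_creation_cons, map_smul, rightCreation_tensor,
      List.cons_append, star_creation_cons, sub_self]
  refine clm_ext fun a => eq_of_inner_tensor fun b => ?_
  rw [ContinuousLinearMap.star_eq_adjoint, ContinuousLinearMap.adjoint_inner_right]
  cases a with
  | nil =>
    cases b with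
    | nil =>
      rw [hnil, inner_smul_left, inner_smul_right, Complex.conj_eq_iff_im.2 h]
    | cons f b => rw [hnil, hcons, inner_smul_right, inner_tensor]; simp [wordInner]
  | cons e a =>
    cases b with
    | nil => rw [hnil, hcons, inner_smul_left, inner_tensor]; simp [wordInner]
    | cons f b => rw [hcons, hcons]; simp

/-- The pure creation and pure annihilation products commute. The two mixed commutators are `c` and
`-c^*`, with `c` the one of `isSelfAdjoint_commutator`, and cancel when `⟪ξ, η⟫` is real. -/
theorem Fock.field_commute_rightField {ξ η : H} (h : (⟪ξ, η⟫_ℂ).im = 0) :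
    field (ξ, ξ) * (rightCreation η + star (rightCreation η)) =
      (rightCreation η + star (rightCreation η)) * field (ξ, ξ) := by
  have h1 := (isSelfAdjoint_commutator h).star_eq
  have h2 := creation_mul_rightCreation ξ η
  have h3 := congrArg star h2
  simp only [star_sub, star_mul, star_star] at h1 h3
  simp only [field, add_mul, mul_add]
  rw [h2, ← h3]
  have h4 : star (creation ξ) * rightCreation η + creation ξ * star (rightCreation η) =
      rightCreation η * star (creation ξ) + star (rightCreation η) * creation ξ := by
    rw [← sub_eq_zero] at h1 ⊢
    rw [← neg_eq_zero, ← h1]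
    abel
  have h5 := congrArg (· + (rightCreation η * creation ξ +
    star (rightCreation η) * star (creation ξ))) h4
  convert h5 using 1 <;> abel

namespace StandardSubspace

variable [CompleteSpace H] (S : StandardSubspace H)

/-- The vectors `y Ω`, for `y` in the commutant of the algebra of a standard subspace. -/
noncomputable def commutantOrbit : Submodule ℂ (Fock H) :=
  (Subalgebra.toSubmodule (StarSubalgebra.centralizer ℂ
    (semicircular '' (S.toClosedSubmodule : Set H))).toSubalgebra).map
      (ContinuousLinearMap.apply ℂ (Fock H) (vacuum H)).toLinearMap

theorem rightField_mem {η : H} (hη : η ∈ S.symplComp.toClosedSubmodule) :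
    rightCreation η + star (rightCreation η) ∈ StarSubalgebra.centralizer ℂ
      (semicircular '' (S.toClosedSubmodule : Set H)) := by
  have key : ∀ s ∈ semicircular '' (S.toClosedSubmodule : Set H),
      s * (rightCreation η + star (rightCreation η)) =
        (rightCreation η + star (rightCreation η)) * s := by
    rintro _ ⟨ξ, hξ, rfl⟩
    have h := field_commute_rightField (mem_symplComp_iff.1 hη ξ hξ)
    rw [semicircular, smul_mul_assoc, mul_smul_comm]
    exact congrArg _ h
  refine (StarSubalgebra.mem_centralizer_iff ℂ).2 fun s hs => ⟨key s hs, ?_⟩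
  rw [(S.isSelfAdjoint_of_mem_semicircular s hs).star_eq]
  exact key s hs

theorem rightField_apply_mem {η : H} (hη : η ∈ S.symplComp.toClosedSubmodule) {v : Fock H}
    (hv : v ∈ S.commutantOrbit) :
    (rightCreation η + star (rightCreation η)) v ∈ S.commutantOrbit := by
  obtain ⟨y, hy, rfl⟩ := hv
  exact ⟨(rightCreation η + star (rightCreation η)) * y,
    (StarSubalgebra.centralizer ℂ _).mul_mem (S.rightField_mem hη) hy, rfl⟩

theorem tensor_reverse_mem (a : List H) (ha : ∀ e ∈ a, e ∈ S.symplComp.toClosedSubmodule) :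
    tensor a.reverse ∈ S.commutantOrbit := by
  have h0 : ∀ (η : H) (a : List H), (rightCreation η + star (rightCreation η)) (tensor a.reverse) =
      flip (creation η (tensor a) + star (creation η) (tensor a)) := fun η a => by
    rw [star_rightCreation]
    change flip (creation η (flip (tensor a.reverse))) +
      flip (star (creation η) (flip (tensor a.reverse))) = _
    rw [flip_tensor, List.reverse_reverse, map_add]
  have key : ∀ a : List H, (∀ e ∈ a, e ∈ S.symplComp.toClosedSubmodule) →
      tensor a.reverse ∈ S.commutantOrbit ∧ ∀ η ∈ S.symplComp.toClosedSubmodule,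
        tensor (η :: a).reverse ∈ S.commutantOrbit := by
    intro a
    induction a with
    | nil =>
      intro _
      have h1 : tensor ([] : List H).reverse ∈ S.commutantOrbit := 
        ⟨1, (StarSubalgebra.centralizer ℂ _).one_mem, rfl⟩
      refine ⟨h1, fun η hη => ?_⟩
      have h2 := S.rightField_apply_mem hη h1
      rw [h0, star_creation_nil, add_zero, creation_tensor, flip_tensor] at h2
      exact h2
    | cons e a ih =>
      intro h
      obtain ⟨h1, h2⟩ := ih fun p hp => h p (by simp [hp])
      have h3 := h2 e (h e (by simp))
      refine ⟨h3, fun η hη => ?_⟩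
      have h4 := S.rightField_apply_mem hη h3
      rw [h0, star_creation_cons, creation_tensor, map_add, map_smul, flip_tensor,
        flip_tensor] at h4
      exact (Submodule.add_mem_iff_left _ (Submodule.smul_mem _ _ h1)).1 h4
  exact (key a ha).1

/-- The symplectic complement of a standard subspace is itself standard, so its complex span is
dense; the right fields of its vectors build all their tensors from the vacuum, by the mirror image
of the Wick recursion. -/
theorem dense_commutantOrbit : Dense (S.commutantOrbit : Set (Fock H)) := by
  have h := eq_top_of_tensor_mem _ S.symplComp.dense_span S.commutantOrbit.topologicalClosure
    (Submodule.isClosed_topologicalClosure _) fun a ha => by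
      have := S.tensor_reverse_mem a.reverse fun e he => ha e (by simpa using he)
      rw [List.reverse_reverse] at this
      exact Submodule.le_topologicalClosure _ this
  exact Submodule.dense_iff_topologicalClosure_eq_top.2 h

theorem commutant_apply {x y : Fock H →L[ℂ] Fock H} (hx : x ∈ S.freeAlgebra.toStarSubalgebra)
    (hy : y ∈ StarSubalgebra.centralizer ℂ (semicircular '' (S.toClosedSubmodule : Set H)))
    (v : Fock H) : x (y v) = y (x v) :=
  (congrArg (fun T : Fock H →L[ℂ] Fock H => T v)
    (VonNeumannAlgebra.mem_generated_iff.1 hx y hy)).symm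

/-- The vacuum vector is separating. -/
theorem eq_of_vacuum_eq {x y : S.freeAlgebra.Elem}
    (h : (x : Fock H →L[ℂ] Fock H) (vacuum H) = (y : Fock H →L[ℂ] Fock H) (vacuum H)) : x = y := by
  refine Subtype.ext (ContinuousLinearMap.ext_on (s := S.commutantOrbit)
    (S.dense_commutantOrbit.mono Submodule.subset_span) ?_)
  rintro _ ⟨z, hz, rfl⟩
  change (x : Fock H →L[ℂ] Fock H) (z (vacuum H)) = (y : Fock H →L[ℂ] Fock H) (z (vacuum H))
  rw [S.commutant_apply x.2 hz, S.commutant_apply y.2 hz, h]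

end StandardSubspace

end Standard

/-! ### Normal completely bounded maps on `B(K)` -/

section NormalCB

variable {K : Type u} [NormedAddCommGroup K] [InnerProductSpace ℂ K] [CompleteSpace K]

/-- `Φ` is an ultraweakly continuous map on `B(K)` with completely bounded norm at most `C`. -/
structure IsNormalCB (Φ : (K →L[ℂ] K) →ₗ[ℂ] (K →L[ℂ] K)) (C : ℝ) : Prop where
  ultraweak : IsUltraweakMap Φ
  continuous : ∀ η ξ : lp (fun _ : ℕ => K) 2, Continuous[ultraweakTopology K, inferInstance]
    fun x : K →L[ℂ] K => ∑' n, ⟪η n, Φ x (ξ n)⟫_ℂ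
  bound : ∀ (n : ℕ) (X : Matrix (Fin n) (Fin n) (K →L[ℂ] K)),
    ‖matrixOp (X.map Φ)‖ ≤ C * ‖matrixOp X‖

theorem matrixOp_add {n : ℕ} (X Y : Matrix (Fin n) (Fin n) (K →L[ℂ] K)) :
    matrixOp (X + Y) = matrixOp X + matrixOp Y := by
  ext v i
  simp [matrixOp_apply, Finset.sum_add_distrib]

theorem matrixOp_smul {n : ℕ} (c : ℂ) (X : Matrix (Fin n) (Fin n) (K →L[ℂ] K)) :
    matrixOp (c • X) = c • matrixOp X := by
  ext v i
  simp [matrixOp_apply, Finset.smul_sum]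

theorem isNormalCB_sandwich {ι : Type u} {A B : K →L[ℂ] lp (fun _ : ι => K) 2} (hA : ‖A‖ ≤ 1)
    (hB : ‖B‖ ≤ 1) : IsNormalCB (sandwich A B) 1 where
  ultraweak := isUltraweakMap_sandwich A B
  continuous η ξ := by
    simp only [tsum_inner_sandwich]
    exact continuous_ultraweak_functional _ _
  bound n X := (norm_matrixOp_sandwich_le A B X).trans <|
    mul_le_mul_of_nonneg_right (mul_le_one₀ hA (norm_nonneg B) hB) (norm_nonneg _)

theorem IsNormalCB.add {Φ Ψ : (K →L[ℂ] K) →ₗ[ℂ] (K →L[ℂ] K)} {C D : ℝ} (h : IsNormalCB Φ C)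
    (h' : IsNormalCB Ψ D) : IsNormalCB (Φ + Ψ) (C + D) where
  ultraweak := h.ultraweak.add h'.ultraweak
  continuous η ξ := by
    let _ := ultraweakTopology K
    refine ((h.continuous η ξ).add (h'.continuous η ξ)).congr fun x => ?_
    refine ((VonNeumannAlgebra.summable_inner_apply η ξ _).tsum_add
      (VonNeumannAlgebra.summable_inner_apply η ξ _)).symm.trans ?_
    exact tsum_congr fun n => (inner_add_right _ _ _).symm
  bound n X := by
    have : X.map (Φ + Ψ) = X.map Φ + X.map Ψ := by ext; rfl
    rw [this, matrixOp_add, add_mul]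
    exact (norm_add_le _ _).trans (add_le_add (h.bound n X) (h'.bound n X))

theorem IsNormalCB.smul {Φ : (K →L[ℂ] K) →ₗ[ℂ] (K →L[ℂ] K)} {C : ℝ} (c : ℂ)
    (h : IsNormalCB Φ C) : IsNormalCB (c • Φ) (‖c‖ * C) where
  ultraweak := h.ultraweak.smul c
  continuous η ξ := by
    let _ := ultraweakTopology K
    refine ((h.continuous η ξ).const_mul c).congr fun x => ?_
    refine tsum_mul_left.symm.trans (tsum_congr fun n => ?_)
    exact (inner_smul_right _ _ _).symm
  bound n X := by
    have : X.map (c • Φ) = c • X.map Φ := by ext; rfl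
    rw [this, matrixOp_smul, norm_smul, mul_assoc]
    exact mul_le_mul_of_nonneg_left (h.bound n X) (norm_nonneg _)

theorem isNormalCB_zero : IsNormalCB (0 : (K →L[ℂ] K) →ₗ[ℂ] (K →L[ℂ] K)) 0 := by
  have h0 : ‖(0 : K →L[ℂ] lp (fun _ : PUnit.{u + 1} => K) 2)‖ ≤ 1 :=
    (ContinuousLinearMap.opNorm_zero).trans_le zero_le_one
  have h := (isNormalCB_sandwich h0 h0).smul 0
  rwa [zero_smul, norm_zero, zero_mul] at h

theorem IsNormalCB.sum {ι : Type*} (s : Finset ι) {Φ : ι → (K →L[ℂ] K) →ₗ[ℂ] (K →L[ℂ] K)}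
    {C : ι → ℝ} (h : ∀ i ∈ s, IsNormalCB (Φ i) (C i)) :
    IsNormalCB (∑ i ∈ s, Φ i) (∑ i ∈ s, C i) := by
  classical
  induction s using Finset.induction_on with
  | empty => exact isNormalCB_zero
  | insert i s hi ih =>
    rw [Finset.sum_insert hi, Finset.sum_insert hi]
    exact (h i (by simp)).add (ih fun j hj => h j (by simp [hj]))

theorem IsNormalCB.mono {Φ : (K →L[ℂ] K) →ₗ[ℂ] (K →L[ℂ] K)} {C D : ℝ}
    (h : IsNormalCB Φ C) (hCD : C ≤ D) : IsNormalCB Φ D where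
  ultraweak := h.ultraweak
  continuous := h.continuous
  bound n X := (h.bound n X).trans (mul_le_mul_of_nonneg_right hCD (norm_nonneg _))

namespace VonNeumannAlgebra

variable {N : VonNeumannAlgebra K}

/-- The restriction of a map on `B(K)` to an invariant von Neumann algebra. -/
def restrictMap (Φ : (K →L[ℂ] K) →ₗ[ℂ] (K →L[ℂ] K))
    (h : ∀ x ∈ N.toStarSubalgebra, Φ x ∈ N.toStarSubalgebra) : N.Elem →ₗ[ℂ] N.Elem where
  toFun x := ⟨Φ x, h x x.2⟩
  map_add' x y := Subtype.ext (Φ.map_add x y)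
  map_smul' c x := Subtype.ext (Φ.map_smul c x)

theorem isNormalMap_restrictMap {Φ : (K →L[ℂ] K) →ₗ[ℂ] (K →L[ℂ] K)} {C : ℝ} (hΦ : IsNormalCB Φ C)
    (h : ∀ x ∈ N.toStarSubalgebra, Φ x ∈ N.toStarSubalgebra) : IsNormalMap (restrictMap Φ h) :=
  isNormalMap_iff.2 fun η ξ => by
    let _ := ultraweakTopology K
    let _ := N.ultraweak
    exact (hΦ.continuous η ξ).comp continuous_induced_dom

theorem isCBBound_restrictMap {Φ : (K →L[ℂ] K) →ₗ[ℂ] (K →L[ℂ] K)} {C : ℝ} (hΦ : IsNormalCB Φ C)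
    (h : ∀ x ∈ N.toStarSubalgebra, Φ x ∈ N.toStarSubalgebra) : IsCBBound (restrictMap Φ h) C :=
  fun n x => hΦ.bound n (x.map Subtype.val)

end VonNeumannAlgebra

end NormalCB

/-! ### Elementary tensors in an amplification -/

section Tmul

variable (K : Type u) [NormedAddCommGroup K] [InnerProductSpace ℂ K] [CompleteSpace K]

/-- The index set of a Hilbert basis. -/
def BasisIndex : Type u := (exists_hilbertBasis ℂ K).choose

/-- A Hilbert basis. -/
noncomputable def hilbertBasis : HilbertBasis (BasisIndex K) ℂ K :=
  (exists_hilbertBasis ℂ K).choose_spec.choose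

/-- The Hilbert space tensor product `K ⊗ K`. -/
abbrev TensorSquare : Type u := lp (fun _ : BasisIndex K => K) 2

variable {K}

/-- The elementary tensor `u ⊗ v`. -/
noncomputable def tmul (u v : K) : TensorSquare K :=
  ⟨fun i => ⟪hilbertBasis K i, v⟫_ℂ • u, memℓp_two <| by
    simp only [norm_smul, mul_pow]
    have := lp_two_summable ((hilbertBasis K).repr v)
    simp only [HilbertBasis.repr_apply_apply] at this
    exact this.mul_right _⟩

theorem tmul_apply (u v : K) (i : BasisIndex K) : tmul u v i = ⟪hilbertBasis K i, v⟫_ℂ • u := rfl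

theorem inner_tmul (u v u' v' : K) :
    ⟪tmul u v, tmul u' v'⟫_ℂ = ⟪u, u'⟫_ℂ * ⟪v, v'⟫_ℂ := by
  rw [lp.inner_eq_tsum, ← (hilbertBasis K).tsum_inner_mul_inner v v', ← tsum_mul_left]
  refine tsum_congr fun i => ?_
  rw [tmul_apply, tmul_apply, inner_smul_left, inner_smul_right, inner_conj_symm]
  ring

theorem amp_tmul (x : K →L[ℂ] K) (u v : K) :
    amp (BasisIndex K) K x (tmul u v) = tmul (x u) v :=
  lp.ext (funext fun _ => x.map_smul _ _)

theorem zero_tmul (v : K) : tmul 0 v = 0 := lp.ext (funext fun _ => smul_zero _)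

theorem norm_tmul (u v : K) : ‖tmul u v‖ = ‖u‖ * ‖v‖ := by
  have h := inner_tmul u v u v
  simp only [inner_self_eq_norm_sq_to_K] at h
  have h' : ‖tmul u v‖ ^ 2 = (‖u‖ * ‖v‖) ^ 2 := by rw [mul_pow]; exact_mod_cast h
  exact (sq_eq_sq₀ (norm_nonneg _) (by positivity)).1 h'

/-- The map `u ↦ u ⊗ v`. -/
noncomputable def tmulRight (v : K) : K →L[ℂ] TensorSquare K :=
  LinearMap.mkContinuous
    { toFun := fun u => tmul u v
      map_add' := fun _ _ => lp.ext (funext fun _ => smul_add _ _ _)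
      map_smul' := fun c _ => lp.ext (funext fun _ => smul_comm _ _ _) } ‖v‖
    fun u => by rw [mul_comm]; exact (norm_tmul u v).le

theorem norm_tmulRight_le (v : K) : ‖tmulRight v‖ ≤ ‖v‖ :=
  LinearMap.mkContinuous_norm_le _ (norm_nonneg _) _

end Tmul

namespace Fock

variable {H : Type u} [NormedAddCommGroup H] [InnerProductSpace ℂ H]

theorem inner_vacuum : ⟪vacuum H, vacuum H⟫_ℂ = 1 := inner_tensor _ _

theorem norm_vacuum : ‖vacuum H‖ = 1 := by
  have h := inner_vacuum (H := H)
  have h' := norm_sq_eq_re_inner (𝕜 := ℂ) (vacuum H)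
  rw [h] at h'
  exact (sq_eq_sq₀ (norm_nonneg _) zero_le_one).1 (by rw [h']; simp)

instance : Nontrivial (Fock H) :=
  ⟨⟨vacuum H, 0, fun h => by simpa [h] using norm_vacuum (H := H)⟩⟩

variable (H) in
/-- The amplification of operators on the Fock space to the tensor square. -/
noncomputable abbrev ampFock : (Fock H →L[ℂ] Fock H) →⋆ₐ[ℂ]
    (TensorSquare (Fock H) →L[ℂ] TensorSquare (Fock H)) :=
  amp (BasisIndex (Fock H)) (Fock H)

/-- The operator `ℓ(ξ) ⊗ 1`. -/
noncomputable abbrev ampCreation (ξ : H) : TensorSquare (Fock H) →L[ℂ] TensorSquare (Fock H) :=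
  ampFock H (creation ξ)

theorem ampCreation_inner_left (ξ : H) (y z : TensorSquare (Fock H)) :
    ⟪ampCreation ξ y, z⟫_ℂ = ⟪y, ampFock H (star (creation ξ)) z⟫_ℂ := by
  rw [map_star, ContinuousLinearMap.star_eq_adjoint, ContinuousLinearMap.adjoint_inner_right]

theorem amp_star_creation_ampCreation (f e : H) (z : TensorSquare (Fock H)) :
    ampFock H (star (creation f)) (ampCreation e z) = ⟪f, e⟫_ℂ • z := by
  rw [← mul_apply_eq_comp, ← map_mul, star_creation_mul_creation, map_smul, map_one]
  rfl

theorem amp_star_creation_tmul_vacuum (f : H) (v : Fock H) :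
    ampFock H (star (creation f)) (tmul (vacuum H) v) = 0 := by
  rw [amp_tmul, star_creation_vacuum, zero_tmul]

theorem inner_ampCreation_ampCreation (f e : H) (y z : TensorSquare (Fock H)) :
    ⟪ampCreation f y, ampCreation e z⟫_ℂ = ⟪f, e⟫_ℂ * ⟪y, z⟫_ℂ := by
  rw [ampCreation_inner_left, amp_star_creation_ampCreation, inner_smul_right]

theorem inner_ampCreation_tmul_vacuum (f : H) (y : TensorSquare (Fock H)) (v : Fock H) :
    ⟪ampCreation f y, tmul (vacuum H) v⟫_ℂ = 0 := by
  rw [ampCreation_inner_left, amp_star_creation_tmul_vacuum, inner_zero_right]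

theorem inner_tmul_vacuum_ampCreation (f : H) (y : TensorSquare (Fock H)) (v : Fock H) :
    ⟪tmul (vacuum H) v, ampCreation f y⟫_ℂ = 0 := by
  rw [← inner_conj_symm, inner_ampCreation_tmul_vacuum, map_zero]

theorem adjoint_comp_eq {A B : Fock H →L[ℂ] TensorSquare (Fock H)} {f g : List H → _}
    (hA : ∀ a, A (tensor a) = f a) (hB : ∀ a, B (tensor a) = g a) {D : Fock H →L[ℂ] Fock H}
    (h : ∀ a b, ⟪f a, g b⟫_ℂ = ⟪tensor a, D (tensor b)⟫_ℂ) :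
    ContinuousLinearMap.adjoint A ∘L B = D := by
  refine clm_ext fun b => eq_of_inner_tensor fun a => ?_
  rw [ContinuousLinearMap.comp_apply, ContinuousLinearMap.adjoint_inner_right, hA, hB, h]

/-! ### Second quantization -/

/-- The defect operator is `(1 - T T^*)^{1/2}`. It makes `e ↦ (D e, T^* e)` isometric, which is what
an isometric dilation on the Fock space needs. -/
theorem exists_defect [CompleteSpace H] (T : H →L[ℂ] H) (hT : ‖T‖ ≤ 1) : ∃ D : H →L[ℂ] H, ∀ e f,
    ⟪D e, D f⟫_ℂ + ⟪ContinuousLinearMap.adjoint T e, ContinuousLinearMap.adjoint T f⟫_ℂ =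
      ⟪e, f⟫_ℂ := by
  have h0 : (0 : H →L[ℂ] H) ≤ 1 - T * star T := by
    rw [sub_nonneg]
    have h1 : ‖T * star T‖ ≤ 1 := by
      rw [CStarRing.norm_self_mul_star]
      exact mul_le_one₀ hT (norm_nonneg _) hT
    exact (CStarAlgebra.norm_le_one_iff_of_nonneg _ (mul_star_self_nonneg T)).1 h1
  refine ⟨CFC.sqrt (1 - T * star T), fun e f => ?_⟩
  have hsa : IsSelfAdjoint (CFC.sqrt (1 - T * star T)) := (CFC.sqrt_nonneg _).isSelfAdjoint
  have h2 : ⟪CFC.sqrt (1 - T * star T) e, CFC.sqrt (1 - T * star T) f⟫_ℂ =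
      ⟪e, (1 - T * star T) f⟫_ℂ := by
    nth_rewrite 1 [← hsa.star_eq]
    rw [ContinuousLinearMap.star_eq_adjoint, ContinuousLinearMap.adjoint_inner_left,
      ← mul_apply_eq_comp, CFC.sqrt_mul_sqrt_self _ h0]
  rw [h2, ContinuousLinearMap.adjoint_inner_left]
  change ⟪e, f - T (ContinuousLinearMap.adjoint T f)⟫_ℂ + _ = _
  rw [inner_sub_right, sub_add_cancel]

/-- The image of an elementary tensor under the isometry that dilates the second quantization
of `T`, where `D = (1 - T T^*)^{1/2}`. -/
noncomputable def dilationVector (R D : H →L[ℂ] H) : List H → TensorSquare (Fock H)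
  | [] => tmul (vacuum H) (vacuum H)
  | e :: a => tmul (vacuum H) (tensor (D e :: a)) + ampCreation (R e) (dilationVector R D a)

/-- A word is mapped to a sum over the number of letters moved by `R` into the left tensor factor.
Terms with different numbers are orthogonal, and one letter at a time the defect identity restores
`⟪e, f⟫`. -/
theorem inner_dilationVector {R D : H →L[ℂ] H}
    (h : ∀ e f, ⟪D e, D f⟫_ℂ + ⟪R e, R f⟫_ℂ = ⟪e, f⟫_ℂ) : ∀ a b : List H,
    ⟪dilationVector R D a, dilationVector R D b⟫_ℂ = wordInner a b
  | [], [] => by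
    rw [dilationVector, inner_tmul, inner_vacuum]
    simp [wordInner]
  | [], f :: b => by
    rw [dilationVector, dilationVector, inner_add_right, inner_tmul_vacuum_ampCreation, inner_tmul,
      vacuum, inner_tensor, inner_tensor]
    simp [wordInner]
  | e :: a, [] => by
    rw [dilationVector, dilationVector, inner_add_left, inner_ampCreation_tmul_vacuum, inner_tmul,
      vacuum, inner_tensor, inner_tensor]
    simp [wordInner]
  | e :: a, f :: b => by
    rw [dilationVector, dilationVector, inner_add_left, inner_add_right, inner_add_right,
      inner_ampCreation_tmul_vacuum, inner_tmul_vacuum_ampCreation, inner_ampCreation_ampCreation,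
      inner_dilationVector h a b, inner_tmul, inner_vacuum, inner_tensor]
    simp only [wordInner]
    rw [← h e f]
    ring

/-- The second quantization of a contraction, as a completely positive map on `B(F(H))`. -/
theorem exists_secondQuantization [CompleteSpace H] (T : H →L[ℂ] H) (hT : ‖T‖ ≤ 1) :
    ∃ (A : Fock H →L[ℂ] TensorSquare (Fock H)) (S : Fock H →L[ℂ] Fock H), ‖A‖ ≤ 1 ∧ ‖S‖ ≤ 1 ∧
      sandwich A A 1 = 1 ∧ (∀ a, sandwich A A (wick a) = wick (a.map (Prod.map T T))) ∧
      IsFirstQuantization T S ∧ ∀ x, sandwich A A x (vacuum H) = S (x (vacuum H)) := by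
  obtain ⟨D, hD⟩ := exists_defect T hT
  obtain ⟨A, hA, hAt⟩ := exists_clm (dilationVector (ContinuousLinearMap.adjoint T) D) (fun _ => 1)
    (fun _ => le_rfl) (fun a b => by simp [inner_dilationVector hD])
  have hiso : ContinuousLinearMap.adjoint A ∘L A = 1 :=
    adjoint_comp_eq hAt hAt fun a b => by
      rw [inner_dilationVector hD, one_apply_eq_self, inner_tensor]
  -- The intertwining relation behind the second quantization: annihilators move to the right
  -- through `A`, creators move to the left through `A^*`, and each `ξ` turns into `T ξ`.
  have hann : ∀ ξ, ampFock H (star (creation ξ)) ∘L A = A ∘L star (creation (T ξ)) := fun ξ => by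
    refine clm_ext fun a => ?_
    rw [ContinuousLinearMap.comp_apply, ContinuousLinearMap.comp_apply, hAt]
    cases a with
    | nil => rw [dilationVector, amp_star_creation_tmul_vacuum, star_creation_nil, map_zero]
    | cons e a =>
      rw [dilationVector, map_add, amp_star_creation_tmul_vacuum, zero_add,
        amp_star_creation_ampCreation, star_creation_cons, map_smul, hAt,
        ContinuousLinearMap.adjoint_inner_right]
  have hcre : ∀ ξ, ContinuousLinearMap.adjoint A ∘L ampCreation ξ =
      creation (T ξ) ∘L ContinuousLinearMap.adjoint A := fun ξ => by
    have := congrArg ContinuousLinearMap.adjoint (hann ξ)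
    rw [ContinuousLinearMap.adjoint_comp, ContinuousLinearMap.adjoint_comp, map_star,
      ContinuousLinearMap.star_eq_adjoint, ContinuousLinearMap.star_eq_adjoint,
      ContinuousLinearMap.adjoint_adjoint, ContinuousLinearMap.adjoint_adjoint] at this
    exact this
  have hN : ∀ a : List (H × H), ampFock H (annihilation a) ∘L A =
      A ∘L annihilation (a.map (Prod.map T T)) := fun a => by
    induction a with
    | nil => simp only [annihilation, map_one, List.map_nil]; rfl
    | cons p a ih =>
      simp only [annihilation, List.map_cons, map_mul, Prod.map_snd]
      change ampFock H (star (creation p.2)) ∘L (ampFock H (annihilation a) ∘L A) = _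
      rw [ih, ← ContinuousLinearMap.comp_assoc, hann]
      rfl
  have hone : sandwich A A 1 = 1 := by
    rw [sandwich_apply, map_one]
    exact hiso
  have hNs : ∀ a : List (H × H), sandwich A A (annihilation a) =
      annihilation (a.map (Prod.map T T)) := fun a => by
    rw [sandwich_apply, hN, ← ContinuousLinearMap.comp_assoc, hiso]
    rfl
  have hmul : ∀ e x, sandwich A A (creation e * x) = creation (T e) * sandwich A A x :=
    fun e x => by
    rw [sandwich_apply, map_mul]
    change (ContinuousLinearMap.adjoint A ∘L ampCreation e) ∘L (ampFock H x ∘L A) = _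
    rw [hcre]
    rfl
  -- The first quantization is `v ↦ A^* (v ⊗ Ω)`. Since `A Ω = Ω ⊗ Ω`, it also describes the action
  -- of the map on vectors `x Ω`.
  have hS : ∀ a : List H, ContinuousLinearMap.adjoint A (tmul (tensor a) (vacuum H)) =
      tensor (a.map T) := fun a => by
    induction a with
    | nil =>
      have : tmul (tensor []) (vacuum H) = A (tensor ([] : List H)) := (hAt []).symm
      rw [this]
      exact congrArg (fun T : Fock H →L[ℂ] Fock H => T (tensor [])) hiso
    | cons e a ih =>
      rw [tensor_cons, ← amp_tmul, List.map_cons, tensor_cons, ← ih]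
      exact congrArg (fun T : TensorSquare (Fock H) →L[ℂ] Fock H =>
        T (tmul (tensor a) (vacuum H))) (hcre e)
  refine ⟨A, ContinuousLinearMap.adjoint A ∘L tmulRight (vacuum H), hA, ?_, hone, fun a => ?_,
    hS, fun x => ?_⟩
  · refine (ContinuousLinearMap.opNorm_comp_le _ _).trans ?_
    rw [LinearIsometryEquiv.norm_map]
    exact mul_le_one₀ hA (norm_nonneg _) ((norm_tmulRight_le _).trans norm_vacuum.le)
  · induction a with
    | nil => exact hone
    | cons p a ih => rw [wick, map_add, hmul, ih, hNs]; rfl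
  · have : A (vacuum H) = tmul (vacuum H) (vacuum H) := hAt []
    rw [sandwich_apply, ContinuousLinearMap.comp_apply, ContinuousLinearMap.comp_apply, this,
      amp_tmul]
    rfl

end Fock

/-! ### Projections onto the words of a given length -/

namespace Fock

variable {H : Type u} [NormedAddCommGroup H] [InnerProductSpace ℂ H]

/-- The vector `(e₁ ⊗ ⋯ ⊗ eₖ) ⊗ (eₖ₊₁ ⊗ ⋯ ⊗ eₙ)` if `k + σ ≤ n`, and `0` otherwise. -/
noncomputable def splitVector (σ : ℕ) : ℕ → List H → TensorSquare (Fock H)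
  | 0, a => if σ ≤ a.length then tmul (vacuum H) (tensor a) else 0
  | _ + 1, [] => 0
  | k + 1, e :: a => ampCreation e (splitVector σ k a)

theorem inner_splitVector (σ : ℕ) : ∀ (k m : ℕ) (a b : List H),
    ⟪splitVector σ k a, splitVector σ m b⟫_ℂ =
      if k = m ∧ k + σ ≤ a.length then wordInner a b else 0
  | 0, 0, a, b => by
    simp only [splitVector, zero_add, true_and]
    by_cases hab : a.length = b.length
    · rw [← hab]
      split_ifs
      · rw [inner_tmul, inner_vacuum, inner_tensor, one_mul]
      · simp
    · rw [wordInner_eq_zero hab]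
      split_ifs <;> simp [inner_tmul, inner_tensor, wordInner_eq_zero hab]
  | 0, m + 1, a, [] => by simp [splitVector]
  | 0, m + 1, a, f :: b => by
    simp only [splitVector]
    split_ifs <;> simp_all [inner_tmul_vacuum_ampCreation]
  | k + 1, m, [], b => by simp [splitVector]
  | k + 1, 0, e :: a, b => by
    simp only [splitVector]
    split_ifs <;> simp_all [inner_ampCreation_tmul_vacuum]
  | k + 1, m + 1, e :: a, [] => by simp [splitVector, wordInner]
  | k + 1, m + 1, e :: a, f :: b => by
    rw [splitVector, splitVector, inner_ampCreation_ampCreation, inner_splitVector σ k m a b]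
    simp only [wordInner, List.length_cons, add_left_inj, add_right_comm k 1 σ,
      add_le_add_iff_right]
    split_ifs <;> simp

theorem exists_splitOp (σ k : ℕ) : ∃ A : Fock H →L[ℂ] TensorSquare (Fock H), ‖A‖ ≤ 1 ∧
    ∀ a, A (tensor a) = splitVector σ k a :=
  exists_clm _ (fun n => if k + σ ≤ n then 1 else 0) (fun n => by split_ifs <;> simp)
    fun a b => by rw [inner_splitVector]; split_ifs <;> simp_all

/-- The partial isometry that splits off the first `k` letters of the words of length at
least `k + σ`, and vanishes on the shorter words. -/
noncomputable def splitOp (σ k : ℕ) : Fock H →L[ℂ] TensorSquare (Fock H) :=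
  (exists_splitOp σ k).choose

theorem norm_splitOp_le (σ k : ℕ) : ‖(splitOp σ k : Fock H →L[ℂ] TensorSquare (Fock H))‖ ≤ 1 :=
  (exists_splitOp σ k).choose_spec.1

theorem splitOp_tensor (σ k : ℕ) (a : List H) : splitOp σ k (tensor a) = splitVector σ k a :=
  (exists_splitOp σ k).choose_spec.2 a

theorem amp_star_creation_comp_splitOp_zero (σ : ℕ) (ξ : H) :
    ampFock H (star (creation ξ)) ∘L splitOp σ 0 = 0 := by
  refine clm_ext fun a => ?_
  rw [ContinuousLinearMap.comp_apply, splitOp_tensor, splitVector]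
  split_ifs
  · rw [amp_star_creation_tmul_vacuum]; rfl
  · rw [map_zero]; rfl

/-- The left factor carries the initial letters of the word, so removing its first letter commutes
with splitting, up to one fewer letter to split off. -/
theorem amp_star_creation_comp_splitOp_succ (σ k : ℕ) (ξ : H) :
    ampFock H (star (creation ξ)) ∘L splitOp σ (k + 1) = splitOp σ k ∘L star (creation ξ) := by
  refine clm_ext fun a => ?_
  rw [ContinuousLinearMap.comp_apply, ContinuousLinearMap.comp_apply, splitOp_tensor]
  cases a with
  | nil => rw [splitVector, star_creation_nil, map_zero, map_zero]
  | cons e a =>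
    rw [splitVector, amp_star_creation_ampCreation, star_creation_cons, map_smul, splitOp_tensor]

theorem adjoint_splitOp_zero_comp_ampCreation (σ : ℕ) (ξ : H) :
    ContinuousLinearMap.adjoint (splitOp σ 0) ∘L ampCreation ξ = 0 := by
  have := congrArg ContinuousLinearMap.adjoint (amp_star_creation_comp_splitOp_zero σ ξ)
  rw [ContinuousLinearMap.adjoint_comp, map_star, ContinuousLinearMap.star_eq_adjoint,
    ContinuousLinearMap.adjoint_adjoint, map_zero] at this
  exact this

theorem adjoint_splitOp_succ_comp_ampCreation (σ k : ℕ) (ξ : H) :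
    ContinuousLinearMap.adjoint (splitOp σ (k + 1)) ∘L ampCreation ξ =
      creation ξ ∘L ContinuousLinearMap.adjoint (splitOp σ k) := by
  have := congrArg ContinuousLinearMap.adjoint (amp_star_creation_comp_splitOp_succ σ k ξ)
  rw [ContinuousLinearMap.adjoint_comp, ContinuousLinearMap.adjoint_comp, map_star,
    ContinuousLinearMap.star_eq_adjoint, ContinuousLinearMap.star_eq_adjoint,
    ContinuousLinearMap.adjoint_adjoint, ContinuousLinearMap.adjoint_adjoint] at this
  exact this

theorem adjoint_splitOp_comp_of_ne (σ : ℕ) {k m : ℕ} (h : k ≠ m) :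
    ContinuousLinearMap.adjoint (splitOp σ k : Fock H →L[ℂ] _) ∘L splitOp σ m = 0 :=
  adjoint_comp_eq (splitOp_tensor σ k) (splitOp_tensor σ m) fun a b => by
    rw [inner_splitVector, if_neg (by simp [h])]
    simp

theorem adjoint_splitOp_zero_comp :
    ContinuousLinearMap.adjoint (splitOp 0 0 : Fock H →L[ℂ] _) ∘L splitOp 0 0 = 1 :=
  adjoint_comp_eq (splitOp_tensor 0 0) (splitOp_tensor 0 0) fun a b => by
    rw [inner_splitVector, if_pos (by simp), one_apply_eq_self, inner_tensor]

/-- For `k = m`, both sides are the projection onto words of length at least `k + 1`, otherwise both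
vanish. This coincidence produces the cancellation in `bidegreeMap`. -/
theorem adjoint_splitOp_succ_comp (k m : ℕ) :
    ContinuousLinearMap.adjoint (splitOp 0 (k + 1) : Fock H →L[ℂ] _) ∘L splitOp 0 (m + 1) =
      ContinuousLinearMap.adjoint (splitOp 1 k) ∘L splitOp 1 m :=
  adjoint_comp_eq (splitOp_tensor 0 (k + 1)) (splitOp_tensor 0 (m + 1)) fun a b => by
    rw [ContinuousLinearMap.comp_apply, ContinuousLinearMap.adjoint_inner_right, splitOp_tensor,
      splitOp_tensor, inner_splitVector, inner_splitVector]
    simp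

/-- The map `x ↦ A^* (x ⊗ 1) B`, where `A` and `B` split off `k` and `l` letters. -/
noncomputable def splitMap (σ k l : ℕ) :
    (Fock H →L[ℂ] Fock H) →ₗ[ℂ] (Fock H →L[ℂ] Fock H) :=
  sandwich (splitOp σ k) (splitOp σ l)

theorem splitMap_zero_creation_mul (σ l : ℕ) (e : H) (y : Fock H →L[ℂ] Fock H) :
    splitMap σ 0 l (creation e * y) = 0 := by
  rw [splitMap, sandwich_apply, map_mul]
  change (ContinuousLinearMap.adjoint (splitOp σ 0) ∘L ampCreation e) ∘L
    (ampFock H y ∘L splitOp σ l) = _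
  rw [adjoint_splitOp_zero_comp_ampCreation, ContinuousLinearMap.zero_comp]

theorem splitMap_succ_creation_mul (σ k l : ℕ) (e : H) (y : Fock H →L[ℂ] Fock H) :
    splitMap σ (k + 1) l (creation e * y) = creation e * splitMap σ k l y := by
  rw [splitMap, sandwich_apply, map_mul]
  change (ContinuousLinearMap.adjoint (splitOp σ (k + 1)) ∘L ampCreation e) ∘L
    (ampFock H y ∘L splitOp σ l) = _
  rw [adjoint_splitOp_succ_comp_ampCreation]
  rfl

theorem amp_annihilation_comp_splitOp (σ : ℕ) (a : List (H × H)) (l : ℕ) :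
    ampFock H (annihilation a) ∘L splitOp σ l =
      if a.length ≤ l then splitOp σ (l - a.length) ∘L annihilation a else 0 := by
  induction a with
  | nil =>
    simp only [annihilation, List.length_nil, zero_le, if_true, Nat.sub_zero]
    rw [map_one]
    rfl
  | cons p a ih =>
    have h : ampFock H (annihilation (p :: a)) ∘L splitOp σ l =
        ampFock H (star (creation p.2)) ∘L (ampFock H (annihilation a) ∘L splitOp σ l) := by
      rw [annihilation, map_mul]; rfl
    rw [h, ih]
    by_cases h1 : a.length ≤ l
    · rw [if_pos h1, ← ContinuousLinearMap.comp_assoc]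
      by_cases h2 : a.length = l
      · rw [← h2, Nat.sub_self, amp_star_creation_comp_splitOp_zero, if_neg (by simp),
          ContinuousLinearMap.zero_comp]
      · have h3 : l - a.length = (l - (p :: a).length) + 1 := by
          simp only [List.length_cons]; omega
        rw [h3, amp_star_creation_comp_splitOp_succ,
          if_pos (by simp only [List.length_cons]; omega), ContinuousLinearMap.comp_assoc]
        rfl
    · rw [if_neg h1, if_neg (by simp only [List.length_cons]; omega),
        ContinuousLinearMap.comp_zero]

theorem splitMap_annihilation (σ k l : ℕ) (a : List (H × H)) :
    splitMap σ k l (annihilation a) = if a.length ≤ l then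
      (ContinuousLinearMap.adjoint (splitOp σ k) ∘L splitOp σ (l - a.length)) ∘L annihilation a
      else 0 := by
  rw [splitMap, sandwich_apply, amp_annihilation_comp_splitOp]
  split_ifs
  · rfl
  · exact ContinuousLinearMap.comp_zero _

theorem splitMap_succ_vacuum (σ k l : ℕ) (x : Fock H →L[ℂ] Fock H) :
    splitMap σ k (l + 1) x (vacuum H) = 0 := by
  have : splitOp σ (l + 1) (vacuum H) = 0 := splitOp_tensor σ (l + 1) []
  rw [splitMap, sandwich_apply, ContinuousLinearMap.comp_apply, ContinuousLinearMap.comp_apply,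
    this, map_zero, map_zero]

theorem splitMap_one_vacuum (k l : ℕ) (x : Fock H →L[ℂ] Fock H) :
    splitMap 1 k l x (vacuum H) = 0 := by
  cases l with
  | zero =>
    have : splitOp 1 0 (vacuum H) = 0 := splitOp_tensor 1 0 []
    rw [splitMap, sandwich_apply, ContinuousLinearMap.comp_apply, ContinuousLinearMap.comp_apply,
      this, map_zero, map_zero]
  | succ l => exact splitMap_succ_vacuum 1 k l x

theorem star_splitMap (σ k l : ℕ) (x : Fock H →L[ℂ] Fock H) :
    star (splitMap σ k l x) = splitMap σ l k (star x) := star_sandwich _ _ _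

theorem isNormalCB_splitMap (σ k l : ℕ) : IsNormalCB (splitMap (H := H) σ k l) 1 :=
  isNormalCB_sandwich (norm_splitOp_le σ k) (norm_splitOp_le σ l)

/-- The map that extracts from a sum of operators `ℓ(e₁) ⋯ ℓ(eᵢ) ℓ(f₁)^* ⋯ ℓ(fⱼ)^*` the terms
with `i = k` and `j = l`. -/
noncomputable def bidegreeMap : ℕ → ℕ → (Fock H →L[ℂ] Fock H) →ₗ[ℂ] (Fock H →L[ℂ] Fock H)
  | 0, l => splitMap 0 0 l
  | k + 1, 0 => splitMap 0 (k + 1) 0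
  -- On a term with `i` creators and `j` annihilators, the first map inserts in the middle the
  -- projection onto length at least `d` if `k + 1 - i = l + 1 - j = d ≥ 0`, and gives zero
  -- otherwise. The second gives the same for `d ≥ 1` but zero for `d = 0`, so only the wanted
  -- bidegree survives. If one index is zero, only `d = 0` is possible.
  | k + 1, l + 1 => splitMap 0 (k + 1) (l + 1) + (-1 : ℂ) • splitMap 1 k l

theorem bidegreeMap_zero_right (k : ℕ) : bidegreeMap (H := H) k 0 = splitMap 0 k 0 := by
  cases k <;> rfl

theorem bidegreeMap_zero_creation_mul (l : ℕ) (e : H) (y : Fock H →L[ℂ] Fock H) :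
    bidegreeMap 0 l (creation e * y) = 0 := splitMap_zero_creation_mul 0 l e y

theorem bidegreeMap_succ_creation_mul (k l : ℕ) (e : H) (y : Fock H →L[ℂ] Fock H) :
    bidegreeMap (k + 1) l (creation e * y) = creation e * bidegreeMap k l y := by
  cases l with
  | zero => rw [bidegreeMap_zero_right, bidegreeMap_zero_right, splitMap_succ_creation_mul]
  | succ l =>
    rw [bidegreeMap, LinearMap.add_apply, LinearMap.smul_apply, splitMap_succ_creation_mul]
    cases k with
    | zero => rw [splitMap_zero_creation_mul, smul_zero, add_zero]; rfl
    | succ k =>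
      rw [splitMap_succ_creation_mul, bidegreeMap, LinearMap.add_apply, LinearMap.smul_apply,
        mul_add, mul_smul_comm]

theorem bidegreeMap_zero_annihilation (l : ℕ) (a : List (H × H)) :
    bidegreeMap 0 l (annihilation a) = if l = a.length then annihilation a else 0 := by
  rw [bidegreeMap, splitMap_annihilation]
  by_cases h : l = a.length
  · rw [if_pos h, if_pos h.ge, h, Nat.sub_self, adjoint_splitOp_zero_comp]
    rfl
  · rw [if_neg h]
    split_ifs with h'
    · rw [adjoint_splitOp_comp_of_ne 0 (by omega), ContinuousLinearMap.zero_comp]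
    · rfl

theorem bidegreeMap_succ_annihilation (k l : ℕ) (a : List (H × H)) :
    bidegreeMap (k + 1) l (annihilation a) = 0 := by
  cases l with
  | zero =>
    rw [bidegreeMap_zero_right, splitMap_annihilation]
    split_ifs
    · rw [adjoint_splitOp_comp_of_ne 0 (by omega), ContinuousLinearMap.zero_comp]
    · rfl
  | succ l =>
    rw [bidegreeMap, LinearMap.add_apply, LinearMap.smul_apply, splitMap_annihilation,
      splitMap_annihilation]
    by_cases h : a.length ≤ l
    · rw [if_pos h, if_pos (by omega), Nat.succ_sub h, adjoint_splitOp_succ_comp]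
      simp
    · rw [if_neg h, smul_zero, add_zero]
      split_ifs with h'
      · rw [adjoint_splitOp_comp_of_ne 0 (by omega), ContinuousLinearMap.zero_comp]
      · rfl

theorem bidegreeMap_succ_vacuum (k l : ℕ) (x : Fock H →L[ℂ] Fock H) :
    bidegreeMap k (l + 1) x (vacuum H) = 0 := by
  cases k with
  | zero => exact splitMap_succ_vacuum 0 0 l x
  | succ k =>
    rw [bidegreeMap, LinearMap.add_apply, LinearMap.smul_apply, add_apply, smul_apply,
      splitMap_succ_vacuum, splitMap_one_vacuum, smul_zero, add_zero]

theorem star_bidegreeMap (k l : ℕ) (x : Fock H →L[ℂ] Fock H) :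
    star (bidegreeMap k l x) = bidegreeMap l k (star x) := by
  cases k with
  | zero => rw [bidegreeMap_zero_right, bidegreeMap, star_splitMap]
  | succ k =>
    cases l with
    | zero => exact star_splitMap 0 (k + 1) 0 x
    | succ l =>
      simp only [bidegreeMap, LinearMap.add_apply, LinearMap.smul_apply, star_add, star_smul,
        star_splitMap]
      simp

theorem isNormalCB_bidegreeMap (k l : ℕ) : IsNormalCB (bidegreeMap (H := H) k l) 2 := by
  cases k with
  | zero => exact (isNormalCB_splitMap 0 0 l).mono one_le_two
  | succ k =>
    cases l with
    | zero => exact (isNormalCB_splitMap 0 (k + 1) 0).mono one_le_two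
    | succ l =>
      exact ((isNormalCB_splitMap 0 (k + 1) (l + 1)).add
        ((isNormalCB_splitMap 1 k l).smul (-1))).mono (by norm_num)

/-- The projection onto the Wick operators of degree `d`. -/
noncomputable def degreeMap (d : ℕ) : (Fock H →L[ℂ] Fock H) →ₗ[ℂ] (Fock H →L[ℂ] Fock H) :=
  ∑ p ∈ Finset.HasAntidiagonal.antidiagonal d, bidegreeMap p.1 p.2

theorem degreeMap_apply (d : ℕ) (x : Fock H →L[ℂ] Fock H) :
    degreeMap d x = ∑ p ∈ Finset.HasAntidiagonal.antidiagonal d, bidegreeMap p.1 p.2 x := by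
  rw [degreeMap, LinearMap.sum_apply]

theorem degreeMap_zero_creation_mul (e : H) (y : Fock H →L[ℂ] Fock H) :
    degreeMap 0 (creation e * y) = 0 := by
  simp [degreeMap_apply, bidegreeMap_zero_creation_mul]

theorem degreeMap_succ_creation_mul (d : ℕ) (e : H) (y : Fock H →L[ℂ] Fock H) :
    degreeMap (d + 1) (creation e * y) = creation e * degreeMap d y := by
  rw [degreeMap_apply, degreeMap_apply, Finset.Nat.sum_antidiagonal_succ, Finset.mul_sum,
    bidegreeMap_zero_creation_mul, zero_add]
  exact Finset.sum_congr rfl fun p _ => bidegreeMap_succ_creation_mul _ _ _ _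

theorem degreeMap_annihilation (d : ℕ) (a : List (H × H)) :
    degreeMap d (annihilation a) = if d = a.length then annihilation a else 0 := by
  cases d with
  | zero => simp [degreeMap_apply, bidegreeMap_zero_annihilation]
  | succ d =>
    rw [degreeMap_apply, Finset.Nat.sum_antidiagonal_succ, bidegreeMap_zero_annihilation,
      Finset.sum_eq_zero fun p _ => bidegreeMap_succ_annihilation _ _ _, add_zero]

/-- All terms of a Wick operator of a word of length `n` have bidegrees summing to `n`, so summing
over an antidiagonal keeps the whole operator or kills it. -/
theorem degreeMap_wick (d : ℕ) (a : List (H × H)) :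
    degreeMap d (wick a) = if d = a.length then wick a else 0 := by
  induction a generalizing d with
  | nil => exact degreeMap_annihilation d []
  | cons p a ih =>
    rw [wick, map_add, degreeMap_annihilation]
    cases d with
    | zero => rw [degreeMap_zero_creation_mul]; simp
    | succ d =>
      rw [degreeMap_succ_creation_mul, ih]
      by_cases h : d = a.length <;> simp [h]

theorem star_degreeMap (d : ℕ) (x : Fock H →L[ℂ] Fock H) :
    star (degreeMap d x) = degreeMap d (star x) := by
  rw [degreeMap_apply, degreeMap_apply, star_sum, ← Finset.Nat.sum_antidiagonal_swap]
  exact Finset.sum_congr rfl fun p _ => star_bidegreeMap _ _ _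

/-- There are `d + 1` bidegrees, each of norm at most `2`. Only the polynomial growth in `d` matters
afterwards. -/
theorem isNormalCB_degreeMap (d : ℕ) : IsNormalCB (degreeMap (H := H) d) (2 * (d + 1)) := by
  refine (IsNormalCB.sum (C := fun _ => 2) _ fun p _ => isNormalCB_bidegreeMap p.1 p.2).mono ?_
  simp [mul_comm]

/-- The projection of the Fock space onto the tensors of degree `d`. -/
noncomputable def degreeProj (d : ℕ) : Fock H →L[ℂ] Fock H :=
  ContinuousLinearMap.adjoint (splitOp 0 d) ∘L tmulRight (vacuum H)

theorem degreeProj_tensor (d : ℕ) (a : List H) :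
    degreeProj d (tensor a) = if d = a.length then tensor a else 0 := by
  change ContinuousLinearMap.adjoint (splitOp 0 d) (tmul (tensor a) (vacuum H)) = _
  have hnil : tmul (tensor []) (vacuum H) = splitOp 0 0 (tensor ([] : List H)) :=
    (splitOp_tensor 0 0 []).symm
  induction a generalizing d with
  | nil =>
    rw [hnil, ← ContinuousLinearMap.comp_apply]
    by_cases h : d = 0
    · rw [h, adjoint_splitOp_zero_comp]; simp
    · rw [adjoint_splitOp_comp_of_ne 0 h]; simp [h]
  | cons e a ih =>
    rw [tensor_cons, ← amp_tmul, ← ContinuousLinearMap.comp_apply]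
    cases d with
    | zero =>
      rw [adjoint_splitOp_zero_comp_ampCreation]
      simp
    | succ d =>
      rw [adjoint_splitOp_succ_comp_ampCreation, ContinuousLinearMap.comp_apply, ih]
      by_cases h : d = a.length <;> simp [h]

theorem degreeMap_vacuum (d : ℕ) (x : Fock H →L[ℂ] Fock H) :
    degreeMap d x (vacuum H) = degreeProj d (x (vacuum H)) := by
  have h0 : ∀ k, bidegreeMap k 0 x (vacuum H) = degreeProj k (x (vacuum H)) := fun k => by
    have : splitOp 0 0 (vacuum H) = tmul (vacuum H) (vacuum H) := splitOp_tensor 0 0 []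
    rw [bidegreeMap_zero_right, splitMap, sandwich_apply, ContinuousLinearMap.comp_apply,
      ContinuousLinearMap.comp_apply, this, amp_tmul]
    rfl
  rw [degreeMap_apply, sum_apply]
  rw [Finset.sum_eq_single (d, 0)]
  · exact h0 d
  · rintro ⟨k, l⟩ hp hne
    rw [Finset.HasAntidiagonal.mem_antidiagonal] at hp
    cases l with
    | zero => exact absurd (by rw [← hp, add_zero]) hne
    | succ l => exact bidegreeMap_succ_vacuum k l x
  · simp

end Fock

/-! ### Strong convergence -/

/-- A bounded family of operators that converges on a total set converges strongly. -/
theorem tendsto_clm_of_dense_span {ι X Y : Type*} [NormedAddCommGroup X] [NormedSpace ℂ X]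
    [NormedAddCommGroup Y] [NormedSpace ℂ Y] {l : Filter ι} {B : ι → X →L[ℂ] Y} {A : X →L[ℂ] Y}
    {C : ℝ} (hB : ∀ i, ‖B i‖ ≤ C) {D : Set X} (hD : Dense (Submodule.span ℂ D : Set X))
    (h : ∀ v ∈ D, Tendsto (fun i => B i v) l (𝓝 (A v))) (v : X) :
    Tendsto (fun i => B i v) l (𝓝 (A v)) := by
  have h1 : ∀ v ∈ Submodule.span ℂ D, Tendsto (fun i => B i v) l (𝓝 (A v)) := fun v hv => by
    induction hv using Submodule.span_induction with
    | mem v hv => exact h v hv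
    | zero => simpa using tendsto_const_nhds
    | add x y _ _ hx hy => simpa using hx.add hy
    | smul c x _ hx => simpa using hx.const_smul c
  rcases l.eq_or_neBot with rfl | hl
  · exact tendsto_bot
  obtain ⟨i₀⟩ : Nonempty ι := l.nonempty_of_neBot
  have hC : 0 ≤ C := (norm_nonneg _).trans (hB i₀)
  rw [Metric.tendsto_nhds]
  intro ε hε
  obtain ⟨w, hw, hvw⟩ := Metric.mem_closure_iff.1 (hD v) (ε / (2 * (C + ‖A‖ + 1)))
    (by positivity)
  have h2 := Metric.tendsto_nhds.1 (h1 w hw) (ε / 2) (by positivity)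
  filter_upwards [h2] with i hi
  rw [dist_eq_norm] at hvw hi ⊢
  have e : B i v - A v = B i (v - w) + (B i w - A w) - A (v - w) := by
    simp only [map_sub]; abel
  have b1 : ‖B i (v - w)‖ ≤ C * ‖v - w‖ :=
    ((B i).le_opNorm _).trans (mul_le_mul_of_nonneg_right (hB i) (norm_nonneg _))
  have b2 := A.le_opNorm (v - w)
  rw [lt_div_iff₀ (by positivity)] at hvw
  rw [e]
  calc _ ≤ ‖B i (v - w)‖ + ‖B i w - A w‖ + ‖A (v - w)‖ :=
        (norm_sub_le _ _).trans (add_le_add_left (norm_add_le _ _) _)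
    _ < ε := by nlinarith [norm_nonneg (v - w)]

namespace StandardSubspace

open Fock ClosedSubmodule VonNeumannAlgebra

variable {H : Type u} [NormedAddCommGroup H] [InnerProductSpace ℂ H] [CompleteSpace H]
variable (S : StandardSubspace H)

/-- Convergence on the vacuum carries over to `y Ω` for `y` in the commutant, because `y` commutes
with every `Φ i x`. Such vectors are dense and the family is bounded; compatibility with adjoints
upgrades strong to `*`-strong convergence. -/
theorem tendstoIdStarStrongly {ι : Type*} {l : Filter ι}
    {Φ : ι → S.freeAlgebra.Elem →ₗ[ℂ] S.freeAlgebra.Elem} {C : ℝ}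
    (hC : ∀ i x, ‖(Φ i x : Fock H →L[ℂ] Fock H)‖ ≤ C * ‖(x : Fock H →L[ℂ] Fock H)‖)
    (hstar : ∀ i x, star (Φ i x) = Φ i (star x))
    (h : ∀ x, Tendsto (fun i => (Φ i x : Fock H →L[ℂ] Fock H) (vacuum H)) l
      (𝓝 ((x : Fock H →L[ℂ] Fock H) (vacuum H)))) : TendstoIdStarStrongly l Φ := by
  have key : ∀ (x : S.freeAlgebra.Elem) (v : Fock H),
      Tendsto (fun i => (Φ i x : Fock H →L[ℂ] Fock H) v) l
        (𝓝 ((x : Fock H →L[ℂ] Fock H) v)) := fun x => by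
    refine tendsto_clm_of_dense_span (D := S.commutantOrbit) (fun i => hC i x)
      (S.dense_commutantOrbit.mono Submodule.subset_span) ?_
    rintro _ ⟨y, hy, rfl⟩
    change Tendsto (fun i => (Φ i x : Fock H →L[ℂ] Fock H) (y (vacuum H))) l
      (𝓝 ((x : Fock H →L[ℂ] Fock H) (y (vacuum H))))
    rw [S.commutant_apply x.2 hy]
    simp only [S.commutant_apply (Φ _ x).2 hy]
    exact (y.continuous.tendsto _).comp (h x)
  refine fun x v => ⟨key x v, ?_⟩
  have := key (star x) v
  simp only [← hstar] at this
  exact this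

/-- The second quantization of a contraction that leaves a standard subspace invariant. -/
theorem exists_secondQuantization (T : H →L[ℂ] H) (hT : ‖T‖ ≤ 1)
    (hTS : ∀ ξ ∈ S.toClosedSubmodule, T ξ ∈ S.toClosedSubmodule) :
    ∃ (G : S.freeAlgebra.Elem →ₗ[ℂ] S.freeAlgebra.Elem) (Q : Fock H →L[ℂ] Fock H),
      IsNormalMap G ∧ G 1 = 1 ∧ IsCompletelyPositive G ∧ IsCBBound G 1 ∧
      (∀ x, star (G x) = G (star x)) ∧ IsFirstQuantization T Q ∧ ‖Q‖ ≤ 1 ∧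
      ∀ x, (G x : Fock H →L[ℂ] Fock H) (vacuum H) =
        Q ((x : Fock H →L[ℂ] Fock H) (vacuum H)) := by
  obtain ⟨A, Q, hA, hQ, h1, hwick, hfirst, hvac⟩ := Fock.exists_secondQuantization T hT
  have hcb := isNormalCB_sandwich hA hA
  have hmem : ∀ x ∈ S.freeAlgebra.toStarSubalgebra,
      sandwich A A x ∈ S.freeAlgebra.toStarSubalgebra := fun x hx => by
    refine S.map_mem hcb.ultraweak (fun a ha => ?_) hx
    rw [hwick]
    refine S.wick_mem _ fun p hp => ?_
    obtain ⟨q, hq, rfl⟩ := List.mem_map.1 hp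
    obtain ⟨b, hb, c, hc, rfl⟩ := ha q hq
    exact ⟨T b, hTS b hb, T c, hTS c hc, by simp⟩
  refine ⟨restrictMap (sandwich A A) hmem, Q, isNormalMap_restrictMap hcb hmem, Subtype.ext h1,
    fun n x hx => isPositive_matrixOp_sandwich A _ hx, isCBBound_restrictMap hcb hmem,
    fun x => Subtype.ext (star_sandwich A A x), hfirst, hQ, fun x => hvac x⟩

end StandardSubspace

/-! ### Truncated radial multipliers -/

namespace Fock

variable {H : Type u} [NormedAddCommGroup H] [InnerProductSpace ℂ H]

/-- The radial multiplier on `B(F(H))` of symbol `k ↦ r ^ k`, truncated to `k < n`. -/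
noncomputable def truncMap (r : ℝ) (n : ℕ) : (Fock H →L[ℂ] Fock H) →ₗ[ℂ] (Fock H →L[ℂ] Fock H) :=
  ∑ k ∈ Finset.range n, ((r : ℂ) ^ k) • degreeMap k

/-- The diagonal operator on the Fock space of symbol `k ↦ r ^ k`, truncated to `k < n`. -/
noncomputable def truncOp (r : ℝ) (n : ℕ) : Fock H →L[ℂ] Fock H :=
  ∑ k ∈ Finset.range n, ((r : ℂ) ^ k) • degreeProj k

theorem truncMap_apply (r : ℝ) (n : ℕ) (x : Fock H →L[ℂ] Fock H) :
    truncMap r n x = ∑ k ∈ Finset.range n, ((r : ℂ) ^ k) • degreeMap k x := by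
  simp [truncMap]

theorem truncMap_wick (r : ℝ) (n : ℕ) (a : List (H × H)) :
    truncMap r n (wick a) = (if a.length < n then (r : ℂ) ^ a.length else 0) • wick a := by
  rw [truncMap_apply]
  simp only [degreeMap_wick, smul_ite, smul_zero, Finset.sum_ite_eq', Finset.mem_range]
  split_ifs <;> simp

theorem truncMap_vacuum (r : ℝ) (n : ℕ) (x : Fock H →L[ℂ] Fock H) :
    truncMap r n x (vacuum H) = truncOp r n (x (vacuum H)) := by
  simp [truncMap_apply, truncOp, degreeMap_vacuum]

theorem star_truncMap (r : ℝ) (n : ℕ) (x : Fock H →L[ℂ] Fock H) :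
    star (truncMap r n x) = truncMap r n (star x) := by
  simp [truncMap_apply, star_degreeMap]

theorem truncOp_tensor (r : ℝ) (n : ℕ) (a : List H) :
    truncOp r n (tensor a) = (if a.length < n then (r : ℂ) ^ a.length else 0) • tensor a := by
  simp only [truncOp, sum_apply, smul_apply, degreeProj_tensor,
    smul_ite, smul_zero, Finset.sum_ite_eq', Finset.mem_range]
  split_ifs <;> simp

theorem norm_truncOp_le {r : ℝ} (h0 : 0 ≤ r) (h1 : r ≤ 1) (n : ℕ) :
    ‖(truncOp r n : Fock H →L[ℂ] Fock H)‖ ≤ 1 := by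
  obtain ⟨A, hA, hAt⟩ := exists_clm (fun a : List H =>
      (if a.length < n then (r : ℂ) ^ a.length else 0) • tensor a)
    (fun k => if k < n then (r ^ k) ^ 2 else 0)
    (fun k => by split_ifs; exacts [pow_le_one₀ (pow_nonneg h0 _) (pow_le_one₀ h0 h1), zero_le_one])
    (fun a b => by
      by_cases hab : a.length = b.length
      · rw [inner_smul_left, inner_smul_right, inner_tensor, ← hab]
        split_ifs
        · simp; ring
        · simp
      · rw [inner_smul_left, inner_smul_right, inner_tensor, wordInner_eq_zero hab]; simp)
  have : truncOp r n = A := clm_ext fun a => by rw [truncOp_tensor, hAt]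
  rwa [this]

theorem isNormalCB_truncMap (r : ℝ) (n : ℕ) : IsNormalCB (truncMap (H := H) r n)
    (∑ k ∈ Finset.range n, |r| ^ k * (2 * (k + 1))) :=
  (IsNormalCB.sum _ fun k _ => (isNormalCB_degreeMap k).smul ((r : ℂ) ^ k)).mono
    (by simp)

/-- Two truncations differ by degrees in `[n, m)` only. The estimate is made on a vector because the
limit `m → ∞` is taken strongly on matrices. -/
theorem norm_matrixOp_truncMap_sub {r : ℝ} (h0 : 0 ≤ r) {n m : ℕ} (hnm : n ≤ m) {d : ℕ}
    (X : Matrix (Fin d) (Fin d) (Fock H →L[ℂ] Fock H)) (v : PiLp 2 (fun _ : Fin d => Fock H)) :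
    ‖matrixOp (X.map (truncMap r n)) v‖ ≤ ‖matrixOp (X.map (truncMap r m)) v‖ +
      (∑ k ∈ Finset.Ico n m, r ^ k * (2 * (k + 1))) * ‖matrixOp X‖ * ‖v‖ := by
  have hcb : IsNormalCB (∑ k ∈ Finset.Ico n m, ((r : ℂ) ^ k) • degreeMap (H := H) k)
      (∑ k ∈ Finset.Ico n m, r ^ k * (2 * (k + 1))) :=
    (IsNormalCB.sum _ fun k _ => (isNormalCB_degreeMap k).smul ((r : ℂ) ^ k)).mono
      (by simp [abs_of_nonneg h0])
  have e : truncMap (H := H) r m = truncMap r n +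
      ∑ k ∈ Finset.Ico n m, ((r : ℂ) ^ k) • degreeMap k := by
    rw [truncMap, truncMap, Finset.sum_range_add_sum_Ico _ hnm]
  have e2 : X.map (truncMap r m) = X.map (truncMap r n) +
      X.map (∑ k ∈ Finset.Ico n m, ((r : ℂ) ^ k) • degreeMap k :
        (Fock H →L[ℂ] Fock H) →ₗ[ℂ] (Fock H →L[ℂ] Fock H)) := by
    rw [e]; ext; rfl
  have e3 : matrixOp (X.map (truncMap r n)) v = matrixOp (X.map (truncMap r m)) v -
      matrixOp (X.map (∑ k ∈ Finset.Ico n m, ((r : ℂ) ^ k) • degreeMap k :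
        (Fock H →L[ℂ] Fock H) →ₗ[ℂ] (Fock H →L[ℂ] Fock H))) v := by
    rw [e2, matrixOp_add, add_apply, add_sub_cancel_right]
  rw [e3]
  refine (norm_sub_le _ _).trans (add_le_add_right ?_ _)
  exact (ContinuousLinearMap.le_opNorm _ _).trans
    (mul_le_mul_of_nonneg_right (hcb.bound d X) (norm_nonneg _))

end Fock

namespace StandardSubspace

open Fock ClosedSubmodule VonNeumannAlgebra

variable {H : Type u} [NormedAddCommGroup H] [InnerProductSpace ℂ H] [CompleteSpace H]
variable (S : StandardSubspace H)

theorem truncMap_mem (r : ℝ) (n : ℕ) : ∀ x ∈ S.freeAlgebra.toStarSubalgebra,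
    truncMap r n x ∈ S.freeAlgebra.toStarSubalgebra := fun x hx => by
  refine S.map_mem (isNormalCB_truncMap r n).ultraweak (fun a ha => ?_) hx
  rw [truncMap_wick]
  exact SMulMemClass.smul_mem _ (S.wick_mem a ha)

theorem mem_of_tendsto {x : ℕ → Fock H →L[ℂ] Fock H} {y : Fock H →L[ℂ] Fock H}
    (hx : ∀ n, x n ∈ S.freeAlgebra.toStarSubalgebra) (h : Tendsto x atTop (𝓝 y)) :
    y ∈ S.freeAlgebra.toStarSubalgebra := by
  refine mem_generated_iff.2 fun z hz => ?_
  refine tendsto_nhds_unique (h.const_mul z) ?_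
  refine (h.mul_const z).congr fun n => ?_
  exact (mem_generated_iff.1 (hx n) z hz).symm

theorem summable_weights {r : ℝ} (h0 : 0 ≤ r) (h1 : r < 1) :
    Summable fun k : ℕ => r ^ k * (2 * ((k : ℝ) + 1)) := by
  have hr : ‖r‖ < 1 := by rwa [Real.norm_of_nonneg h0]
  have h2 := (summable_pow_mul_geometric_of_norm_lt_one 1 hr).mul_left 2
  have h3 := (summable_geometric_of_lt_one h0 h1).mul_left 2
  refine (h2.add h3).congr fun k => ?_
  ring

/-- The truncated radial multipliers converge in norm to the second quantization of `r`. -/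
theorem tendsto_truncMap {r : ℝ} (h0 : 0 ≤ r) (h1 : r < 1)
    {G : S.freeAlgebra.Elem →ₗ[ℂ] S.freeAlgebra.Elem} {Q : Fock H →L[ℂ] Fock H}
    (hQ : IsFirstQuantization ((r : ℂ) • (1 : H →L[ℂ] H)) Q)
    (hG : ∀ x, (G x : Fock H →L[ℂ] Fock H) (vacuum H) =
        Q ((x : Fock H →L[ℂ] Fock H) (vacuum H))) (x : S.freeAlgebra.Elem) :
    Tendsto (fun n => truncMap r n (x : Fock H →L[ℂ] Fock H)) atTop
      (𝓝 (G x : Fock H →L[ℂ] Fock H)) := by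
  have hbound : ∀ k, ‖((r : ℂ) ^ k) • degreeMap k (x : Fock H →L[ℂ] Fock H)‖ ≤
      r ^ k * (2 * ((k : ℝ) + 1)) * ‖(x : Fock H →L[ℂ] Fock H)‖ := fun k => by
    have hmem : ∀ y ∈ S.freeAlgebra.toStarSubalgebra,
        degreeMap k y ∈ S.freeAlgebra.toStarSubalgebra := fun y hy => by
      refine S.map_mem (isNormalCB_degreeMap k).ultraweak (fun a ha => ?_) hy
      rw [degreeMap_wick]
      split_ifs
      exacts [S.wick_mem a ha, zero_mem _]
    have := (isCBBound_restrictMap (isNormalCB_degreeMap k) hmem).norm_le x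
    rw [norm_smul, norm_pow, Complex.norm_real, Real.norm_of_nonneg h0, mul_assoc]
    exact mul_le_mul_of_nonneg_left this (pow_nonneg h0 k)
  -- Absolute convergence in operator norm, from the linear bound on degree projections against `r ^
  -- k`.
  have hsum : Summable fun k => ((r : ℂ) ^ k) • degreeMap k (x : Fock H →L[ℂ] Fock H) :=
    Summable.of_norm_bounded ((summable_weights h0 h1).mul_right _) hbound
  obtain ⟨y, hy⟩ := hsum
  have hlim : Tendsto (fun n => truncMap r n (x : Fock H →L[ℂ] Fock H)) atTop (𝓝 y) := by
    simp only [truncMap_apply]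
    exact hy.tendsto_sum_nat
  have hymem := S.mem_of_tendsto (fun n => S.truncMap_mem r n x x.2) hlim
  have hop : ∀ v : Fock H, Tendsto (fun n => truncOp r n v) atTop (𝓝 (Q v)) :=
    tendsto_clm_of_dense_span (fun n => norm_truncOp_le h0 h1.le n) dense_span_tensor (by
      rintro _ ⟨a, rfl⟩
      have hmap : tensor (a.map ((r : ℂ) • (1 : H →L[ℂ] H))) = ((r : ℂ) ^ a.length) • tensor a := by
        induction a with
        | nil => simp
        | cons e a ih =>
          rw [List.map_cons, tensor_cons, ih, tensor_cons, smul_apply, one_apply_eq_self,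
            creation_smul, smul_apply, map_smul, smul_smul, List.length_cons, pow_succ']
      rw [hQ, hmap]
      refine tendsto_const_nhds.congr' ?_
      filter_upwards [eventually_gt_atTop a.length] with n hn
      rw [truncOp_tensor, if_pos hn])
  have hvac : y (vacuum H) = (G x : Fock H →L[ℂ] Fock H) (vacuum H) := by
    rw [hG]
    refine tendsto_nhds_unique (((ContinuousLinearMap.apply ℂ (Fock H)
      (vacuum H)).continuous.tendsto y).comp hlim) ?_
    refine (hop _).congr fun n => ?_
    exact (truncMap_vacuum r n _).symm
  -- The norm limit belongs to the algebra and agrees with `G x` on the vacuum, which is separating.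
  have hyG : (⟨y, hymem⟩ : S.freeAlgebra.Elem) = G x := S.eq_of_vacuum_eq hvac
  rw [← hyG]
  exact hlim

/-- The full multiplier of symbol `r ^ k` is the second quantization of the contraction `r • 1`,
hence has bound one; dropping the degrees from `n` on costs at most the tail `ε`. -/
theorem isCBBound_truncMap {r : ℝ} (h0 : 0 ≤ r) (h1 : r < 1) {n : ℕ} {ε : ℝ}
    (hε : ∀ m, n ≤ m → ∑ k ∈ Finset.Ico n m, r ^ k * (2 * ((k : ℝ) + 1)) ≤ ε) :
    IsCBBound (restrictMap (truncMap r n) (S.truncMap_mem r n)) (1 + ε) := by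
  have hT : ‖(r : ℂ) • (1 : H →L[ℂ] H)‖ ≤ 1 := by
    rw [norm_smul, Complex.norm_real, Real.norm_of_nonneg h0]
    exact mul_le_one₀ h1.le (norm_nonneg _) ContinuousLinearMap.norm_id_le
  obtain ⟨G, Q, -, -, -, hGcb, -, hQ, -, hG⟩ := S.exists_secondQuantization _ hT fun ξ hξ => by
    have := S.toClosedSubmodule.toSubmodule.smul_mem r hξ
    rw [smul_apply, one_apply_eq_self, Complex.coe_smul]
    exact this
  have hlim := S.tendsto_truncMap h0 h1 hQ hG
  have hε0 : 0 ≤ ε := by simpa using hε n le_rfl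
  intro d x
  refine ContinuousLinearMap.opNorm_le_bound _ (by positivity) fun v => ?_
  have hmat : Tendsto (fun m => _root_.matrixOp ((x.map Subtype.val).map (truncMap r m)) v) atTop
      (𝓝 (matrixOp (x.map G) v)) := by
    have h2 : Tendsto (fun m => fun i => _root_.matrixOp ((x.map Subtype.val).map
        (truncMap r m)) v i) atTop (𝓝 fun i => matrixOp (x.map G) v i) := by
      refine tendsto_pi_nhds.2 fun i => ?_
      simp only [_root_.matrixOp_apply, VonNeumannAlgebra.matrixOp_apply]
      refine tendsto_finsetSum _ fun j _ => ?_
      exact ((ContinuousLinearMap.apply ℂ (Fock H) (v j)).continuous.tendsto _).comp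
        (hlim (x i j))
    exact ((PiLp.continuous_toLp 2 fun _ : Fin d => Fock H).tendsto _).comp h2
  have h3 : ∀ m, n ≤ m → ‖matrixOp (x.map (restrictMap (truncMap r n) (S.truncMap_mem r n))) v‖ -
      ε * ‖matrixOp x‖ * ‖v‖ ≤
      ‖_root_.matrixOp ((x.map Subtype.val).map (truncMap r m)) v‖ := fun m hm => by
    rw [sub_le_iff_le_add]
    refine (norm_matrixOp_truncMap_sub h0 hm (x.map Subtype.val) v).trans
      (add_le_add_right ?_ _)
    exact mul_le_mul_of_nonneg_right (mul_le_mul_of_nonneg_right (hε m hm) (norm_nonneg _))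
      (norm_nonneg _)
  -- The estimate is uniform in `m`, so letting `m → ∞` replaces the longer truncation by `G`.
  have h4 := ge_of_tendsto hmat.norm ((eventually_ge_atTop n).mono h3)
  have h5 : ‖matrixOp (x.map G) v‖ ≤ ‖matrixOp x‖ * ‖v‖ :=
    (ContinuousLinearMap.le_opNorm _ _).trans
      (mul_le_mul_of_nonneg_right (by simpa using hGcb d x) (norm_nonneg _))
  linarith

end StandardSubspace

/-! ### Finite rank and convergence to the identity -/

namespace Fock

variable {H : Type u} [NormedAddCommGroup H] [InnerProductSpace ℂ H]

/-- The span of the elementary tensors of degree `n` of the vectors of a subspace. -/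
noncomputable def tensorPower (W : Submodule ℂ H) : ℕ → Submodule ℂ (Fock H)
  | 0 => Submodule.span ℂ {vacuum H}
  | n + 1 => Submodule.map₂ (LinearMap.compr₂ (LinearMap.id (R := ℂ)
      (M := Fock H →ₗ[ℂ] Fock H)) LinearMap.id ∘ₗ
        (ContinuousLinearMap.coeLM ℂ ∘ₗ (creationL (H := H)).toLinearMap)) W (tensorPower W n)

theorem tensor_mem_tensorPower {W : Submodule ℂ H} (a : List H) (ha : ∀ e ∈ a, e ∈ W) :
    tensor a ∈ tensorPower W a.length := by
  induction a with
  | nil => exact Submodule.mem_span_singleton_self _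
  | cons e a ih =>
    rw [tensor_cons]
    exact Submodule.apply_mem_map₂ _ (ha e (by simp)) (ih fun f hf => ha f (by simp [hf]))

theorem fg_tensorPower {W : Submodule ℂ H} (hW : W.FG) (n : ℕ) : (tensorPower W n).FG := by
  induction n with
  | zero => exact Submodule.fg_span_singleton _
  | succ n ih => exact hW.map₂ _ ih

theorem exists_finiteDimensional_tensor_mem {W : Submodule ℂ H} (hW : W.FG) (n : ℕ) :
    ∃ V : Submodule ℂ (Fock H), V.FG ∧
      ∀ a : List H, (∀ e ∈ a, e ∈ W) → a.length < n → tensor a ∈ V :=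
  ⟨(Finset.range n).sup (tensorPower W),
    Submodule.fg_finset_sup _ _ fun k _ => fg_tensorPower hW k, fun a ha h =>
    Finset.le_sup (f := tensorPower W) (Finset.mem_range.2 h) (tensor_mem_tensorPower a ha)⟩

theorem tendsto_tensor_map {κ : Type*} {l : Filter κ} {T : κ → H →L[ℂ] H}
    (hT : ∀ ξ, Tendsto (fun k => T k ξ) l (𝓝 ξ)) (a : List H) :
    Tendsto (fun k => tensor (a.map (T k))) l (𝓝 (tensor a)) := by
  induction a with
  | nil => exact tendsto_const_nhds
  | cons e a ih =>
    simp only [List.map_cons, tensor_cons]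
    have h : Tendsto (fun k => creationL (T k e)) l (𝓝 (creationL e)) :=
      (creationL.continuous.tendsto e).comp (hT e)
    exact (isBoundedBilinearMap_apply.continuous.tendsto (creationL e, tensor a)).comp
      (h.prodMk_nhds ih)

end Fock

namespace StandardSubspace

open Fock ClosedSubmodule VonNeumannAlgebra

variable {H : Type u} [NormedAddCommGroup H] [InnerProductSpace ℂ H] [CompleteSpace H]
variable (S : StandardSubspace H)

/-- Evaluation at the separating vacuum embeds the range of `Φ` into `V`, since a finite dimensional
space is closed and so contains the whole range of `B`. -/
theorem isFiniteRank_of_vacuum {Φ : S.freeAlgebra.Elem →ₗ[ℂ] S.freeAlgebra.Elem}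
    {B : Fock H →L[ℂ] Fock H} (hB : ∀ x, (Φ x : Fock H →L[ℂ] Fock H) (vacuum H) =
      B ((x : Fock H →L[ℂ] Fock H) (vacuum H)))
    {V : Submodule ℂ (Fock H)} (hV : V.FG) (h : ∀ a, B (tensor a) ∈ V) : IsFiniteRank Φ := by
  have : FiniteDimensional ℂ V := Module.Finite.iff_fg.2 hV
  have hclosed : IsClosed (V : Set (Fock H)) := V.closed_of_finiteDimensional
  have hrange : ∀ v, B v ∈ V := fun v => by
    have hle : Submodule.span ℂ (Set.range (tensor : List H → Fock H)) ≤
        V.comap B.toLinearMap := Submodule.span_le.2 (by rintro _ ⟨a, rfl⟩; exact h a)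
    exact closure_minimal hle (hclosed.preimage B.continuous) (dense_span_tensor v)
  let f : LinearMap.range Φ →ₗ[ℂ] V :=
    { toFun := fun y => ⟨((y : S.freeAlgebra.Elem) : Fock H →L[ℂ] Fock H) (vacuum H), by
        obtain ⟨x, hx⟩ := y.2
        rw [← hx, hB]
        exact hrange _⟩
      map_add' := fun _ _ => rfl
      map_smul' := fun _ _ => rfl }
  have hf : Function.Injective f := fun y z hyz =>
    Subtype.ext (S.eq_of_vacuum_eq (congrArg Subtype.val hyz))
  exact Module.Finite.of_injective f hf

/-- The symbol `k ↦ r ^ k`, truncated to `k < n`. -/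
noncomputable def truncSymbol (r : ℝ) (n k : ℕ) : ℝ := if k < n then r ^ k else 0

theorem truncOp_tensor_eq (r : ℝ) (n : ℕ) (a : List H) :
    truncOp r n (tensor a) = (truncSymbol r n a.length : ℂ) • tensor a := by
  rw [truncOp_tensor, truncSymbol]
  split_ifs <;> simp

theorem finite_support_truncSymbol (r : ℝ) (n : ℕ) : (Function.support (truncSymbol r n)).Finite :=
  (Set.finite_lt_nat n).subset fun k hk => by
    by_contra h
    exact hk (if_neg h)

/-- The truncated radial multiplier on the algebra of a standard subspace. -/
noncomputable def radialMap (r : ℝ) (n : ℕ) : S.freeAlgebra.Elem →ₗ[ℂ] S.freeAlgebra.Elem :=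
  restrictMap (truncMap r n) (S.truncMap_mem r n)

theorem radialMap_vacuum (r : ℝ) (n : ℕ) (x : S.freeAlgebra.Elem) :
    (S.radialMap r n x : Fock H →L[ℂ] Fock H) (vacuum H) =
      truncOp r n ((x : Fock H →L[ℂ] Fock H) (vacuum H)) :=
  truncMap_vacuum r n _

theorem star_radialMap (r : ℝ) (n : ℕ) (x : S.freeAlgebra.Elem) :
    star (S.radialMap r n x) = S.radialMap r n (star x) :=
  Subtype.ext (star_truncMap r n _)

theorem isNormalMap_radialMap (r : ℝ) (n : ℕ) : IsNormalMap (S.radialMap r n) :=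
  isNormalMap_restrictMap (isNormalCB_truncMap r n) _

theorem radialMap_eq_smul (r : ℝ) (n : ℕ) {a : List H} {x : S.freeAlgebra.Elem}
    (hx : (x : Fock H →L[ℂ] Fock H) (vacuum H) = tensor a) :
    S.radialMap r n x = (truncSymbol r n a.length : ℂ) • x := by
  refine S.eq_of_vacuum_eq ?_
  rw [radialMap_vacuum, hx, truncOp_tensor_eq, ← hx]
  rfl

theorem radialMap_one (r : ℝ) {n : ℕ} (hn : 0 < n) : S.radialMap r n 1 = 1 := by
  rw [S.radialMap_eq_smul r n (a := []) rfl]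
  simp [truncSymbol, hn]

/-- The choice is `r = 1 - 1/(j + 1)`, with the cutoff `n` so large that the weighted tail is at
most `1/(j + 1)`. Requiring `j < n` makes the symbol converge pointwise and keeps the multiplier
unital. -/
theorem exists_radial : ∃ (r : ℕ → ℝ) (n : ℕ → ℕ), (∀ j, 0 ≤ r j ∧ r j < 1 ∧ 0 < n j ∧
    IsCBBound (S.radialMap (r j) (n j)) (1 + 1 / (j + 1))) ∧
    ∀ k, Tendsto (fun j => truncSymbol (r j) (n j) k) atTop (𝓝 1) := by
  let r : ℕ → ℝ := fun j => 1 - 1 / ((j : ℝ) + 1)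
  have h0 : ∀ j, 0 ≤ r j := fun j => by
    simp only [r, sub_nonneg]
    rw [div_le_one (by positivity)]
    linarith [Nat.cast_nonneg (α := ℝ) j]
  have h1 : ∀ j, r j < 1 := fun j => by
    simp only [r, sub_lt_self_iff]
    positivity
  have hn : ∀ j, ∃ n : ℕ, j < n ∧ ∀ m, n ≤ m →
      ∑ k ∈ Finset.Ico n m, r j ^ k * (2 * ((k : ℝ) + 1)) ≤ 1 / ((j : ℝ) + 1) := fun j => by
    have hs := summable_weights (h0 j) (h1 j)
    have hnn : ∀ k : ℕ, 0 ≤ r j ^ k * (2 * ((k : ℝ) + 1)) := fun k =>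
      mul_nonneg (pow_nonneg (h0 j) k) (by positivity)
    -- A partial sum within `1/(j + 1)` of the total leaves a tail that small, as all terms are
    -- nonnegative.
    have ht := hs.hasSum.tendsto_sum_nat
    have hpos : (0 : ℝ) < 1 / ((j : ℝ) + 1) := by positivity
    obtain ⟨n, hn, hjn⟩ := ((ht.eventually (lt_mem_nhds (sub_lt_self _ hpos))).and
      (eventually_gt_atTop j)).exists
    refine ⟨n, hjn, fun m hm => ?_⟩
    have h3 := hs.sum_le_tsum (Finset.range m) fun k _ => hnn k
    rw [← Finset.sum_range_add_sum_Ico _ hm] at h3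
    linarith
  choose n hjn hn using hn
  refine ⟨r, n, fun j => ⟨h0 j, h1 j, (Nat.zero_le j).trans_lt (hjn j),
    S.isCBBound_truncMap (h0 j) (h1 j) (hn j)⟩, fun k => ?_⟩
  have hr : Tendsto r atTop (𝓝 1) := by
    have := (tendsto_one_div_add_atTop_nhds_zero_nat (𝕜 := ℝ)).const_sub 1
    rw [sub_zero] at this
    exact this
  have hk : Tendsto (fun j => r j ^ k) atTop (𝓝 1) := by simpa using hr.pow k
  refine hk.congr' ?_
  filter_upwards [eventually_ge_atTop k] with j hj
  rw [truncSymbol, if_pos (hj.trans_lt (hjn j))]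

theorem isFiniteRank_radialMap_comp (r : ℝ) (n : ℕ) {T : H →L[ℂ] H}
    {G : S.freeAlgebra.Elem →ₗ[ℂ] S.freeAlgebra.Elem} {Q : Fock H →L[ℂ] Fock H}
    (hT : FiniteDimensional ℂ (LinearMap.range T.toLinearMap)) (hQ : IsFirstQuantization T Q)
    (hG : ∀ x, (G x : Fock H →L[ℂ] Fock H) (vacuum H) =
        Q ((x : Fock H →L[ℂ] Fock H) (vacuum H))) : IsFiniteRank (S.radialMap r n ∘ₗ G) := by
  obtain ⟨V, hV, hVt⟩ := exists_finiteDimensional_tensor_mem (Module.Finite.iff_fg.1 hT) n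
  refine S.isFiniteRank_of_vacuum (B := truncOp r n ∘L Q) (fun x => ?_) hV fun a => ?_
  · rw [LinearMap.comp_apply, radialMap_vacuum, hG]
    rfl
  · rw [ContinuousLinearMap.comp_apply, hQ, truncOp_tensor]
    split_ifs with h
    · refine V.smul_mem _ (hVt _ (fun e he => ?_) h)
      obtain ⟨f, _, rfl⟩ := List.mem_map.1 he
      exact ⟨f, rfl⟩
    · rw [zero_smul]; exact zero_mem _

/-- On the vacuum the composite acts by contractions of the Fock space, so the limit along the
product filter need only be checked on elementary tensors. The constant `2` bounds all the `1 + 1/(j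
+ 1)`. -/
theorem tendsto_radialMap_comp {r : ℕ → ℝ} {n : ℕ → ℕ} (hr : ∀ j, 0 ≤ r j ∧ r j < 1)
    (hcb : ∀ j, IsCBBound (S.radialMap (r j) (n j)) (1 + 1 / (j + 1)))
    (hφ : ∀ k, Tendsto (fun j => truncSymbol (r j) (n j) k) atTop (𝓝 1))
    {κ : Type*} {l : Filter κ} {T : κ → H →L[ℂ] H} (hT : ∀ ξ, Tendsto (fun k => T k ξ) l (𝓝 ξ))
    {G : κ → S.freeAlgebra.Elem →ₗ[ℂ] S.freeAlgebra.Elem} {Q : κ → Fock H →L[ℂ] Fock H}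
    (hGcb : ∀ k, IsCBBound (G k) 1) (hGs : ∀ k x, star (G k x) = G k (star x))
    (hQ : ∀ k, IsFirstQuantization (T k) (Q k)) (hQn : ∀ k, ‖Q k‖ ≤ 1)
    (hG : ∀ k x, (G k x : Fock H →L[ℂ] Fock H) (vacuum H) =
        Q k ((x : Fock H →L[ℂ] Fock H) (vacuum H))) :
    TendstoIdStarStrongly (atTop ×ˢ l)
      (fun p : ℕ × κ => S.radialMap (r p.1) (n p.1) ∘ₗ G p.2) := by
  have hB : ∀ v : Fock H, Tendsto (fun p : ℕ × κ => (truncOp (r p.1) (n p.1) ∘L Q p.2) v)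
      (atTop ×ˢ l) (𝓝 ((1 : Fock H →L[ℂ] Fock H) v)) := by
    refine tendsto_clm_of_dense_span (C := 1) (fun p => ?_) dense_span_tensor ?_
    · exact (ContinuousLinearMap.opNorm_comp_le _ _).trans
        (mul_le_one₀ (norm_truncOp_le (hr _).1 (hr _).2.le _) (norm_nonneg _) (hQn _))
    · rintro _ ⟨a, rfl⟩
      simp only [ContinuousLinearMap.comp_apply, hQ _ _, truncOp_tensor_eq, List.length_map,
        one_apply_eq_self]
      have h1 : Tendsto (fun p : ℕ × κ => (truncSymbol (r p.1) (n p.1) a.length : ℂ))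
          (atTop ×ˢ l) (𝓝 1) := by
        have := (Complex.continuous_ofReal.tendsto 1).comp ((hφ a.length).comp (tendsto_fst (g := l)))
        rw [Complex.ofReal_one] at this
        exact this
      have h2 := h1.smul ((tendsto_tensor_map hT a).comp (tendsto_snd (f := atTop (α := ℕ))))
      simpa using h2
  refine S.tendstoIdStarStrongly (C := 2) (fun p x => ?_) (fun p x => ?_) fun x => ?_
  · have h2 : (1 : ℝ) + 1 / (p.1 + 1) ≤ 2 := by
      have : (1 : ℝ) / (p.1 + 1) ≤ 1 := by
        rw [div_le_one (by positivity)]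
        linarith [Nat.cast_nonneg (α := ℝ) p.1]
      linarith
    refine (((hcb p.1).comp (by positivity) (hGcb p.2)).norm_le x).trans ?_
    rw [mul_one]
    exact mul_le_mul_of_nonneg_right h2 (norm_nonneg _)
  · rw [LinearMap.comp_apply, star_radialMap, hGs]
    rfl
  · refine (hB ((x : Fock H →L[ℂ] Fock H) (vacuum H))).congr fun p => ?_
    rw [LinearMap.comp_apply, radialMap_vacuum, hG]
    rfl

end StandardSubspace

/-! ### Sum and difference of the real projections onto `S` and `i S`. -/

namespace StandardSubspace

open ClosedSubmodule

variable {H : Type u} [NormedAddCommGroup H] [InnerProductSpace ℂ H] [CompleteSpace H]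
variable (S : StandardSubspace H)

/-- The real orthogonal projection onto a standard subspace. -/
noncomputable def realProj : H →L[ℝ] H := S.toClosedSubmodule.toSubmodule.starProjection

theorem realProj_mem (x : H) : S.realProj x ∈ S.toClosedSubmodule :=
  Submodule.starProjection_apply_mem _ x

theorem realProj_eq_self {x : H} (hx : x ∈ S.toClosedSubmodule) : S.realProj x = x :=
  Submodule.starProjection_eq_self_iff.2 hx

theorem realProj_idem (x : H) : S.realProj (S.realProj x) = S.realProj x :=
  S.realProj_eq_self (S.realProj_mem x)

theorem re_inner_realProj (x y : H) : (⟪S.realProj x, y⟫_ℂ).re = (⟪x, S.realProj y⟫_ℂ).re :=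
  Submodule.inner_starProjection_left_eq_right (𝕜 := ℝ) S.toClosedSubmodule.toSubmodule x y

theorem re_inner_realProj_self (x : H) : (⟪S.realProj x, x⟫_ℂ).re = ‖S.realProj x‖ ^ 2 := by
  rw [← S.realProj_idem x, re_inner_realProj, realProj_idem]
  exact (inner_self_eq_norm_sq (𝕜 := ℂ) _)

/-- The sum of the real projections onto `S` and `i S`, a complex linear operator. -/
noncomputable def sumProj : H →L[ℂ] H where
  toFun x := S.realProj x - Complex.I • S.realProj (Complex.I • x)
  map_add' x y := by simp only [map_add, smul_add]; abel
  map_smul' c x := by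
    obtain ⟨a, b⟩ := c
    have h : ∀ y : H, (⟨a, b⟩ : ℂ) • y = a • y + b • Complex.I • y := fun y => by
      rw [← Complex.coe_smul, ← Complex.coe_smul, smul_smul, ← add_smul]
      congr 1
      apply Complex.ext <;> simp
    have h2 : Complex.I • (⟨a, b⟩ : ℂ) • x = a • Complex.I • x - b • x := by
      rw [← Complex.coe_smul, ← Complex.coe_smul, smul_smul, smul_smul, ← sub_smul]
      congr 1
      apply Complex.ext <;> simp
    have h3 : S.realProj (a • x + b • Complex.I • x) =
        a • S.realProj x + b • S.realProj (Complex.I • x) := by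
      rw [map_add, S.realProj.map_smul, S.realProj.map_smul]
    have h4 : S.realProj (a • Complex.I • x - b • x) =
        a • S.realProj (Complex.I • x) - b • S.realProj x := by
      rw [map_sub, S.realProj.map_smul, S.realProj.map_smul]
    rw [h2, h, h3, h4, RingHom.id_apply]
    simp only [← Complex.coe_smul]
    match_scalars <;> apply Complex.ext <;> simp
  cont := by fun_prop

/-- The difference of the real projections onto `S` and `i S`, a conjugate linear operator. -/
noncomputable def diffProj : H →L⋆[ℂ] H where
  toFun x := S.realProj x + Complex.I • S.realProj (Complex.I • x)
  map_add' x y := by simp only [map_add, smul_add]; abel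
  map_smul' c x := by
    obtain ⟨a, b⟩ := c
    have h : ∀ y : H, (⟨a, b⟩ : ℂ) • y = a • y + b • Complex.I • y := fun y => by
      rw [← Complex.coe_smul, ← Complex.coe_smul, smul_smul, ← add_smul]
      congr 1
      apply Complex.ext <;> simp
    have h2 : Complex.I • (⟨a, b⟩ : ℂ) • x = a • Complex.I • x - b • x := by
      rw [← Complex.coe_smul, ← Complex.coe_smul, smul_smul, smul_smul, ← sub_smul]
      congr 1
      apply Complex.ext <;> simp
    have h3 : S.realProj (a • x + b • Complex.I • x) =
        a • S.realProj x + b • S.realProj (Complex.I • x) := by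
      rw [map_add, S.realProj.map_smul, S.realProj.map_smul]
    have h4 : S.realProj (a • Complex.I • x - b • x) =
        a • S.realProj (Complex.I • x) - b • S.realProj x := by
      rw [map_sub, S.realProj.map_smul, S.realProj.map_smul]
    rw [h2, h, h3, h4]
    simp only [← Complex.coe_smul]
    match_scalars <;> apply Complex.ext <;> simp
  cont := by fun_prop

theorem sumProj_apply (x : H) :
    S.sumProj x = S.realProj x - Complex.I • S.realProj (Complex.I • x) := rfl

theorem diffProj_apply (x : H) :
    S.diffProj x = S.realProj x + Complex.I • S.realProj (Complex.I • x) := rfl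

theorem sumProj_add_diffProj (x : H) : S.sumProj x + S.diffProj x = (2 : ℝ) • S.realProj x := by
  rw [sumProj_apply, diffProj_apply, two_smul]; abel

/-- That is, `D R = (2 - R) D`: with `P² = P` and `Q² = Q`, the product `(P - Q)(P + Q)` is `P - Q +
PQ - QP`, and the reversed product has the opposite commutator. -/
theorem diffProj_sumProj (x : H) :
    S.diffProj (S.sumProj x) = (2 : ℝ) • S.diffProj x - S.sumProj (S.diffProj x) := by
  simp only [sumProj_apply, diffProj_apply, map_add, map_sub, smul_add, smul_smul,
    Complex.I_mul_I, neg_smul, one_smul, map_neg, smul_neg, realProj_idem, two_smul]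
  abel

theorem diffProj_diffProj (x : H) :
    S.diffProj (S.diffProj x) = (2 : ℝ) • S.sumProj x - S.sumProj (S.sumProj x) := by
  simp only [sumProj_apply, diffProj_apply, map_add, map_sub, smul_sub, smul_smul,
    Complex.I_mul_I, neg_smul, one_smul, map_neg, smul_neg, realProj_idem, two_smul]
  abel

theorem diffProj_of_mem {x : H} (hx : x ∈ S.toClosedSubmodule) :
    S.diffProj x = (2 : ℝ) • x - S.sumProj x := by
  rw [diffProj_apply, sumProj_apply, S.realProj_eq_self hx, two_smul]; abel

theorem re_inner_I_smul_realProj (x y : H) :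
    (⟪Complex.I • S.realProj (Complex.I • x), y⟫_ℂ).re =
      (⟪x, Complex.I • S.realProj (Complex.I • y)⟫_ℂ).re := by
  have h1 : (⟪Complex.I • S.realProj (Complex.I • x), y⟫_ℂ).re =
      -(⟪S.realProj (Complex.I • x), Complex.I • y⟫_ℂ).re := by
    rw [inner_smul_left, inner_smul_right]; simp
  have h2 : (⟪x, Complex.I • S.realProj (Complex.I • y)⟫_ℂ).re =
      -(⟪Complex.I • x, S.realProj (Complex.I • y)⟫_ℂ).re := by
    rw [inner_smul_left, inner_smul_right]; simp
  rw [h1, h2, re_inner_realProj]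

theorem re_inner_sumProj (x y : H) : (⟪S.sumProj x, y⟫_ℂ).re = (⟪x, S.sumProj y⟫_ℂ).re := by
  rw [sumProj_apply, sumProj_apply, inner_sub_left, inner_sub_right, Complex.sub_re,
    Complex.sub_re, re_inner_realProj, re_inner_I_smul_realProj]

theorem re_inner_diffProj (x y : H) : (⟪S.diffProj x, y⟫_ℂ).re = (⟪x, S.diffProj y⟫_ℂ).re := by
  rw [diffProj_apply, diffProj_apply, inner_add_left, inner_add_right, Complex.add_re,
    Complex.add_re, re_inner_realProj, re_inner_I_smul_realProj]

/-- Real projections are symmetric only for the real part of the inner product; replacing `y` by `i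
y` recovers the imaginary part because the sum is complex linear. -/
theorem inner_sumProj (x y : H) : ⟪S.sumProj x, y⟫_ℂ = ⟪x, S.sumProj y⟫_ℂ := by
  apply Complex.ext (S.re_inner_sumProj x y)
  have h := S.re_inner_sumProj x (Complex.I • y)
  rw [map_smul, inner_smul_right, inner_smul_right] at h
  simpa using h

theorem inner_diffProj (x y : H) : ⟪S.diffProj x, y⟫_ℂ = ⟪S.diffProj y, x⟫_ℂ := by
  rw [← inner_conj_symm _ x]
  apply Complex.ext
  · rw [Complex.conj_re, re_inner_diffProj]
  · have h := S.re_inner_diffProj x (Complex.I • y)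
    rw [map_smulₛₗ, inner_smul_right, inner_smul_right] at h
    simp only [Complex.mul_re, Complex.I_re, Complex.I_im, Complex.conj_I, Complex.neg_re,
      Complex.neg_im, zero_mul, one_mul] at h
    rw [Complex.conj_im]
    linarith

theorem isSelfAdjoint_sumProj : IsSelfAdjoint S.sumProj :=
  ContinuousLinearMap.isSelfAdjoint_iff_isSymmetric.2 S.inner_sumProj

theorem re_inner_sumProj_self (x : H) : (⟪S.sumProj x, x⟫_ℂ).re =
    ‖S.realProj x‖ ^ 2 + ‖S.realProj (Complex.I • x)‖ ^ 2 := by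
  have h1 : (⟪Complex.I • S.realProj (Complex.I • x), x⟫_ℂ).re =
      -(⟪S.realProj (Complex.I • x), Complex.I • x⟫_ℂ).re := by
    rw [inner_smul_left, inner_smul_right]; simp
  rw [sumProj_apply, inner_sub_left, Complex.sub_re, h1, re_inner_realProj_self,
    re_inner_realProj_self]
  ring

theorem norm_realProj_le (x : H) : ‖S.realProj x‖ ≤ ‖x‖ :=
  Submodule.norm_starProjection_apply_le _ x

/-- The quadratic form is `‖P x‖² + ‖P (i x)‖²`, which lies between `0` and `2 ‖x‖²`. -/
theorem spectrum_sumProj {r : ℝ} (hr : r ∈ spectrum ℝ S.sumProj) : 0 ≤ r ∧ r ≤ 2 := by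
  have h0 : 0 ≤ S.sumProj := by
    rw [ContinuousLinearMap.nonneg_iff_isPositive, ContinuousLinearMap.isPositive_def']
    refine ⟨S.isSelfAdjoint_sumProj, fun x => ?_⟩
    change 0 ≤ (⟪S.sumProj x, x⟫_ℂ).re
    rw [re_inner_sumProj_self]
    positivity
  have h2 : S.sumProj ≤ algebraMap ℝ (H →L[ℂ] H) 2 := by
    rw [← sub_nonneg, ContinuousLinearMap.nonneg_iff_isPositive,
      ContinuousLinearMap.isPositive_def']
    refine ⟨(IsSelfAdjoint.all (2 : ℝ)).algebraMap (H →L[ℂ] H) |>.sub S.isSelfAdjoint_sumProj,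
      fun x => ?_⟩
    change 0 ≤ (⟪(2 : ℝ) • x - S.sumProj x, x⟫_ℂ).re
    have h3 : (⟪(2 : ℝ) • x, x⟫_ℂ).re = 2 * ‖x‖ ^ 2 := by
      rw [← Complex.coe_smul, inner_smul_left, Complex.conj_ofReal, Complex.re_ofReal_mul,
        ← inner_self_eq_norm_sq (𝕜 := ℂ)]
      rfl
    rw [inner_sub_left, Complex.sub_re, re_inner_sumProj_self, h3]
    have h4 := S.norm_realProj_le x
    have h5 := S.norm_realProj_le (Complex.I • x)
    rw [norm_smul, Complex.norm_I, one_mul] at h5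
    have h6 := pow_le_pow_left₀ (norm_nonneg _) h4 2
    have h7 := pow_le_pow_left₀ (norm_nonneg _) h5 2
    linarith
  exact ⟨spectrum_nonneg_of_nonneg h0 hr,
    (le_algebraMap_iff_spectrum_le S.isSelfAdjoint_sumProj).1 h2 r hr⟩

/-- A null vector is orthogonal to `S` and `i S` in the real sense, hence to `S` in the complex
sense, and the complex span of `S` is dense. This is where cyclicity enters. -/
theorem eq_zero_of_sumProj {x : H} (hx : S.sumProj x = 0) : x = 0 := by
  have h := S.re_inner_sumProj_self x
  rw [hx, inner_zero_left, Complex.zero_re] at h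
  have h1 : S.realProj x = 0 := by
    rw [← norm_eq_zero, ← sq_eq_zero_iff]; nlinarith [sq_nonneg ‖S.realProj x‖]
  have h2 : S.realProj (Complex.I • x) = 0 := by
    rw [← norm_eq_zero, ← sq_eq_zero_iff]; nlinarith [sq_nonneg ‖S.realProj x‖]
  have h3 : ∀ y ∈ S.toClosedSubmodule, ⟪x, y⟫_ℂ = 0 := fun y hy => by
    have e1 := S.re_inner_realProj x y
    have e2 := S.re_inner_realProj (Complex.I • x) y
    rw [S.realProj_eq_self hy] at e1 e2
    rw [h1, inner_zero_left] at e1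
    rw [h2, inner_zero_left, inner_smul_left] at e2
    apply Complex.ext
    · exact e1.symm
    · simpa using e2.symm
  refine S.dense_span.eq_zero_of_inner_left ℂ fun y hy => ?_
  induction hy using Submodule.span_induction with
  | mem y hy => exact h3 y hy
  | zero => simp
  | add a b _ _ ha hb => rw [inner_add_right, ha, hb, add_zero]
  | smul c a _ ha => rw [inner_smul_right, ha, mul_zero]

theorem eq_self_of_norm_realProj {x : H} (h : ‖S.realProj x‖ = ‖x‖) :
    x ∈ S.toClosedSubmodule := by
  have h1 : ‖S.realProj x - x‖ ^ 2 = 0 := by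
    rw [norm_sub_sq (𝕜 := ℂ)]
    change ‖S.realProj x‖ ^ 2 - 2 * (⟪S.realProj x, x⟫_ℂ).re + ‖x‖ ^ 2 = 0
    rw [re_inner_realProj_self, h]
    ring
  rw [sq_eq_zero_iff, norm_eq_zero, sub_eq_zero] at h1
  rw [← h1]
  exact S.realProj_mem x

theorem eq_zero_of_mem_of_I_smul_mem {x : H} (h1 : x ∈ S.toClosedSubmodule)
    (h2 : Complex.I • x ∈ S.toClosedSubmodule) : x = 0 := by
  have h3 : x ∈ S.toClosedSubmodule ⊓ S.toClosedSubmodule.mulI := by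
    refine ⟨h1, ?_⟩
    change x ∈ S.toClosedSubmodule.mulI
    rw [mem_mapEquiv_iff, scalarSMulCLE_symm_apply, Units.smul_def, Units.val_inv_eq_inv_val,
      Complex.val_UnitI, Complex.inv_I, neg_smul]
    exact S.toClosedSubmodule.toSubmodule.neg_mem h2
  rw [S.IsSeparating] at h3
  simpa using h3

/-- Equality in both projection estimates puts `x` and `i x` in `S`, which is impossible for nonzero
`x` because `S` is separating. -/
theorem eq_zero_of_sumProj_eq {x : H} (hx : S.sumProj x = (2 : ℝ) • x) : x = 0 := by
  have h := S.re_inner_sumProj_self x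
  have h3 : (⟪(2 : ℝ) • x, x⟫_ℂ).re = 2 * ‖x‖ ^ 2 := by
    rw [← Complex.coe_smul, inner_smul_left, Complex.conj_ofReal, Complex.re_ofReal_mul,
      ← inner_self_eq_norm_sq (𝕜 := ℂ)]
    rfl
  rw [hx, h3] at h
  have h4 := S.norm_realProj_le x
  have h5 := S.norm_realProj_le (Complex.I • x)
  have hI : ‖Complex.I • x‖ = ‖x‖ := by rw [norm_smul, Complex.norm_I, one_mul]
  rw [hI] at h5
  have h6 := pow_le_pow_left₀ (norm_nonneg _) h4 2
  have h7 := pow_le_pow_left₀ (norm_nonneg _) h5 2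
  refine S.eq_zero_of_mem_of_I_smul_mem (S.eq_self_of_norm_realProj ?_)
    (S.eq_self_of_norm_realProj ?_)
  · exact (sq_eq_sq₀ (norm_nonneg _) (norm_nonneg _)).1 (by linarith)
  · rw [hI]
    exact (sq_eq_sq₀ (norm_nonneg _) (norm_nonneg _)).1 (by linarith)

end StandardSubspace

/-! ### Functional calculus of the sum of the projections. -/

namespace StandardSubspace

open ClosedSubmodule

variable {H : Type u} [NormedAddCommGroup H] [InnerProductSpace ℂ H] [CompleteSpace H]
variable (S : StandardSubspace H)

/-- The functional calculus of the sum of the real projections onto `S` and `i S`. -/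
noncomputable def fc (f : ℝ → ℝ) : H →L[ℂ] H := cfc f S.sumProj

theorem fc_fc {f g : ℝ → ℝ} (hf : Continuous f) (hg : Continuous g) (x : H) :
    S.fc f (S.fc g x) = S.fc (fun r => f r * g r) x := by
  rw [fc, fc, fc, cfc_mul f g _ hf.continuousOn hg.continuousOn]
  rfl

theorem fc_sum {ι : Type*} (s : Finset ι) {f : ι → ℝ → ℝ} (hf : ∀ j, Continuous (f j)) (x : H) :
    ∑ j ∈ s, S.fc (f j) x = S.fc (fun r => ∑ j ∈ s, f j r) x := by
  have h := cfc_sum f S.sumProj s fun j _ => (hf j).continuousOn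
  have e : (∑ j ∈ s, f j) = fun r => ∑ j ∈ s, f j r := by ext r; simp
  rw [e] at h
  rw [fc, h, sum_apply]
  rfl

theorem fc_add {f g : ℝ → ℝ} (hf : Continuous f) (hg : Continuous g) (x : H) :
    S.fc (fun r => f r + g r) x = S.fc f x + S.fc g x := by
  rw [fc, fc, fc, cfc_add S.sumProj f g hf.continuousOn hg.continuousOn]
  rfl

theorem fc_sub {f g : ℝ → ℝ} (hf : Continuous f) (hg : Continuous g) (x : H) :
    S.fc (fun r => f r - g r) x = S.fc f x - S.fc g x := by
  rw [fc, fc, fc, cfc_sub f g S.sumProj hf.continuousOn hg.continuousOn]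
  rfl

theorem fc_id (x : H) : S.fc (fun r => r) x = S.sumProj x := by
  rw [fc, cfc_id' ℝ S.sumProj S.isSelfAdjoint_sumProj]

theorem fc_const (c : ℝ) (x : H) : S.fc (fun _ => c) x = c • x := by
  rw [fc, cfc_const c S.sumProj S.isSelfAdjoint_sumProj]
  rfl

theorem inner_fc (f : ℝ → ℝ) (x y : H) : ⟪S.fc f x, y⟫_ℂ = ⟪x, S.fc f y⟫_ℂ :=
  ContinuousLinearMap.isSelfAdjoint_iff_isSymmetric.1 (IsSelfAdjoint.cfc (f := f)) x y

theorem norm_fc_le {f : ℝ → ℝ} {c : ℝ} (hc : 0 ≤ c)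
    (h : ∀ r, 0 ≤ r → r ≤ 2 → |f r| ≤ c) : ‖S.fc f‖ ≤ c :=
  norm_cfc_le hc fun r hr => h r (S.spectrum_sumProj hr).1 (S.spectrum_sumProj hr).2

theorem re_inner_fc_mono {f g : ℝ → ℝ} (hf : Continuous f) (hg : Continuous g)
    (h : ∀ r, 0 ≤ r → r ≤ 2 → f r ≤ g r) (x : H) :
    (⟪S.fc f x, x⟫_ℂ).re ≤ (⟪S.fc g x, x⟫_ℂ).re := by
  have h1 : S.fc f ≤ S.fc g :=
    cfc_mono (fun r hr => h r (S.spectrum_sumProj hr).1 (S.spectrum_sumProj hr).2)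
      hf.continuousOn hg.continuousOn
  rw [ContinuousLinearMap.le_def] at h1
  have h2 := ((ContinuousLinearMap.isPositive_def' (T := S.fc g - S.fc f)).1 h1).2 x
  change 0 ≤ (⟪S.fc g x - S.fc f x, x⟫_ℂ).re at h2
  rw [inner_sub_left, Complex.sub_re] at h2
  linarith

theorem norm_fc_sq {f : ℝ → ℝ} (hf : Continuous f) (x : H) :
    ‖S.fc f x‖ ^ 2 = (⟪S.fc (fun r => f r * f r) x, x⟫_ℂ).re := by
  rw [← S.fc_fc hf hf, inner_fc, ← inner_self_eq_norm_sq (𝕜 := ℂ)]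
  rfl

theorem diffProj_real_smul (c : ℝ) (x : H) : S.diffProj (c • x) = c • S.diffProj x := by
  rw [← Complex.coe_smul, map_smulₛₗ, Complex.conj_ofReal, Complex.coe_smul]

theorem diffProj_fc_polynomial (p : Polynomial ℝ) (x : H) :
    S.diffProj (S.fc (fun r => p.eval r) x) = S.fc (fun r => p.eval (2 - r)) (S.diffProj x) := by
  have hid : ∀ x, S.diffProj (S.sumProj x) = S.fc (fun r => 2 - r) (S.diffProj x) := fun x => by
    rw [S.fc_sub continuous_const continuous_id', fc_const, fc_id, diffProj_sumProj]
  have hc : ∀ q : Polynomial ℝ, Continuous fun r => q.eval r := fun q => q.continuous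
  have hc' : ∀ q : Polynomial ℝ, Continuous fun r => q.eval (2 - r) := fun q => by fun_prop
  induction p using Polynomial.induction_on generalizing x with
  | C a => simp only [Polynomial.eval_C, fc_const, diffProj_real_smul]
  | add p q hp hq =>
    simp only [Polynomial.eval_add]
    rw [S.fc_add (hc p) (hc q), S.fc_add (hc' p) (hc' q), map_add, hp, hq]
  | monomial n a h =>
    have e : ∀ r : ℝ, (Polynomial.C a * Polynomial.X ^ (n + 1)).eval r =
        (Polynomial.C a * Polynomial.X ^ n).eval r * r := fun r => by
      simp [pow_succ, mul_assoc]
    simp only [e]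
    rw [← S.fc_fc (hc _) continuous_id',
      ← S.fc_fc (g := fun r => 2 - r) (hc' _) (by fun_prop), h, fc_id, hid]

/-- The relation `D R = (2 - R) D` passes to real polynomials, and to continuous functions by
Weierstrass on `[0, 2]`. Real coefficients are essential, since `D` is conjugate linear. -/
theorem diffProj_fc {f : ℝ → ℝ} (hf : Continuous f) (x : H) :
    S.diffProj (S.fc f x) = S.fc (fun r => f (2 - r)) (S.diffProj x) := by
  rw [← sub_eq_zero, ← norm_le_zero_iff]
  refine le_of_forall_pos_le_add fun ε hε => ?_
  set B := ‖S.diffProj‖ * ‖x‖ + ‖S.diffProj x‖ + 1 with hB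
  have hBpos : 0 < B := by positivity
  obtain ⟨p, hp⟩ := exists_polynomial_near_of_continuousOn 0 2 f hf.continuousOn (ε / B)
    (by positivity)
  have hc : Continuous fun r => p.eval r := p.continuous
  have h1 : ‖S.fc (fun r => f r - p.eval r) x‖ ≤ ε / B * ‖x‖ := by
    refine (S.fc _).le_of_opNorm_le (S.norm_fc_le (by positivity) fun r h0 h2 => ?_) x
    rw [abs_sub_comm]
    exact (hp r ⟨h0, h2⟩).le
  have h2 : ‖S.fc (fun r => f (2 - r) - p.eval (2 - r)) (S.diffProj x)‖ ≤
      ε / B * ‖S.diffProj x‖ := by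
    refine (S.fc _).le_of_opNorm_le (S.norm_fc_le (by positivity) fun r h0 h2 => ?_) _
    rw [abs_sub_comm]
    exact (hp (2 - r) ⟨by linarith, by linarith⟩).le
  have e : S.diffProj (S.fc f x) - S.fc (fun r => f (2 - r)) (S.diffProj x) =
      S.diffProj (S.fc (fun r => f r - p.eval r) x) -
        S.fc (fun r => f (2 - r) - p.eval (2 - r)) (S.diffProj x) := by
    rw [S.fc_sub hf hc, S.fc_sub (f := fun r => f (2 - r)) (g := fun r => p.eval (2 - r))
      (by fun_prop) (by fun_prop), map_sub, diffProj_fc_polynomial]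
    abel
  rw [e, zero_add]
  calc _ ≤ ‖S.diffProj‖ * (ε / B * ‖x‖) + ε / B * ‖S.diffProj x‖ :=
        (norm_sub_le _ _).trans (add_le_add ((S.diffProj.le_opNorm _).trans
          (mul_le_mul_of_nonneg_left h1 (norm_nonneg _))) h2)
    _ ≤ ε / B * B := by rw [hB]; nlinarith [div_pos hε hBpos]
    _ = ε := div_mul_cancel₀ _ hBpos.ne'

theorem diffProj_eq_fc {x : H} (hx : x ∈ S.toClosedSubmodule) :
    S.diffProj x = S.fc (fun r => 2 - r) x := by
  rw [S.fc_sub continuous_const continuous_id', fc_const, fc_id, S.diffProj_of_mem hx]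

/-- Moving one `D` across the inner product leaves `D² = R (2 - R)`, so norms involving `D` become
scalar inequalities on `[0, 2]`. -/
theorem norm_diffProj_fc_sq {f : ℝ → ℝ} (hf : Continuous f) (x : H) :
    ‖S.diffProj (S.fc f x)‖ ^ 2 =
      (⟪S.fc (fun r => r * (2 - r) * (f r * f r)) x, x⟫_ℂ).re := by
  have h1 : ∀ y, S.diffProj (S.diffProj y) = S.fc (fun r => r * (2 - r)) y := fun y => by
    rw [← S.fc_fc continuous_id' (by fun_prop), S.fc_sub continuous_const continuous_id',
      fc_const, fc_id, fc_id, diffProj_diffProj, map_sub, ← Complex.coe_smul,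
      ← Complex.coe_smul, map_smul]
  have h2 : (fun r => r * (2 - r) * (f r * f r)) = fun r => f r * (r * (2 - r) * f r) := by
    ext r; ring
  rw [h2, ← S.fc_fc hf (by fun_prop), ← S.fc_fc (by fun_prop) hf, inner_fc,
    ← h1, inner_diffProj, ← inner_self_eq_norm_sq (𝕜 := ℂ)]
  rfl

/-- Densely many vectors lie in the range of `r (2 - r)`, applied to the sum of the projections. -/
theorem dense_range_fc : Dense (Set.range (S.fc fun r => r * (2 - r))) := by
  have h0 : Continuous fun r : ℝ => 2 - r := by fun_prop
  -- By self-adjointness it suffices that `R (2 - R)` is injective, and both factors are.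
  have h := (S.fc fun r => r * (2 - r)).range.topologicalClosure_eq_top_iff.2 ?_
  · rw [← Submodule.dense_iff_topologicalClosure_eq_top] at h
    exact h
  rw [Submodule.eq_bot_iff]
  intro x hx
  have h1 : S.fc (fun r => r * (2 - r)) x = 0 := by
    rw [← inner_self_eq_zero (𝕜 := ℂ), inner_fc]
    exact (Submodule.mem_orthogonal' _ _).1 hx _ ⟨_, rfl⟩
  rw [← S.fc_fc continuous_id' h0, fc_id] at h1
  have h2 := S.eq_zero_of_sumProj h1
  rw [S.fc_sub continuous_const continuous_id', fc_const, fc_id, sub_eq_zero] at h2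
  exact S.eq_zero_of_sumProj_eq h2.symm

end StandardSubspace

/-! ### A partition of unity by hat functions on the line. -/

section Hat

/-- The hat function of height one on `[j - 1, j + 1]`. -/
noncomputable def hat (j : ℤ) (x : ℝ) : ℝ := max 0 (1 - |x - j|)

theorem hat_nonneg (j : ℤ) (x : ℝ) : 0 ≤ hat j x := le_max_left _ _

theorem continuous_hat (j : ℤ) : Continuous (hat j) := by unfold hat; fun_prop

theorem hat_eq_zero {j : ℤ} {x : ℝ} (h : 1 ≤ |x - j|) : hat j x = 0 :=
  max_eq_left (by linarith)

theorem hat_floor (x : ℝ) : hat ⌊x⌋ x = 1 - Int.fract x := by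
  have h1 := Int.fract_nonneg x
  have h2 := Int.fract_lt_one x
  have h3 : x - ⌊x⌋ = Int.fract x := rfl
  rw [hat, h3, abs_of_nonneg h1, max_eq_right (by linarith)]

theorem hat_floor_add_one (x : ℝ) : hat (⌊x⌋ + 1) x = Int.fract x := by
  have h1 := Int.fract_nonneg x
  have h2 := Int.fract_lt_one x
  have h3 : x - ((⌊x⌋ + 1 : ℤ) : ℝ) = Int.fract x - 1 := by
    push_cast; rw [← Int.self_sub_floor]; ring
  rw [hat, h3, abs_of_nonpos (by linarith), max_eq_right (by linarith)]
  ring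

theorem hat_eq_zero_of_ne {j : ℤ} {x : ℝ} (h1 : j ≠ ⌊x⌋) (h2 : j ≠ ⌊x⌋ + 1) : hat j x = 0 := by
  apply hat_eq_zero
  have h3 := Int.floor_le x
  have h4 := Int.lt_floor_add_one x
  rcases lt_or_gt_of_ne h1 with h | h
  · have : (j : ℝ) + 1 ≤ ⌊x⌋ := by exact_mod_cast h
    exact le_trans (by linarith) (le_abs_self _)
  · have h5 : ⌊x⌋ + 2 ≤ j := by omega
    have : (⌊x⌋ : ℝ) + 2 ≤ j := by exact_mod_cast h5
    exact le_trans (by linarith) (neg_le_abs _)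

theorem sum_hat_pair (x : ℝ) : ∑ j ∈ ({⌊x⌋, ⌊x⌋ + 1} : Finset ℤ), hat j x = 1 := by
  rw [Finset.sum_pair (by omega), hat_floor, hat_floor_add_one]
  ring

/-- At a given point only the hats at the floor and at the next integer can be nonzero, and these
two add up to one. -/
theorem sum_hat_le (s : Finset ℤ) (x : ℝ) : ∑ j ∈ s, hat j x ≤ 1 := by
  rw [← sum_hat_pair x, ← Finset.sum_filter_add_sum_filter_not s (· ∈ ({⌊x⌋, ⌊x⌋ + 1} : Finset ℤ)),
    Finset.sum_eq_zero (s := s.filter (· ∉ ({⌊x⌋, ⌊x⌋ + 1} : Finset ℤ))), add_zero]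
  · exact Finset.sum_le_sum_of_subset_of_nonneg (fun j hj => (Finset.mem_filter.1 hj).2)
      fun j _ _ => hat_nonneg j x
  · intro j hj
    have h := (Finset.mem_filter.1 hj).2
    simp only [Finset.mem_insert, Finset.mem_singleton, not_or] at h
    exact hat_eq_zero_of_ne h.1 h.2

theorem sum_hat_eq {s : Finset ℤ} {x : ℝ} (h1 : ⌊x⌋ ∈ s) (h2 : ⌊x⌋ + 1 ∈ s) :
    ∑ j ∈ s, hat j x = 1 := by
  rw [← sum_hat_pair x]
  symm
  refine Finset.sum_subset ?_ fun j _ hj => ?_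
  · intro j hj
    simp only [Finset.mem_insert, Finset.mem_singleton] at hj
    rcases hj with rfl | rfl <;> assumption
  · simp only [Finset.mem_insert, Finset.mem_singleton, not_or] at hj
    exact hat_eq_zero_of_ne hj.1 hj.2

end Hat

/-! ### Cauchy–Schwarz estimates for the two halves of the approximating operator. -/

namespace StandardSubspace

open ClosedSubmodule

variable {H : Type u} [NormedAddCommGroup H] [InnerProductSpace ℂ H] [CompleteSpace H]
variable (S : StandardSubspace H)

theorem sum_norm_fc_sq_le {ι : Type*} (s : Finset ι) {f : ι → ℝ → ℝ} (hf : ∀ j, Continuous (f j))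
    (h : ∀ r, 0 ≤ r → r ≤ 2 → ∑ j ∈ s, f j r * f j r ≤ 1) (x : H) :
    ∑ j ∈ s, ‖S.fc (f j) x‖ ^ 2 ≤ ‖x‖ ^ 2 := by
  have h1 : ∑ j ∈ s, ‖S.fc (f j) x‖ ^ 2 =
      (⟪S.fc (fun r => ∑ j ∈ s, f j r * f j r) x, x⟫_ℂ).re := by
    rw [← S.fc_sum (f := fun j r => f j r * f j r) s fun j => (hf j).mul (hf j), sum_inner, Complex.re_sum]
    exact Finset.sum_congr rfl fun j _ => S.norm_fc_sq (hf j) x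
  have h2 := S.re_inner_fc_mono (f := fun r => ∑ j ∈ s, f j r * f j r) (g := fun _ => 1)
    (by fun_prop) continuous_const h x
  rw [fc_const, one_smul] at h2
  rw [h1]
  exact h2.trans (inner_self_eq_norm_sq (𝕜 := ℂ) x).le

theorem norm_le_of_inner_le {X : Type*} [NormedAddCommGroup X] [InnerProductSpace ℂ X]
    {x : X} {C : ℝ} (hC : 0 ≤ C) (h : ∀ y : X, ‖⟪y, x⟫_ℂ‖ ≤ C * ‖y‖) : ‖x‖ ≤ C := by
  have h1 := h x
  rw [inner_self_eq_norm_sq_to_K] at h1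
  norm_num at h1
  rcases (norm_nonneg x).eq_or_lt with h2 | h2
  · rw [← h2]; exact hC
  · nlinarith

theorem sum_mul_norm_le {ι : Type*} (s : Finset ι) {a b : ι → ℝ} {A B : ℝ} (hA : 0 ≤ A)
    (hB : 0 ≤ B) (h1 : ∑ j ∈ s, a j ^ 2 ≤ A ^ 2) (h2 : ∑ j ∈ s, b j ^ 2 ≤ B ^ 2) :
    ∑ j ∈ s, a j * b j ≤ A * B :=
  (Real.sum_mul_le_sqrt_mul_sqrt s a b).trans
    (mul_le_mul (Real.sqrt_le_iff.2 ⟨hA, h1⟩) (Real.sqrt_le_iff.2 ⟨hB, h2⟩) (Real.sqrt_nonneg _) hA)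

/-- The pairing with `y` splits into terms bounded by `‖fⱼ(R) x‖ ‖fⱼ(R) y‖`. The bound on `∑ fⱼ²`
controls both square sums, whatever the contractions `pⱼ` are. -/
theorem norm_sum_fc_le {ι : Type*} (s : Finset ι) {f : ι → ℝ → ℝ} (hf : ∀ j, Continuous (f j))
    (h : ∀ r, 0 ≤ r → r ≤ 2 → ∑ j ∈ s, f j r * f j r ≤ 1) {p : ι → H →L[ℂ] H}
    (hp : ∀ j x, ‖p j x‖ ≤ ‖x‖) (x : H) :
    ‖∑ j ∈ s, S.fc (f j) (p j (S.fc (f j) x))‖ ≤ ‖x‖ := by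
  refine norm_le_of_inner_le (norm_nonneg _) fun y => ?_
  rw [inner_sum]
  calc _ ≤ ∑ j ∈ s, ‖S.fc (f j) x‖ * ‖S.fc (f j) y‖ := by
        refine (norm_sum_le _ _).trans (Finset.sum_le_sum fun j _ => ?_)
        rw [← inner_fc, mul_comm]
        exact (norm_inner_le_norm _ _).trans (mul_le_mul_of_nonneg_left (hp _ _) (norm_nonneg _))
    _ ≤ ‖x‖ * ‖y‖ := sum_mul_norm_le s (norm_nonneg _) (norm_nonneg _)
        (S.sum_norm_fc_sq_le s hf h x) (S.sum_norm_fc_sq_le s hf h y)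

/-- Moving `a(R)` through `D` reflects the variable, and `D² = R (2 - R)` turns the claim into the
hypothesis evaluated at `2 - r`. -/
theorem norm_fc_diffProj_sq_le {f a : ℝ → ℝ} (hf : Continuous f) (ha : Continuous a) {A : ℝ}
    (h : ∀ r, 0 ≤ r → r ≤ 2 → r * (2 - r) * (a r * a r) ≤ A * (f r * f r)) (x : H) :
    ‖S.fc a (S.diffProj x)‖ ^ 2 ≤ A * ‖S.fc (fun r => f (2 - r)) x‖ ^ 2 := by
  have ha' : Continuous fun r => a (2 - r) := by fun_prop
  have hf' : Continuous fun r => f (2 - r) := by fun_prop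
  have e : S.fc a (S.diffProj x) = S.diffProj (S.fc (fun r => a (2 - r)) x) := by
    rw [S.diffProj_fc ha']; simp
  rw [e, S.norm_diffProj_fc_sq ha', S.norm_fc_sq hf']
  have h1 := S.re_inner_fc_mono (f := fun r => r * (2 - r) * (a (2 - r) * a (2 - r)))
    (g := fun r => A * (f (2 - r) * f (2 - r))) (by fun_prop) (by fun_prop) (fun r h0 h2 => by
      have := h (2 - r) (by linarith) (by linarith)
      rw [sub_sub_cancel, mul_comm (2 - r) r] at this
      exact this) x
  refine h1.trans (le_of_eq ?_)
  rw [← S.fc_fc (f := fun _ => A) continuous_const (by fun_prop), fc_const, ← Complex.coe_smul,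
    inner_smul_left, Complex.conj_ofReal, Complex.re_ofReal_mul]

/-- Pairing with `y` moves the outer `D` onto `y`, so each term is controlled by `√(Aⱼ Bⱼ)`.
Individually `Aⱼ` and `Bⱼ` may be large, near `0` and `2` respectively; only their product has to be
bounded. -/
theorem norm_sum_diffProj_le {ι : Type*} (s : Finset ι) {f a b : ι → ℝ → ℝ}
    (hf : ∀ j, Continuous (f j)) (ha : ∀ j, Continuous (a j)) (hb : ∀ j, Continuous (b j))
    (h : ∀ r, 0 ≤ r → r ≤ 2 → ∑ j ∈ s, f j r * f j r ≤ 1)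
    {A B : ι → ℝ} {C : ℝ} (hC : 0 ≤ C) (hA0 : ∀ j ∈ s, 0 ≤ A j)
    (hAB : ∀ j ∈ s, A j * B j ≤ C ^ 2)
    (hA : ∀ j ∈ s, ∀ r, 0 ≤ r → r ≤ 2 → r * (2 - r) * (a j r * a j r) ≤ A j * (f j r * f j r))
    (hB : ∀ j ∈ s, ∀ r, 0 ≤ r → r ≤ 2 → r * (2 - r) * (b j r * b j r) ≤ B j * (f j r * f j r))
    {p : ι → H →L[ℂ] H} (hp : ∀ j x, ‖p j x‖ ≤ ‖x‖) (x : H) :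
    ‖∑ j ∈ s, S.diffProj (S.fc (a j) (p j (S.fc (b j) (S.diffProj x))))‖ ≤ C * ‖x‖ := by
  refine norm_le_of_inner_le (by positivity) fun y => ?_
  rw [inner_sum]
  set F : ι → H → ℝ := fun j x => ‖S.fc (fun r => f j (2 - r)) x‖ with hF
  have hF2 : ∀ x, ∑ j ∈ s, F j x ^ 2 ≤ ‖x‖ ^ 2 := fun x =>
    S.sum_norm_fc_sq_le (f := fun j r => f j (2 - r)) s (fun j => (hf j).comp (by fun_prop))
      (fun r h0 h2 => h (2 - r) (by linarith) (by linarith)) x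
  calc _ ≤ ∑ j ∈ s, C * (F j x * F j y) := by
        refine (norm_sum_le _ _).trans (Finset.sum_le_sum fun j hj => ?_)
        rw [norm_inner_symm, inner_diffProj, ← inner_fc]
        have h1 : ‖⟪S.fc (a j) (S.diffProj y), p j (S.fc (b j) (S.diffProj x))⟫_ℂ‖ ≤
            ‖S.fc (a j) (S.diffProj y)‖ * ‖S.fc (b j) (S.diffProj x)‖ :=
          (norm_inner_le_norm _ _).trans (mul_le_mul_of_nonneg_left (hp _ _) (norm_nonneg _))
        refine h1.trans (abs_le_of_sq_le_sq' ?_ (by positivity)).2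
        have h2 := S.norm_fc_diffProj_sq_le (hf j) (ha j) (hA j hj) y
        have h3 := S.norm_fc_diffProj_sq_le (hf j) (hb j) (hB j hj) x
        calc _ = ‖S.fc (a j) (S.diffProj y)‖ ^ 2 * ‖S.fc (b j) (S.diffProj x)‖ ^ 2 := mul_pow _ _ _
          _ ≤ (A j * F j y ^ 2) * (B j * F j x ^ 2) :=
            mul_le_mul h2 h3 (by positivity) (mul_nonneg (hA0 j hj) (by positivity))
          _ = A j * B j * (F j x * F j y) ^ 2 := by ring
          _ ≤ C ^ 2 * (F j x * F j y) ^ 2 :=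
            mul_le_mul_of_nonneg_right (hAB j hj) (by positivity)
          _ = _ := by ring
    _ ≤ C * (‖x‖ * ‖y‖) := by
        rw [← Finset.mul_sum]
        exact mul_le_mul_of_nonneg_left (sum_mul_norm_le s (norm_nonneg _) (norm_nonneg _)
          (hF2 x) (hF2 y)) hC
    _ = _ := by ring

end StandardSubspace

/-! ### Hats rescaled to `[0, 2]`, and their quotients by `r` and `2 - r`. -/

section Hat

/-- The square root of a hat function, rescaled to width `2 / m ^ 2`. -/
noncomputable def hatRoot (m : ℕ) (j : ℤ) (r : ℝ) : ℝ := √(hat j (m ^ 2 * r))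

/-- The function `hatRoot m j r / r`. -/
noncomputable def hatRootDiv (m : ℕ) (j : ℤ) (r : ℝ) : ℝ := hatRoot m j r / max r (1 / m ^ 2)

/-- The function `hatRoot m j r / (2 - r)`. -/
noncomputable def hatRootDivSub (m : ℕ) (j : ℤ) (r : ℝ) : ℝ :=
  hatRoot m j r / max (2 - r) (1 / m ^ 2)

/-- The indices of the hats whose supports cover `[1 / m, 2 - 1 / m]`. -/
noncomputable def hatIndex (m : ℕ) : Finset ℤ := Finset.Icc (m : ℤ) (2 * m ^ 2 - m)

variable {m : ℕ} {j : ℤ} {r : ℝ}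

theorem continuous_hatRoot (m : ℕ) (j : ℤ) : Continuous (hatRoot m j) := by
  have := continuous_hat j
  unfold hatRoot
  fun_prop

theorem continuous_hatRootDiv (hm : 2 ≤ m) (j : ℤ) : Continuous (hatRootDiv m j) := by
  refine (continuous_hatRoot m j).div₀ (by fun_prop) fun r => ?_
  exact (lt_max_of_lt_right (by positivity)).ne'

theorem continuous_hatRootDivSub (hm : 2 ≤ m) (j : ℤ) : Continuous (hatRootDivSub m j) := by
  refine (continuous_hatRoot m j).div₀ (by fun_prop) fun r => ?_
  exact (lt_max_of_lt_right (by positivity)).ne'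

theorem hatRoot_mul_self (m : ℕ) (j : ℤ) (r : ℝ) :
    hatRoot m j r * hatRoot m j r = hat j (m ^ 2 * r) := Real.mul_self_sqrt (hat_nonneg _ _)

theorem lt_of_hatRoot_ne_zero (h : hatRoot m j r ≠ 0) :
    (j : ℝ) - 1 < m ^ 2 * r ∧ m ^ 2 * r < j + 1 := by
  have h1 : |m ^ 2 * r - j| < 1 := by
    by_contra h1
    exact h (by rw [hatRoot, hat_eq_zero (not_lt.1 h1), Real.sqrt_zero])
  have := abs_lt.1 h1
  constructor <;> linarith

theorem cast_of_mem_hatIndex (hj : j ∈ hatIndex m) :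
    (m : ℝ) ≤ j ∧ (j : ℝ) ≤ 2 * m ^ 2 - m := by
  have h := Finset.mem_Icc.1 hj
  exact ⟨by exact_mod_cast h.1, by exact_mod_cast h.2⟩

/-- The cutoffs in the denominators only serve continuity on the whole line. They are inactive on
the relevant supports, where `r` and `2 - r` are at least `(m - 1)/m² ≥ 1/m²`. -/
theorem max_eq_of_hatRoot_ne_zero (hm : 2 ≤ m) (hj : j ∈ hatIndex m) (h : hatRoot m j r ≠ 0) :
    max r (1 / m ^ 2) = r ∧ 0 < r ∧ max (2 - r) (1 / m ^ 2) = 2 - r ∧ 0 < 2 - r := by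
  have hm' : (2 : ℝ) ≤ m := by exact_mod_cast hm
  have hN : (0 : ℝ) < m ^ 2 := by positivity
  have h0 : (0 : ℝ) < 1 / m ^ 2 := by positivity
  obtain ⟨h1, h2⟩ := lt_of_hatRoot_ne_zero h
  obtain ⟨h3, h4⟩ := cast_of_mem_hatIndex hj
  have h5 : 1 / (m : ℝ) ^ 2 ≤ r := by rw [div_le_iff₀ hN]; linarith
  have h6 : 1 / (m : ℝ) ^ 2 ≤ 2 - r := by rw [div_le_iff₀ hN]; linarith
  exact ⟨max_eq_left h5, h0.trans_le h5, max_eq_left h6, h0.trans_le h6⟩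

theorem mul_hatRootDiv (hm : 2 ≤ m) (hj : j ∈ hatIndex m) (r : ℝ) :
    r * hatRootDiv m j r = hatRoot m j r := by
  by_cases h : hatRoot m j r = 0
  · rw [hatRootDiv, h, zero_div, mul_zero]
  · obtain ⟨h1, h2, -, -⟩ := max_eq_of_hatRoot_ne_zero hm hj h
    rw [hatRootDiv, h1, mul_div_cancel₀ _ h2.ne']

theorem mul_hatRootDivSub (hm : 2 ≤ m) (hj : j ∈ hatIndex m) (r : ℝ) :
    (2 - r) * hatRootDivSub m j r = hatRoot m j r := by
  by_cases h : hatRoot m j r = 0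
  · rw [hatRootDivSub, h, zero_div, mul_zero]
  · obtain ⟨-, -, h1, h2⟩ := max_eq_of_hatRoot_ne_zero hm hj h
    rw [hatRootDivSub, h1, mul_div_cancel₀ _ h2.ne']

/-- The quotient `(2 - r)/r` is bounded through the endpoints `(j ± 1)/m²` of the support of the
hat. -/
theorem hatRootDiv_le (hm : 2 ≤ m) (hj : j ∈ hatIndex m) (r : ℝ) :
    r * (2 - r) * (hatRootDiv m j r * hatRootDiv m j r) ≤
      (2 * m ^ 2 - j + 1) / (j - 1) * (hatRoot m j r * hatRoot m j r) := by
  by_cases h : hatRoot m j r = 0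
  · rw [hatRootDiv, h]; simp
  obtain ⟨h1, h2, h3, h4⟩ := max_eq_of_hatRoot_ne_zero hm hj h
  obtain ⟨h5, h6⟩ := lt_of_hatRoot_ne_zero h
  obtain ⟨h7, h8⟩ := cast_of_mem_hatIndex hj
  have hm' : (2 : ℝ) ≤ m := by exact_mod_cast hm
  have hN : (0 : ℝ) < m ^ 2 := by positivity
  have e : r * (2 - r) * (hatRootDiv m j r * hatRootDiv m j r) =
      (2 - r) / r * (hatRoot m j r * hatRoot m j r) := by
    rw [hatRootDiv, h1]; field_simp
  rw [e]
  refine mul_le_mul_of_nonneg_right ?_ (mul_self_nonneg _)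
  rw [div_le_div_iff₀ h2 (by linarith), ← mul_le_mul_iff_right₀ hN]
  calc _ = (m ^ 2 * (2 - r)) * (j - 1) := by ring
    _ ≤ (2 * m ^ 2 - j + 1) * (m ^ 2 * r) :=
      mul_le_mul (by linarith) h5.le (by linarith) (by linarith)
    _ = _ := by ring

theorem hatRootDivSub_le (hm : 2 ≤ m) (hj : j ∈ hatIndex m) (r : ℝ) :
    r * (2 - r) * (hatRootDivSub m j r * hatRootDivSub m j r) ≤
      (j + 1) / (2 * m ^ 2 - j - 1) * (hatRoot m j r * hatRoot m j r) := by
  by_cases h : hatRoot m j r = 0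
  · rw [hatRootDivSub, h]; simp
  obtain ⟨h1, h2, h3, h4⟩ := max_eq_of_hatRoot_ne_zero hm hj h
  obtain ⟨h5, h6⟩ := lt_of_hatRoot_ne_zero h
  obtain ⟨h7, h8⟩ := cast_of_mem_hatIndex hj
  have hm' : (2 : ℝ) ≤ m := by exact_mod_cast hm
  have hN : (0 : ℝ) < m ^ 2 := by positivity
  have e : r * (2 - r) * (hatRootDivSub m j r * hatRootDivSub m j r) =
      r / (2 - r) * (hatRoot m j r * hatRoot m j r) := by
    rw [hatRootDivSub, h3]; field_simp
  rw [e]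
  refine mul_le_mul_of_nonneg_right ?_ (mul_self_nonneg _)
  rw [div_le_div_iff₀ h4 (by linarith), ← mul_le_mul_iff_right₀ hN]
  calc _ = (m ^ 2 * r) * (2 * m ^ 2 - j - 1) := by ring
    _ ≤ (j + 1) * (m ^ 2 * (2 - r)) :=
      mul_le_mul h6.le (by linarith) (by linarith) (by linarith)
    _ = _ := by ring

/-- Regrouped, the product is `(t + 1)/(t - 1)` at `t = j` times the same at `t = 2m² - j`. Both
values are at least `m` and the function decreases. The mesh `1/m²` is chosen so that it is small
relative to the distance `1/m` from the endpoints. -/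
theorem ratio_le (hm : 2 ≤ m) (hj : j ∈ hatIndex m) :
    (2 * (m : ℝ) ^ 2 - j + 1) / (j - 1) * ((j + 1) / (2 * m ^ 2 - j - 1)) ≤
      (((m : ℝ) + 1) / (m - 1)) ^ 2 := by
  obtain ⟨h7, h8⟩ := cast_of_mem_hatIndex hj
  have hm' : (2 : ℝ) ≤ m := by exact_mod_cast hm
  have key : ∀ t : ℝ, m ≤ t → (t + 1) / (t - 1) ≤ ((m : ℝ) + 1) / (m - 1) := fun t ht => by
    rw [div_le_div_iff₀ (by linarith) (by linarith)]
    nlinarith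
  calc _ = (((j : ℝ) + 1) / (j - 1)) * (((2 * m ^ 2 - j) + 1) / ((2 * m ^ 2 - j) - 1)) := by
        rw [div_mul_div_comm, div_mul_div_comm, mul_comm (2 * (m : ℝ) ^ 2 - j + 1)]
    _ ≤ (((m : ℝ) + 1) / (m - 1)) * (((m : ℝ) + 1) / (m - 1)) :=
        mul_le_mul (key _ h7) (key _ (by linarith))
          (div_nonneg (by linarith) (by linarith)) (div_nonneg (by linarith) (by linarith))
    _ = _ := (sq _).symm

theorem sum_hatRoot_le (m : ℕ) (r : ℝ) :
    ∑ j ∈ hatIndex m, hatRoot m j r * hatRoot m j r ≤ 1 := by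
  simp only [hatRoot_mul_self]
  exact sum_hat_le _ _

theorem sum_hatRoot_nonneg (m : ℕ) (r : ℝ) :
    0 ≤ ∑ j ∈ hatIndex m, hatRoot m j r * hatRoot m j r :=
  Finset.sum_nonneg fun _ _ => mul_self_nonneg _

/-- The hats add up to one except near `0` and `2`. There the weight `r (2 - r)` is at most `2/m`,
and this weight is harmless because `R (2 - R)` has dense range. -/
theorem abs_sum_hatRoot_sub_one_mul_le (hm : 2 ≤ m) (h0 : 0 ≤ r) (h2 : r ≤ 2) :
    |((∑ j ∈ hatIndex m, hatRoot m j r * hatRoot m j r) - 1) * (r * (2 - r))| ≤ 2 / m := by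
  have hm' : (0 : ℝ) < m := by positivity
  have h3 := sum_hatRoot_le m r
  have h4 := sum_hatRoot_nonneg m r
  have h2m : (0 : ℝ) ≤ 2 / m := by positivity
  by_cases h : (m : ℝ) ≤ m ^ 2 * r ∧ (m : ℝ) ^ 2 * r < 2 * m ^ 2 - m
  · have h5 : ∑ j ∈ hatIndex m, hatRoot m j r * hatRoot m j r = 1 := by
      simp only [hatRoot_mul_self]
      have h6 : (m : ℤ) ≤ ⌊(m : ℝ) ^ 2 * r⌋ := Int.le_floor.2 (by exact_mod_cast h.1)
      have h7 : ⌊(m : ℝ) ^ 2 * r⌋ < 2 * m ^ 2 - m := Int.floor_lt.2 (by push_cast; exact h.2)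
      exact sum_hat_eq (Finset.mem_Icc.2 ⟨h6, by omega⟩) (Finset.mem_Icc.2 ⟨by omega, by omega⟩)
    rw [h5, sub_self, zero_mul, abs_zero]
    exact h2m
  · rw [abs_mul, abs_of_nonneg (mul_nonneg h0 (sub_nonneg.2 h2)), abs_of_nonpos (by linarith)]
    have h5 : r * (2 - r) ≤ 2 / m := by
      rw [not_and_or, not_le, not_lt] at h
      rw [le_div_iff₀ hm']
      rcases h with h | h
      · have : m * r < 1 := by
          rw [sq, mul_assoc] at h
          exact lt_of_mul_lt_mul_left (by linarith) hm'.le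
        nlinarith
      · have : m * (2 - r) ≤ 1 := by
          refine le_of_mul_le_mul_left ?_ hm'
          nlinarith
        nlinarith
    refine (mul_le_of_le_one_left (mul_nonneg h0 (sub_nonneg.2 h2)) (by linarith)).trans h5

end Hat

/-! ### Finite rank contractions that preserve a standard subspace. -/

namespace StandardSubspace

open ClosedSubmodule

variable {H : Type u} [NormedAddCommGroup H] [InnerProductSpace ℂ H] [CompleteSpace H]
variable (S : StandardSubspace H)

/-- The projection onto the image of the span of `V` under a hat of the sum of projections. -/
noncomputable def hatProj (V : Finset H) (m : ℕ) (j : ℤ) : H →L[ℂ] H :=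
  (Submodule.map (S.fc (hatRoot m j)).toLinearMap
    (Submodule.span ℂ (V : Set H))).starProjection

theorem norm_hatProj_apply_le (V : Finset H) (m : ℕ) (j : ℤ) (x : H) :
    ‖S.hatProj V m j x‖ ≤ ‖x‖ := Submodule.norm_starProjection_apply_le _ x

theorem hatProj_apply_of_mem {V : Finset H} {x : H} (hx : x ∈ V) (m : ℕ) (j : ℤ) :
    S.hatProj V m j (S.fc (hatRoot m j) x) = S.fc (hatRoot m j) x :=
  Submodule.starProjection_eq_self_iff.2 ⟨x, Submodule.subset_span hx, rfl⟩

/-- A finite rank operator that preserves `S` and is close to the identity on `V`. -/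
noncomputable def approxId (V : Finset H) (m : ℕ) : H →L[ℂ] H :=
  (((1 - 1 / m) / 2 : ℝ) : ℂ) • ∑ j ∈ hatIndex m,
    (S.fc (hatRoot m j) ∘L S.hatProj V m j ∘L S.fc (hatRoot m j) +
      S.diffProj.comp ((S.fc (hatRootDiv m j)).comp ((S.hatProj V m j).comp
        ((S.fc (hatRootDivSub m j)).comp S.diffProj))))

theorem approxId_apply (V : Finset H) (m : ℕ) (x : H) : S.approxId V m x =
    ((1 - 1 / m) / 2 : ℝ) • (∑ j ∈ hatIndex m,
      S.fc (hatRoot m j) (S.hatProj V m j (S.fc (hatRoot m j) x)) +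
    ∑ j ∈ hatIndex m, S.diffProj (S.fc (hatRootDiv m j) (S.hatProj V m j
        (S.fc (hatRootDivSub m j) (S.diffProj x))))) := by
  rw [← Finset.sum_add_distrib, approxId, smul_apply, sum_apply,
    Complex.coe_smul]
  rfl

theorem norm_approxId_le (V : Finset H) {m : ℕ} (hm : 2 ≤ m) : ‖S.approxId V m‖ ≤ 1 := by
  refine ContinuousLinearMap.opNorm_le_bound _ zero_le_one fun x => ?_
  have hm' : (2 : ℝ) ≤ m := by exact_mod_cast hm
  have hC : (0 : ℝ) ≤ ((m : ℝ) + 1) / (m - 1) := div_nonneg (by linarith) (by linarith)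
  have h1 := S.norm_sum_fc_le (hatIndex m) (continuous_hatRoot m)
    (fun r _ _ => sum_hatRoot_le m r) (S.norm_hatProj_apply_le V m) x
  have h2 := S.norm_sum_diffProj_le (hatIndex m) (continuous_hatRoot m)
    (continuous_hatRootDiv hm) (continuous_hatRootDivSub hm) (fun r _ _ => sum_hatRoot_le m r) hC
    (A := fun j => (2 * (m : ℝ) ^ 2 - j + 1) / (j - 1))
    (B := fun j => ((j : ℝ) + 1) / (2 * m ^ 2 - j - 1)) (fun j hj => by
      obtain ⟨h7, h8⟩ := cast_of_mem_hatIndex hj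
      exact div_nonneg (by linarith) (by linarith))
    (fun j hj => ratio_le hm hj) (fun j hj r _ _ => hatRootDiv_le hm hj r)
    (fun j hj r _ _ => hatRootDivSub_le hm hj r) (S.norm_hatProj_apply_le V m) x
  have h3 : (0 : ℝ) ≤ (1 - 1 / m) / 2 := by
    have : 1 / (m : ℝ) ≤ 1 := by rw [div_le_one (by linarith)]; linarith
    linarith
  rw [approxId_apply, norm_smul, Real.norm_of_nonneg h3]
  refine (mul_le_mul_of_nonneg_left ((norm_add_le _ _).trans (add_le_add h1 h2)) h3).trans
    (le_of_eq ?_)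
  -- The two halves contribute `1 + (m + 1)/(m - 1) = 2m/(m - 1)`, which the prefactor `(1 - 1/m)/2`
  -- turns into exactly one.
  have h4 : (m : ℝ) - 1 ≠ 0 := by linarith
  field_simp
  ring

/-- On `S` the operator `D` acts as `2 - R`, and the division by `2 - r` undoes it. -/
theorem fc_hatRootDivSub_diffProj {m : ℕ} (hm : 2 ≤ m) {j : ℤ} (hj : j ∈ hatIndex m) {x : H}
    (hx : x ∈ S.toClosedSubmodule) :
    S.fc (hatRootDivSub m j) (S.diffProj x) = S.fc (hatRoot m j) x := by
  rw [S.diffProj_eq_fc hx, S.fc_fc (continuous_hatRootDivSub hm j) (by fun_prop)]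
  congr 2
  ext r
  rw [mul_comm, mul_hatRootDivSub hm hj]

/-- For `x ∈ S` both halves come from the same vector `y`, as `R y` and `D y`, and `R + D` is twice
the projection onto `S`. -/
theorem approxId_mem (V : Finset H) {m : ℕ} (hm : 2 ≤ m) {x : H}
    (hx : x ∈ S.toClosedSubmodule) : S.approxId V m x ∈ S.toClosedSubmodule := by
  set y := ∑ j ∈ hatIndex m, S.fc (hatRootDiv m j) (S.hatProj V m j (S.fc (hatRoot m j) x))
    with hy
  have h1 : ∑ j ∈ hatIndex m, S.fc (hatRoot m j) (S.hatProj V m j (S.fc (hatRoot m j) x)) =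
      S.sumProj y := by
    rw [hy, map_sum]
    refine Finset.sum_congr rfl fun j hj => ?_
    rw [← fc_id, S.fc_fc continuous_id' (continuous_hatRootDiv hm j)]
    congr 2
    ext r
    exact (mul_hatRootDiv hm hj r).symm
  have h2 : ∑ j ∈ hatIndex m, S.diffProj (S.fc (hatRootDiv m j) (S.hatProj V m j
      (S.fc (hatRootDivSub m j) (S.diffProj x)))) = S.diffProj y := by
    rw [hy, map_sum]
    refine Finset.sum_congr rfl fun j hj => ?_
    rw [S.fc_hatRootDivSub_diffProj hm hj hx]
  rw [approxId_apply, h1, h2, sumProj_add_diffProj]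
  exact S.toClosedSubmodule.toSubmodule.smul_mem _
    (S.toClosedSubmodule.toSubmodule.smul_mem _ (S.realProj_mem y))

/-- The projections fix `fⱼ(R) x` for `x ∈ V`, so the first half becomes `∑ fⱼ²(R)`. Moving `D`
through the second half reflects `r` to `2 - r`, and `D x = (2 - R) x` cancels the denominator. -/
theorem approxId_apply_of_mem {V : Finset H} {m : ℕ} (hm : 2 ≤ m) {x : H}
    (hx : x ∈ S.toClosedSubmodule) (hV : x ∈ V) : S.approxId V m x =
      ((1 - 1 / m) / 2 : ℝ) •
        (S.fc (fun r => ∑ j ∈ hatIndex m, hatRoot m j r * hatRoot m j r) x +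
        S.fc (fun r => ∑ j ∈ hatIndex m, hatRoot m j (2 - r) * hatRoot m j (2 - r)) x) := by
  have hc := continuous_hatRoot m
  rw [approxId_apply, ← S.fc_sum (f := fun j r => hatRoot m j r * hatRoot m j r) _
    (fun j => (hc j).mul (hc j)), ← S.fc_sum
      (f := fun j r => hatRoot m j (2 - r) * hatRoot m j (2 - r)) _
      (fun j => by have := hc j; fun_prop)]
  congr 2
  · refine Finset.sum_congr rfl fun j _ => ?_
    rw [S.hatProj_apply_of_mem hV, S.fc_fc (hc j) (hc j)]
  · refine Finset.sum_congr rfl fun j hj => ?_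
    have ha := continuous_hatRootDiv hm j
    have hcj := hc j
    rw [S.fc_hatRootDivSub_diffProj hm hj hx, S.hatProj_apply_of_mem hV,
      S.fc_fc ha hcj, S.diffProj_fc (by fun_prop), S.diffProj_eq_fc hx,
      S.fc_fc (by fun_prop) (by fun_prop)]
    congr 2
    ext r
    rw [← mul_hatRootDiv hm hj (2 - r)]
    ring

theorem finiteDimensional_range_approxId (V : Finset H) (m : ℕ) :
    FiniteDimensional ℂ (LinearMap.range (S.approxId V m).toLinearMap) := by
  let W : ℤ → Submodule ℂ H := fun j => Submodule.map (S.fc (hatRoot m j)).toLinearMap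
    (Submodule.span ℂ (V : Set H))
  have hW : ∀ j, (W j).FG := fun j => (Submodule.fg_span V.finite_toSet).map _
  have hp : ∀ j x, S.hatProj V m j x ∈ W j := fun j x => Submodule.starProjection_apply_mem _ x
  let X : ℤ → Submodule ℂ H := fun j => Submodule.map (S.fc (hatRoot m j)).toLinearMap (W j) ⊔
    Submodule.map S.diffProj.toLinearMap
      (Submodule.map (S.fc (hatRootDiv m j)).toLinearMap (W j))
  have hX : ∀ j, (X j).FG := fun j => ((hW j).map _).sup (((hW j).map _).map _)
  have hY : ((hatIndex m).sup X).FG := Submodule.fg_finset_sup _ _ fun j _ => hX j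
  have := Module.Finite.iff_fg.2 hY
  refine Submodule.finiteDimensional_of_le (S₂ := (hatIndex m).sup X) ?_
  rintro _ ⟨x, rfl⟩
  change S.approxId V m x ∈ _
  rw [approxId_apply, ← Finset.sum_add_distrib, ← Complex.coe_smul]
  refine Submodule.smul_mem _ _ (Submodule.sum_mem _ fun j hj => ?_)
  refine Finset.le_sup (f := X) hj (Submodule.add_mem_sup ⟨_, hp j _, rfl⟩ ?_)
  exact ⟨_, ⟨_, hp j _, rfl⟩, rfl⟩

theorem tendsto_fc_sum_hatRoot (x : H) :
    Tendsto (fun m : ℕ => S.fc (fun r => ∑ j ∈ hatIndex (m + 2),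
      hatRoot (m + 2) j r * hatRoot (m + 2) j r) x) atTop (𝓝 x) := by
  have hc : ∀ m, Continuous fun r => ∑ j ∈ hatIndex m, hatRoot m j r * hatRoot m j r := fun m =>
    continuous_finsetSum _ fun j _ => (continuous_hatRoot m j).mul (continuous_hatRoot m j)
  have hd : Dense (Submodule.span ℂ (Set.range (S.fc fun r => r * (2 - r))) : Set H) :=
    S.dense_range_fc.mono Submodule.subset_span
  refine tendsto_clm_of_dense_span (A := 1) (C := 1) (fun m => ?_) hd ?_ x
  · refine S.norm_fc_le zero_le_one fun r _ _ => ?_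
    rw [abs_of_nonneg (sum_hatRoot_nonneg _ r)]
    exact sum_hatRoot_le _ r
  rintro _ ⟨y, rfl⟩
  rw [tendsto_iff_norm_sub_tendsto_zero]
  have hl : Tendsto (fun m : ℕ => 2 / ((m + 2 : ℕ) : ℝ) * ‖y‖) atTop (𝓝 0) := by
    have := (tendsto_const_div_atTop_nhds_zero_nat (2 : ℝ)).comp (tendsto_add_atTop_nat 2)
    have := this.mul_const ‖y‖
    rw [zero_mul] at this
    exact this
  refine squeeze_zero (fun m => norm_nonneg _) (fun m => ?_) hl
  have e : S.fc (fun r => ∑ j ∈ hatIndex (m + 2), hatRoot (m + 2) j r * hatRoot (m + 2) j r)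
        (S.fc (fun r => r * (2 - r)) y) - (1 : H →L[ℂ] H) (S.fc (fun r => r * (2 - r)) y) =
      S.fc (fun r => ((∑ j ∈ hatIndex (m + 2), hatRoot (m + 2) j r * hatRoot (m + 2) j r) - 1) *
        (r * (2 - r))) y := by
    rw [← S.fc_fc (g := fun r => r * (2 - r)) (f := fun r => (∑ j ∈ hatIndex (m + 2),
      hatRoot (m + 2) j r * hatRoot (m + 2) j r) - 1) ((hc _).sub continuous_const)
      (by fun_prop), S.fc_sub (hc _) continuous_const,
      fc_const, one_smul]
    rfl
  rw [e]
  exact (S.fc _).le_of_opNorm_le (S.norm_fc_le (by positivity) fun r h0 h2 =>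
    abs_sum_hatRoot_sub_one_mul_le (by omega) h0 h2) y

/-- The index set is symmetric under `j ↦ 2m² - j`, which is the reflection of the interval. Both
halves thus converge to the same vector. -/
theorem hatIndex_reflect (m : ℕ) (r : ℝ) :
    ∑ j ∈ hatIndex m, hatRoot m j (2 - r) * hatRoot m j (2 - r) =
      ∑ j ∈ hatIndex m, hatRoot m j r * hatRoot m j r := by
  refine Finset.sum_nbij' (fun j => 2 * m ^ 2 - j) (fun j => 2 * m ^ 2 - j) ?_ ?_ ?_ ?_ ?_
  · intro j hj
    have := Finset.mem_Icc.1 hj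
    exact Finset.mem_Icc.2 ⟨by omega, by omega⟩
  · intro j hj
    have := Finset.mem_Icc.1 hj
    exact Finset.mem_Icc.2 ⟨by omega, by omega⟩
  · intro j _; ring
  · intro j _; ring
  · intro j _
    rw [hatRoot_mul_self, hatRoot_mul_self, hat, hat, ← abs_neg]
    push_cast
    ring_nf

theorem tendsto_approxId (x : H) :
    Tendsto (fun k : Finset H × ℕ => S.approxId k.1 (k.2 + 2) x) atTop (𝓝 x) := by
  have hn : ∀ k : Finset H × ℕ, ‖S.approxId k.1 (k.2 + 2)‖ ≤ 1 := fun k =>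
    S.norm_approxId_le k.1 (Nat.le_add_left 2 _)
  refine tendsto_clm_of_dense_span (B := fun k : Finset H × ℕ => S.approxId k.1 (k.2 + 2))
    (A := 1) (C := 1) hn S.dense_span (fun v hv => ?_) x
  have h1 : Tendsto (fun m : ℕ => ((1 - 1 / ((m + 2 : ℕ) : ℝ)) / 2 : ℝ)) atTop (𝓝 (2⁻¹)) := by
    have := (tendsto_const_div_atTop_nhds_zero_nat (1 : ℝ)).comp (tendsto_add_atTop_nat 2)
    have := (this.const_sub 1).div_const 2
    rw [sub_zero, one_div] at this
    exact this
  have h3 := S.tendsto_fc_sum_hatRoot v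
  have h2 := h1.smul (h3.add h3)
  have e : (2⁻¹ : ℝ) • (v + v) = v := by
    rw [← two_smul ℝ v, smul_smul, inv_mul_cancel₀ two_ne_zero, one_smul]
  rw [e] at h2
  have h4 : Tendsto (fun k : Finset H × ℕ => k.2) atTop atTop := by
    rw [← prod_atTop_atTop_eq]
    exact tendsto_snd
  refine (h2.comp h4).congr' ?_
  -- Once the finite set contains `v`, the projections disappear and only the parameter `m` remains.
  filter_upwards [eventually_ge_atTop (({v} : Finset H), 0)] with k hk
  have hvk : v ∈ k.1 := hk.1 (Finset.mem_singleton_self v)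
  rw [S.approxId_apply_of_mem (by omega) hv hvk]
  simp only [hatIndex_reflect]
  rfl

/-- A standard subspace is preserved by a net of finite rank contractions that converges to the
identity. -/
theorem exists_finiteRank_approximation :
    ∃ (κ : Type u) (_ : Preorder κ) (_ : IsDirectedOrder κ) (_ : Nonempty κ) (T : κ → H →L[ℂ] H),
      (∀ k, ‖T k‖ ≤ 1 ∧ FiniteDimensional ℂ (LinearMap.range (T k).toLinearMap) ∧
        ∀ x ∈ S.toClosedSubmodule, T k x ∈ S.toClosedSubmodule) ∧
      ∀ x, Tendsto (fun k => T k x) atTop (𝓝 x) := by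
  classical
  exact ⟨Finset H × ℕ, inferInstance, inferInstance, inferInstance,
    fun k => S.approxId k.1 (k.2 + 2), fun k => ⟨S.norm_approxId_le k.1 (by omega),
      S.finiteDimensional_range_approxId k.1 _, fun x hx => S.approxId_mem k.1 (by omega) hx⟩,
    S.tendsto_approxId⟩

end StandardSubspace

/-! ### Holomorphic functions on a horizontal strip -/

/-- The open strip `0 < Im z < s`. -/
abbrev openStrip (s : ℝ) : Set ℂ := {z : ℂ | 0 < z.im ∧ z.im < s}

theorem isOpen_openStrip (s : ℝ) : IsOpen (openStrip s) :=
  (isOpen_lt continuous_const Complex.continuous_im).inter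
    (isOpen_lt Complex.continuous_im continuous_const)

theorem closure_openStrip {s : ℝ} (hs : 0 < s) :
    closure (openStrip s) = {z : ℂ | 0 ≤ z.im ∧ z.im ≤ s} := by
  have h := Complex.closure_preimage_im (Set.Ioo 0 s)
  rw [closure_Ioo hs.ne] at h
  exact h

theorem isPreconnected_openStrip (s : ℝ) : IsPreconnected (openStrip s) := by
  refine Convex.isPreconnected ?_
  exact (convex_Ioo (0 : ℝ) s).linear_preimage Complex.imLm

section Uniqueness

variable {s : ℝ}

/-- The maximum principle is applied on a square around `c` to the product of four copies of `f`,
turned by right angles. Each side of the square is sent to the real line by one of them, so the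
product vanishes on the boundary, and its value at the centre is `f c ^ 4`. -/
theorem eq_zero_of_two_mul_im_le {f : ℂ → ℂ} (hf : DiffContOnCl ℂ f (openStrip s))
    (h0 : ∀ t : ℝ, f t = 0) {c : ℂ} (hc : 0 < c.im) (hcs : 2 * c.im ≤ s) : f c = 0 := by
  have hs : 0 < s := by linarith
  set Q : Set ℂ := {z | |z.re| < c.im ∧ |z.im| < c.im} with hQ
  have hre : Continuous fun z : ℂ => |z.re| := by fun_prop
  have him : Continuous fun z : ℂ => |z.im| := by fun_prop
  have hQo : IsOpen Q := (isOpen_lt hre continuous_const).inter (isOpen_lt him continuous_const)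
  have hQb : Bornology.IsBounded Q := by
    refine (Metric.isBounded_ball (x := (0 : ℂ)) (r := c.im + c.im)).subset fun z hz => ?_
    rw [mem_ball_zero_iff]
    exact (Complex.norm_le_abs_re_add_abs_im z).trans_lt (add_lt_add hz.1 hz.2)
  have hcl : closure Q ⊆ {z | |z.re| ≤ c.im ∧ |z.im| ≤ c.im} := by
    refine closure_minimal (fun z hz => ⟨hz.1.le, hz.2.le⟩) ?_
    exact (isClosed_le hre continuous_const).inter (isClosed_le him continuous_const)
  have hcomp : ∀ w : ℂ, (∀ z ∈ Q, |(w * z).im| < c.im) →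
      DiffContOnCl ℂ (fun z => f (c + w * z)) Q := fun w hw => by
    have hg : DiffContOnCl ℂ (fun z : ℂ => c + w * z) Q :=
      Differentiable.diffContOnCl (by fun_prop)
    refine hf.comp hg fun z hz => ?_
    have := abs_lt.1 (hw z hz)
    constructor <;> rw [Complex.add_im] <;> linarith
  have h1 := hcomp 1 fun z hz => by simpa using hz.2
  have h2 := hcomp Complex.I fun z hz => by simpa using hz.1
  have h3 := hcomp (-1) fun z hz => by simpa using hz.2
  have h4 := hcomp (-Complex.I) fun z hz => by simpa using hz.1
  have hg := (h1.smul h2).smul (h3.smul h4)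
  have hreal : ∀ z : ℂ, z.im = 0 → f z = 0 := fun z hz => by
    have : z = (z.re : ℂ) := by apply Complex.ext <;> simp [hz]
    rw [this]; exact h0 _
  have hfr := Complex.norm_le_of_forall_mem_frontier_norm_le hQb hg (C := 0) (fun z hz => ?_)
    (subset_closure (show (0 : ℂ) ∈ Q by simp [hQ, hc]))
  · simp only [mul_zero, add_zero, smul_eq_mul] at hfr
    rw [norm_le_zero_iff] at hfr
    simpa using hfr
  · rw [hQo.frontier_eq] at hz
    obtain ⟨h5, h6⟩ := hcl hz.1
    have h7 : |z.re| = c.im ∨ |z.im| = c.im := by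
      by_contra h
      rw [not_or] at h
      exact hz.2 ⟨lt_of_le_of_ne h5 h.1, lt_of_le_of_ne h6 h.2⟩
    refine norm_le_zero_iff.2 ?_
    simp only [smul_eq_mul, mul_eq_zero]
    rcases h7 with h | h <;> rcases eq_or_eq_neg_of_abs_eq h with h | h
    · exact Or.inr (Or.inr (hreal _ (by simp [h])))
    · exact Or.inl (Or.inr (hreal _ (by simp [h])))
    · exact Or.inr (Or.inl (hreal _ (by simp [h])))
    · exact Or.inl (Or.inl (hreal _ (by simp [h])))

variable {X : Type*} [NormedAddCommGroup X] [InnerProductSpace ℂ X] [CompleteSpace X]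

/-- The square argument gives vanishing on the lower half of the strip; the identity theorem and
continuity do the rest. -/
theorem eqOn_zero_closure_openStrip (hs : 0 < s) {F : ℂ → X}
    (hF : DiffContOnCl ℂ F (openStrip s)) (h0 : ∀ t : ℝ, F t = 0) :
    Set.EqOn F 0 (closure (openStrip s)) := by
  have h1 : ∀ c : ℂ, 0 < c.im → 2 * c.im ≤ s → F c = 0 := fun c hc hcs => by
    refine ext_inner_left ℂ fun v => ?_
    rw [inner_zero_right]
    have hv : DiffContOnCl ℂ (fun z => ⟪v, F z⟫_ℂ) (openStrip s) :=
      (innerSL ℂ v).differentiable.comp_diffContOnCl hF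
    exact eq_zero_of_two_mul_im_le hv (fun t => by simp only [h0, inner_zero_right]) hc hcs
  have h2 : Set.EqOn F 0 (openStrip s) := by
    have ha : AnalyticOnNhd ℂ F (openStrip s) := hF.differentiableOn.analyticOnNhd
      (isOpen_openStrip s)
    refine ha.eqOn_zero_of_preconnected_of_eventuallyEq_zero (isPreconnected_openStrip s)
      (z₀ := (s / 4 : ℝ) * Complex.I) ?_ ?_
    · simp only [Set.mem_ofPred_eq, Complex.im_ofReal_mul, Complex.I_im]
      constructor <;> linarith
    · have ho : IsOpen (openStrip (s / 2)) := isOpen_openStrip _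
      filter_upwards [ho.mem_nhds (x := (s / 4 : ℝ) * Complex.I) (by
        simp only [Set.mem_ofPred_eq, Complex.im_ofReal_mul, Complex.I_im]
        constructor <;> linarith)] with z hz
      exact h1 z hz.1 (by linarith [hz.2])
  exact h2.of_subset_closure hF.continuousOn continuousOn_const subset_closure subset_rfl

end Uniqueness

/-- A group of linear isometries, as the orbits are continued to a strip. -/
structure IsometryFlow (X : Type*) [NormedAddCommGroup X] [InnerProductSpace ℂ X] where
  /-- the isometry at time `t` -/
  toFun : ℝ → X →ₗᵢ[ℂ] X
  map_add : ∀ s t x, toFun (s + t) x = toFun s (toFun t x)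
  continuous_apply : ∀ x, Continuous fun t => toFun t x

namespace IsometryFlow

variable {X : Type*} [NormedAddCommGroup X] [InnerProductSpace ℂ X]
variable (V : IsometryFlow X) {s : ℝ}

theorem map_zero_apply (x : X) : V.toFun 0 x = x := by
  have h := V.map_add 0 0 x
  rw [add_zero] at h
  exact (V.toFun 0).injective h.symm

/-- `F` continues the orbit of `ζ` to the closed strip of width `s`. -/
structure IsContinuation (s : ℝ) (ζ : X) (F : ℂ → X) : Prop where
  diffContOnCl : DiffContOnCl ℂ F (openStrip s)
  apply_real : ∀ t : ℝ, F t = V.toFun t ζ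

namespace IsContinuation

variable {V} {ζ ζ' : X} {F F' : ℂ → X}

theorem add (h : V.IsContinuation s ζ F) (h' : V.IsContinuation s ζ' F') :
    V.IsContinuation s (ζ + ζ') (F + F') :=
  ⟨h.1.add h'.1, fun t => by rw [Pi.add_apply, h.2, h'.2, _root_.map_add]⟩

theorem smul (h : V.IsContinuation s ζ F) (c : ℂ) : V.IsContinuation s (c • ζ) (c • F) :=
  ⟨h.1.const_smul c, fun t => by rw [Pi.smul_apply, h.2, map_smul]⟩

theorem sub (h : V.IsContinuation s ζ F) (h' : V.IsContinuation s ζ' F') :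
    V.IsContinuation s (ζ - ζ') (F - F') :=
  ⟨h.1.sub h'.1, fun t => by rw [Pi.sub_apply, h.2, h'.2, map_sub]⟩

variable [CompleteSpace X]

theorem eqOn (hs : 0 < s) (h : V.IsContinuation s ζ F) (h' : V.IsContinuation s ζ F') :
    Set.EqOn F F' (closure (openStrip s)) := fun z hz => by
  have := eqOn_zero_closure_openStrip hs (h.1.sub h'.1)
    (fun t => by rw [Pi.sub_apply, h.2, h'.2, sub_self]) hz
  exact sub_eq_zero.1 this

theorem apply_add (hs : 0 < s) (h : V.IsContinuation s ζ F) (t : ℝ) {z : ℂ}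
    (hz : z ∈ closure (openStrip s)) : F (z + t) = V.toFun t (F z) := by
  have h1 : V.IsContinuation s (V.toFun t ζ) fun z => F (z + t) := by
    refine ⟨?_, fun r => ?_⟩
    · have hg : DiffContOnCl ℂ (fun z : ℂ => z + t) (openStrip s) :=
        Differentiable.diffContOnCl (by fun_prop)
      exact h.1.comp hg fun z hz => by simpa using hz
    · rw [← Complex.ofReal_add, h.2, V.map_add]
  have h2 : V.IsContinuation s (V.toFun t ζ) fun z => V.toFun t (F z) :=
    ⟨(V.toFun t).toContinuousLinearMap.differentiable.comp_diffContOnCl h.1, fun r => by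
      rw [h.2, ← V.map_add, ← V.map_add, add_comm]⟩
  exact eqOn hs h1 h2 hz

/-- The flow is isometric, so the norm depends only on the imaginary part. It is then bounded by
compactness and constant on each edge, and Phragmén–Lindelöf applies. -/
theorem norm_apply_le (hs : 0 < s) (h : V.IsContinuation s ζ F) {z : ℂ}
    (hz : z ∈ closure (openStrip s)) : ‖F z‖ ≤ max ‖ζ‖ ‖F (s * Complex.I)‖ := by
  have hI : ∀ y : ℝ, 0 ≤ y → y ≤ s → (y : ℂ) * Complex.I ∈ closure (openStrip s) :=
    fun y h0 h1 => by rw [closure_openStrip hs]; simpa using ⟨h0, h1⟩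
  have hn : ∀ z ∈ closure (openStrip s), ‖F z‖ = ‖F (z.im * Complex.I)‖ := fun z hz => by
    have hz' := hz
    rw [closure_openStrip hs] at hz'
    have e : z = z.im * Complex.I + z.re := by
      rw [add_comm]; exact (Complex.re_add_im z).symm
    conv_lhs => rw [e]
    rw [h.apply_add hs _ (hI _ hz'.1 hz'.2), LinearIsometry.norm_map]
  have hc : ContinuousOn (fun y : ℝ => ‖F (y * Complex.I)‖) (Set.Icc 0 s) :=
    (h.1.continuousOn.comp (by fun_prop) fun y hy => hI y hy.1 hy.2).norm
  obtain ⟨B, hB⟩ := isCompact_Icc.bddAbove_image hc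
  have hz' := hz
  rw [closure_openStrip hs] at hz'
  refine PhragmenLindelof.horizontal_strip (a := 0) (b := s) h.1 ⟨0, by
    rw [sub_zero]; positivity, 0, ?_⟩ (fun w hw => ?_) (fun w hw => ?_) hz'.1 hz'.2
  · refine Asymptotics.IsBigO.of_bound B ?_
    filter_upwards [mem_inf_of_right (mem_principal_self _)] with w hw
    have hw' : w ∈ closure (openStrip s) := subset_closure hw
    rw [hn w hw']
    simp only [zero_mul, Real.exp_zero, norm_one, mul_one]
    exact hB ⟨w.im, ⟨hw.1.le, hw.2.le⟩, rfl⟩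
  · rw [hn w (by rw [closure_openStrip hs]; exact ⟨hw.ge, hw.le.trans hs.le⟩), hw,
      Complex.ofReal_zero, zero_mul, ← Complex.ofReal_zero, h.2, LinearIsometry.norm_map]
    exact le_max_left _ _
  · rw [hn w (by rw [closure_openStrip hs]; exact ⟨hs.le.trans hw.ge, hw.le⟩), hw]
    exact le_max_right _ _

end IsContinuation

/-- The graph of the continuation of the flow to `i s` is closed. -/
theorem exists_isContinuation_of_tendsto [CompleteSpace X] (hs : 0 < s) {ζ : ℕ → X}
    {F : ℕ → ℂ → X} (h : ∀ n, V.IsContinuation s (ζ n) (F n)) {ζ₀ θ₀ : X}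
    (h1 : Tendsto ζ atTop (𝓝 ζ₀)) (h2 : Tendsto (fun n => F n (s * Complex.I)) atTop (𝓝 θ₀)) :
    ∃ F₀, V.IsContinuation s ζ₀ F₀ ∧ F₀ (s * Complex.I) = θ₀ := by
  have hsI : (s : ℂ) * Complex.I ∈ closure (openStrip s) := by
    rw [closure_openStrip hs]; simpa using hs.le
  have hR : ∀ t : ℝ, (t : ℂ) ∈ closure (openStrip s) := fun t => by
    rw [closure_openStrip hs]; simpa using hs.le
  -- The estimate by the two edge values turns convergence at `0` and at `i s` into uniform
  -- convergence on the closed strip.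
  have hU : UniformCauchySeqOn F atTop (closure (openStrip s)) := by
    rw [Metric.uniformCauchySeqOn_iff]
    intro ε hε
    obtain ⟨N₁, hN₁⟩ := Metric.cauchySeq_iff.1 h1.cauchySeq ε hε
    obtain ⟨N₂, hN₂⟩ := Metric.cauchySeq_iff.1 h2.cauchySeq ε hε
    refine ⟨max N₁ N₂, fun m hm n hn z hz => ?_⟩
    rw [dist_eq_norm]
    refine ((h m).sub (h n)).norm_apply_le hs hz |>.trans_lt (max_lt ?_ ?_)
    · rw [← dist_eq_norm]
      exact hN₁ m (le_of_max_le_left hm) n (le_of_max_le_left hn)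
    · rw [Pi.sub_apply, ← dist_eq_norm]
      exact hN₂ m (le_of_max_le_right hm) n (le_of_max_le_right hn)
  have hlim : ∀ z, ∃ x, z ∈ closure (openStrip s) → Tendsto (fun n => F n z) atTop (𝓝 x) :=
    fun z => by
      by_cases hz : z ∈ closure (openStrip s)
      · obtain ⟨x, hx⟩ := cauchySeq_tendsto_of_complete (hU.cauchySeq hz)
        exact ⟨x, fun _ => hx⟩
      · exact ⟨0, fun h => absurd h hz⟩
  choose F₀ hF₀ using hlim
  have hT : TendstoUniformlyOn F F₀ atTop (closure (openStrip s)) :=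
    hU.tendstoUniformlyOn_of_tendsto fun z hz => hF₀ z hz
  refine ⟨F₀, ⟨⟨?_, ?_⟩, fun t => ?_⟩, ?_⟩
  · exact (hT.mono subset_closure).tendstoLocallyUniformlyOn.differentiableOn
      (Eventually.of_forall fun n => (h n).1.differentiableOn) (isOpen_openStrip s)
  · exact hT.continuousOn (Eventually.of_forall fun n => (h n).1.continuousOn).frequently
  · refine tendsto_nhds_unique (hF₀ t (hR t)) ?_
    simp only [(h _).2]
    exact ((V.toFun t).continuous.tendsto ζ₀).comp h1
  · exact tendsto_nhds_unique (hF₀ _ hsI) h2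

end IsometryFlow

namespace IsometryFlow

open MeasureTheory

variable {X : Type*} [NormedAddCommGroup X] [InnerProductSpace ℂ X] [CompleteSpace X]
variable (V : IsometryFlow X) {s : ℝ}

/-- One integrable bound, uniform for bounded real part, for both the kernel and its complex
derivative; the factor `1 + |t|` accounts for the latter. The constant comes from completing the
square. -/
theorem abs_mul_exp_le {b R : ℝ} (hb : 0 < b) {x : ℝ} (hx : |x| ≤ R) (t : ℝ) :
    (1 + |t|) * Real.exp (-b * t ^ 2 + 2 * b * t * x) ≤
      Real.exp ((2 * b * R + 1) ^ 2 / (2 * b)) * Real.exp (-(b / 2) * t ^ 2) := by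
  have h1 : 1 + |t| ≤ Real.exp |t| := by linarith [Real.add_one_le_exp |t|]
  refine (mul_le_mul_of_nonneg_right h1 (Real.exp_pos _).le).trans ?_
  rw [← Real.exp_add, ← Real.exp_add, Real.exp_le_exp]
  have h2 : t * x ≤ |t| * R := (le_abs_self _).trans (by
    rw [abs_mul]; exact mul_le_mul_of_nonneg_left hx (abs_nonneg t))
  have h3 : (2 * b * R + 1) * |t| ≤ (b / 2) * t ^ 2 + (2 * b * R + 1) ^ 2 / (2 * b) := by
    have h4 : 0 ≤ (b / 2) * (|t| - (2 * b * R + 1) / b) ^ 2 := by positivity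
    have h5 : (b / 2) * (|t| - (2 * b * R + 1) / b) ^ 2 =
        (b / 2) * |t| ^ 2 - (2 * b * R + 1) * |t| + (2 * b * R + 1) ^ 2 / (2 * b) := by
      field_simp
      ring
    rw [sq_abs] at h5
    linarith
  nlinarith

/-- The integrand of the Gaussian smoothing of an orbit, continued to the complex plane. -/
noncomputable def gaussianKernel (b : ℝ) (ζ : X) (z : ℂ) (t : ℝ) : X :=
  Complex.exp (-b * t ^ 2 + 2 * b * t * z) • V.toFun t ζ

theorem continuous_gaussianKernel (b : ℝ) (ζ : X) (z : ℂ) :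
    Continuous (V.gaussianKernel b ζ z) := by
  have := V.continuous_apply ζ
  unfold gaussianKernel
  fun_prop

theorem norm_gaussianKernel (b : ℝ) (ζ : X) (z : ℂ) (t : ℝ) :
    ‖V.gaussianKernel b ζ z t‖ = Real.exp (-b * t ^ 2 + 2 * b * t * z.re) * ‖ζ‖ := by
  rw [gaussianKernel, norm_smul, LinearIsometry.norm_map, Complex.norm_exp]
  congr 2
  simp [← Complex.ofReal_pow]

theorem integrable_bound {b : ℝ} (hb : 0 < b) (C : ℝ) :
    Integrable fun t : ℝ => C * Real.exp (-(b / 2) * t ^ 2) :=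
  (integrable_exp_neg_mul_sq (half_pos hb)).const_mul C

theorem integrable_gaussianKernel {b : ℝ} (hb : 0 < b) (ζ : X) (z : ℂ) :
    Integrable (V.gaussianKernel b ζ z) := by
  refine (integrable_bound hb (Real.exp ((2 * b * |z.re| + 1) ^ 2 / (2 * b)) * ‖ζ‖)).mono'
    (V.continuous_gaussianKernel b ζ z).aestronglyMeasurable (Eventually.of_forall fun t => ?_)
  rw [norm_gaussianKernel, mul_right_comm _ ‖ζ‖]
  refine mul_le_mul_of_nonneg_right ?_ (norm_nonneg ζ)
  refine le_trans ?_ (abs_mul_exp_le hb le_rfl t)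
  exact le_mul_of_one_le_left (Real.exp_pos _).le (by linarith [abs_nonneg t])

theorem differentiable_integral_gaussianKernel {b : ℝ} (hb : 0 < b) (ζ : X) :
    Differentiable ℂ fun z => ∫ t, V.gaussianKernel b ζ z t := fun z₀ => by
  have hcont := V.continuous_apply ζ
  refine (hasDerivAt_integral_of_dominated_loc_of_deriv_le (𝕜 := ℂ) (s := Metric.ball z₀ 1)
    (F' := fun z t => (2 * b * t : ℂ) • V.gaussianKernel b ζ z t)
    (bound := fun t => 2 * b * ‖ζ‖ * Real.exp ((2 * b * (‖z₀‖ + 1) + 1) ^ 2 / (2 * b)) *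
      Real.exp (-(b / 2) * t ^ 2))
    (Metric.ball_mem_nhds _ one_pos) (Eventually.of_forall fun z =>
      (V.continuous_gaussianKernel b ζ z).aestronglyMeasurable)
    (V.integrable_gaussianKernel hb ζ z₀) ?_ ?_ (integrable_bound hb _)
    ?_).2.differentiableAt
  · have := V.continuous_gaussianKernel b ζ z₀
    exact Continuous.aestronglyMeasurable (by fun_prop)
  · refine Eventually.of_forall fun t z hz => ?_
    have hz' : |z.re| ≤ ‖z₀‖ + 1 := by
      have h1 := Complex.abs_re_le_norm z
      have h2 : ‖z - z₀‖ < 1 := by rwa [← dist_eq_norm]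
      have h3 := norm_le_insert' z z₀
      linarith
    have h1 := abs_mul_exp_le hb hz' t
    have h2 : ‖(2 * b * t : ℂ)‖ ≤ 2 * b * (1 + |t|) := by
      simp only [norm_mul, Complex.norm_real, Real.norm_eq_abs, Complex.norm_ofNat,
        abs_of_pos hb]
      nlinarith [abs_nonneg t]
    rw [norm_smul, norm_gaussianKernel]
    calc _ ≤ 2 * b * (1 + |t|) * (Real.exp (-b * t ^ 2 + 2 * b * t * z.re) * ‖ζ‖) :=
          mul_le_mul_of_nonneg_right h2 (by positivity)
      _ = 2 * b * ‖ζ‖ * ((1 + |t|) * Real.exp (-b * t ^ 2 + 2 * b * t * z.re)) := by ring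
      _ ≤ _ := by
        rw [mul_assoc (2 * b * ‖ζ‖)]
        exact mul_le_mul_of_nonneg_left h1 (by positivity)
  · refine Eventually.of_forall fun t z _ => ?_
    have h1 : HasDerivAt (fun z : ℂ => -b * t ^ 2 + 2 * b * t * z) (2 * b * t : ℂ) z := by
      simpa using ((hasDerivAt_id z).const_mul (2 * b * t : ℂ)).const_add (-b * t ^ 2 : ℂ)
    have h2 := h1.cexp.smul_const (V.toFun t ζ)
    rw [mul_comm (Complex.exp _), mul_smul] at h2
    exact h2

/-- The Gaussian smoothing of an orbit. -/
noncomputable def smoothing (b : ℝ) (ζ : X) : X := ∫ t, V.gaussianKernel b ζ 0 t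

/-- The factor `exp(-b z²)` completes the square to `exp(-b (t - z)²)`. The result is entire in `z`,
and for real `z` a translation of the variable shows that it is the orbit. -/
theorem exists_isContinuation_smoothing {b : ℝ} (hb : 0 < b) (ζ : X) (s : ℝ) :
    ∃ F, V.IsContinuation s (V.smoothing b ζ) F := by
  refine ⟨fun z => Complex.exp (-b * z ^ 2) • ∫ t, V.gaussianKernel b ζ z t, ⟨?_, fun r => ?_⟩⟩
  · have h := V.differentiable_integral_gaussianKernel hb ζ
    exact Differentiable.diffContOnCl (by fun_prop)
  · have h1 : Complex.exp (-b * (r : ℂ) ^ 2) • ∫ t, V.gaussianKernel b ζ r t =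
        ∫ t, V.toFun r (V.gaussianKernel b ζ 0 (t - r)) := by
      rw [← integral_smul]
      congr 1
      ext t
      rw [gaussianKernel, gaussianKernel, map_smul, ← V.map_add, smul_smul, ← Complex.exp_add]
      congr 2
      · push_cast; ring
      · rw [add_sub_cancel]
    rw [h1, integral_sub_right_eq_self (fun t => V.toFun r (V.gaussianKernel b ζ 0 t)) r, smoothing]
    exact (V.toFun r).toContinuousLinearMap.integral_comp_comm (V.integrable_gaussianKernel hb ζ 0)

theorem inner_smoothing {b : ℝ} (hb : 0 < b) (w ζ : X) :
    ⟪w, V.smoothing b ζ⟫_ℂ = ∫ t : ℝ, Complex.exp (-b * t ^ 2) * ⟪w, V.toFun t ζ⟫_ℂ := by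
  rw [smoothing, ← integral_inner (V.integrable_gaussianKernel hb ζ 0)]
  simp [gaussianKernel, inner_smul_right]

/-- Testing against smoothings of `w` itself with ever narrower Gaussians gives, after rescaling,
`√π ‖w‖² = 0` in the limit. -/
theorem eq_zero_of_inner_isContinuation {w : X}
    (hw : ∀ ζ F, V.IsContinuation s ζ F → ⟪w, ζ⟫_ℂ = 0) : w = 0 := by
  have hcont : Continuous fun t => ⟪w, V.toFun t w⟫_ℂ :=
    continuous_const.inner (V.continuous_apply w)
  have h1 : ∀ n : ℕ, ∫ u : ℝ, Complex.exp (-u ^ 2) * ⟪w, V.toFun (u / (n + 1)) w⟫_ℂ = 0 :=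
    fun n => by
      have hn : (0 : ℝ) < n + 1 := by positivity
      -- The parameter `(n + 1)²` becomes `1` after the substitution `u = (n + 1) t`, which moves
      -- the whole dependence on `n` into the flow.
      obtain ⟨F, hF⟩ := V.exists_isContinuation_smoothing (b := (n + 1) ^ 2) (by positivity) w s
      have h := hw _ F hF
      rw [V.inner_smoothing (by positivity)] at h
      have h2 := Measure.integral_comp_mul_left (fun u : ℝ =>
        Complex.exp (-u ^ 2) * ⟪w, V.toFun (u / (n + 1)) w⟫_ℂ) ((n : ℝ) + 1)
      have h3 : (fun t : ℝ => Complex.exp (-(((n : ℝ) + 1) * t : ℝ) ^ 2) *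
          ⟪w, V.toFun (((n : ℝ) + 1) * t / (n + 1)) w⟫_ℂ) = fun t : ℝ =>
          Complex.exp (-(((n : ℝ) + 1) ^ 2 : ℝ) * t ^ 2) * ⟪w, V.toFun t w⟫_ℂ := by
        ext t
        rw [mul_div_cancel_left₀ _ hn.ne']
        congr 2
        push_cast
        ring
      rw [h3, h] at h2
      exact (smul_eq_zero.1 h2.symm).resolve_left (abs_pos.2 (inv_ne_zero hn.ne')).ne'
  have h2 : Tendsto (fun n : ℕ => ∫ u : ℝ, Complex.exp (-u ^ 2) *
      ⟪w, V.toFun (u / (n + 1)) w⟫_ℂ) atTop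
      (𝓝 (∫ u : ℝ, Complex.exp (-u ^ 2) * ⟪w, V.toFun 0 w⟫_ℂ)) := by
    refine tendsto_integral_of_dominated_convergence
      (fun u => Real.exp (-1 * u ^ 2) * (‖w‖ * ‖w‖)) (fun n => ?_) ?_ (fun n => ?_) ?_
    · have h3 : Continuous fun u : ℝ => ⟪w, V.toFun (u / (n + 1)) w⟫_ℂ :=
        hcont.comp (by fun_prop : Continuous fun u : ℝ => u / ((n : ℝ) + 1))
      exact Continuous.aestronglyMeasurable (by fun_prop)
    · exact (integrable_exp_neg_mul_sq one_pos).mul_const _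
    · refine Eventually.of_forall fun u => ?_
      rw [norm_mul, Complex.norm_exp]
      have h3 := norm_inner_le_norm (𝕜 := ℂ) w (V.toFun (u / (n + 1)) w)
      rw [LinearIsometry.norm_map] at h3
      refine mul_le_mul (le_of_eq ?_) h3 (norm_nonneg _) (Real.exp_pos _).le
      congr 1
      simp [← Complex.ofReal_pow]
    · refine Eventually.of_forall fun u => ?_
      have h3 : Tendsto (fun n : ℕ => u / ((n : ℝ) + 1)) atTop (𝓝 0) := by
        have := (tendsto_one_div_add_atTop_nhds_zero_nat (𝕜 := ℝ)).const_mul u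
        rw [mul_zero] at this
        refine this.congr fun n => ?_
        rw [mul_one_div]
      exact ((hcont.tendsto 0).comp h3).const_mul _
  simp only [h1] at h2
  have h3 := tendsto_nhds_unique h2 tendsto_const_nhds
  rw [integral_mul_const, V.map_zero_apply] at h3
  have h4 : (∫ u : ℝ, Complex.exp (-u ^ 2)) ≠ 0 := by
    have h5 := integral_gaussian 1
    have h6 : (∫ u : ℝ, Complex.exp (-u ^ 2)) = ((∫ u : ℝ, Real.exp (-1 * u ^ 2) : ℝ) : ℂ) := by
      rw [← integral_complex_ofReal]
      congr 1
      ext u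
      push_cast
      simp
    rw [h6, h5]
    simp [Real.sqrt_ne_zero', Real.pi_pos]
  exact inner_self_eq_zero.1 ((mul_eq_zero.1 h3).resolve_left h4)

end IsometryFlow

/-! ### The canonical conjugation and reflection of holomorphic functions. -/

namespace Complexification

variable {E : Type u} [NormedAddCommGroup E] [InnerProductSpace ℝ E]

theorem continuous_re : Continuous (re : Complexification E → E) :=
  continuous_fst.comp (WithLp.prod_continuous_ofLp 2 E E)

theorem continuous_im : Continuous (im : Complexification E → E) :=
  continuous_snd.comp (WithLp.prod_continuous_ofLp 2 E E)

theorem continuous_mk {Y : Type*} [TopologicalSpace Y] {f g : Y → E} (hf : Continuous f)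
    (hg : Continuous g) : Continuous fun y => mk (f y) (g y) :=
  (WithLp.prod_continuous_toLp 2 E E).comp (hf.prodMk hg)

@[simp] theorem re_neg (z : Complexification E) : (-z).re = -z.re := rfl
@[simp] theorem im_neg (z : Complexification E) : (-z).im = -z.im := rfl
@[simp] theorem re_conjJ (z : Complexification E) : (conjJ z).re = z.re := rfl
@[simp] theorem im_conjJ (z : Complexification E) : (conjJ z).im = -z.im := rfl
@[simp] theorem re_mapIso (u : E ≃ₗᵢ[ℝ] E) (z : Complexification E) :
    (mapIso u z).re = u z.re := rfl
@[simp] theorem im_mapIso (u : E ≃ₗᵢ[ℝ] E) (z : Complexification E) :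
    (mapIso u z).im = u z.im := rfl

theorem conjJ_conjJ (z : Complexification E) : conjJ (conjJ z) = z := by
  apply ext' <;> simp

theorem conjJ_add (z w : Complexification E) : conjJ (z + w) = conjJ z + conjJ w := by
  apply ext' <;> simp [add_comm]

theorem conjJ_smul (c : ℂ) (z : Complexification E) : conjJ (c • z) = conj c • conjJ z := by
  apply ext' <;> simp [add_comm]

theorem continuous_conjJ : Continuous (conjJ : Complexification E → Complexification E) :=
  continuous_mk continuous_re continuous_im.neg

theorem conjJ_mapIso (u : E ≃ₗᵢ[ℝ] E) (z : Complexification E) :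
    conjJ (mapIso u z) = mapIso u (conjJ z) := by
  apply ext' <;> simp

theorem conjJ_sub (z w : Complexification E) : conjJ (z - w) = conjJ z - conjJ w := by
  have h := conjJ_add (z - w) w
  rw [sub_add_cancel] at h
  exact eq_sub_of_add_eq h.symm

/-- The reflection `z ↦ J F(conj z + c)` of a holomorphic function is holomorphic. -/
theorem hasDerivAt_conjJ {F : ℂ → Complexification E} {F' : Complexification E} {c z : ℂ}
    (h : HasDerivAt F F' (conj z + c)) :
    HasDerivAt (fun w => conjJ (F (conj w + c))) (conjJ F') z := by
  rw [hasDerivAt_iff_tendsto_slope] at h ⊢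
  have h1 : Tendsto (fun w : ℂ => conj w + c) (𝓝[≠] z) (𝓝[≠] (conj z + c)) := by
    refine tendsto_nhdsWithin_iff.2 ⟨?_, ?_⟩
    · have : Continuous fun w : ℂ => conj w + c := by fun_prop
      exact (this.tendsto z).mono_left nhdsWithin_le_nhds
    · filter_upwards [self_mem_nhdsWithin] with w hw h
      exact hw ((starRingEnd ℂ).injective (add_right_cancel h))
  refine ((continuous_conjJ.tendsto F').comp (h.comp h1)).congr fun w => ?_
  simp only [Function.comp_apply, slope, vsub_eq_sub, conjJ_smul, conjJ_sub]
  simp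

end Complexification

/-! ### The involution of an orthogonal representation and its standard subspace. -/

namespace OrthogonalRep

open Complexification

variable {E : Type u} [NormedAddCommGroup E] [InnerProductSpace ℝ E] (U : OrthogonalRep E)

/-- The complexified group of isometries. -/
noncomputable def flow : IsometryFlow (Complexification E) where
  toFun t :=
    { toFun := mapIso (U.toFun t)
      map_add' := fun z w => by apply ext' <;> simp
      map_smul' := fun c z => by apply ext' <;> simp
      norm_map' := fun z => by
        change ‖mapIso (U.toFun t) z‖ = ‖z‖
        rw [← sq_eq_sq₀ (norm_nonneg _) (norm_nonneg _), norm_sq_eq, norm_sq_eq]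
        simp }
  map_add s t z := by
    change mapIso _ z = mapIso _ (mapIso _ z)
    apply ext' <;> simp [U.map_add]
  continuous_apply z := continuous_mk (U.continuous_apply z.re) (U.continuous_apply z.im)

theorem flow_apply (t : ℝ) (z : Complexification E) :
    U.flow.toFun t z = mapIso (U.toFun t) z := rfl

theorem involutionGraph_iff {ζ η : Complexification E} : U.InvolutionGraph ζ η ↔
    ∃ F, U.flow.IsContinuation (1 / 2) ζ F ∧
      η = conjJ (F (((1 / 2 : ℝ) : ℂ) * Complex.I)) := by
  constructor
  · rintro ⟨θ, ⟨F, h1, h2, rfl⟩, rfl⟩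
    exact ⟨F, ⟨h1, h2⟩, rfl⟩
  · rintro ⟨F, ⟨h1, h2⟩, rfl⟩
    exact ⟨_, ⟨F, h1, h2, rfl⟩, rfl⟩

theorem half_mul_I_mem : ((1 / 2 : ℝ) : ℂ) * Complex.I ∈ closure (openStrip (1 / 2)) := by
  rw [closure_openStrip (by norm_num)]
  refine ⟨?_, ?_⟩ <;> simp

variable {U}

namespace InvolutionGraph

variable {ζ η ζ' η' : Complexification E}

theorem add (h : U.InvolutionGraph ζ η) (h' : U.InvolutionGraph ζ' η') :
    U.InvolutionGraph (ζ + ζ') (η + η') := by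
  rw [involutionGraph_iff] at h h' ⊢
  obtain ⟨F, hF, rfl⟩ := h
  obtain ⟨F', hF', rfl⟩ := h'
  exact ⟨_, hF.add hF', (conjJ_add _ _).symm⟩

theorem smul (h : U.InvolutionGraph ζ η) (c : ℂ) :
    U.InvolutionGraph (c • ζ) (conj c • η) := by
  rw [involutionGraph_iff] at h ⊢
  obtain ⟨F, hF, rfl⟩ := h
  exact ⟨_, hF.smul c, (conjJ_smul _ _).symm⟩

theorem zero : U.InvolutionGraph (0 : Complexification E) 0 :=
  U.involutionGraph_iff.2 ⟨0, ⟨diffContOnCl_const, fun t => (map_zero _).symm⟩, by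
    apply ext' <;> simp⟩

variable [CompleteSpace E]

theorem unique (h : U.InvolutionGraph ζ η) (h' : U.InvolutionGraph ζ η') : η = η' := by
  rw [involutionGraph_iff] at h h'
  obtain ⟨F, hF, rfl⟩ := h
  obtain ⟨F', hF', rfl⟩ := h'
  rw [hF.eqOn (by norm_num) hF' half_mul_I_mem]

/-- The reflection `z ↦ J F(conj z + i/2)` exchanges the two edges of the strip. Since `J` commutes
with the flow, it continues the orbit of `η` and takes the value `J ζ` at `i/2`. -/
theorem symm (h : U.InvolutionGraph ζ η) : U.InvolutionGraph η ζ := by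
  rw [involutionGraph_iff] at h ⊢
  obtain ⟨F, hF, rfl⟩ := h
  set c : ℂ := ((1 / 2 : ℝ) : ℂ) * Complex.I with hc
  have hci : c.im = 1 / 2 := by rw [hc, Complex.im_ofReal_mul, Complex.I_im, mul_one]
  have him : ∀ z : ℂ, (conj z + c).im = 1 / 2 - z.im := fun z => by
    rw [Complex.add_im, hci, Complex.conj_im]; ring
  have hmap : Set.MapsTo (fun z : ℂ => conj z + c) (closure (openStrip (1 / 2)))
      (closure (openStrip (1 / 2))) := fun z hz => by
    rw [closure_openStrip (by norm_num)] at hz ⊢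
    change 0 ≤ (conj z + c).im ∧ (conj z + c).im ≤ 1 / 2
    rw [him]
    constructor <;> linarith [hz.1, hz.2]
  refine ⟨fun z => conjJ (F (conj z + c)), ⟨⟨fun z hz => ?_, ?_⟩, fun t => ?_⟩, ?_⟩
  · have hz' : conj z + c ∈ openStrip (1 / 2) := by
      change 0 < (conj z + c).im ∧ (conj z + c).im < 1 / 2
      rw [him]
      constructor <;> linarith [hz.1, hz.2]
    exact (hasDerivAt_conjJ (hF.1.differentiableAt (isOpen_openStrip _)
      hz').hasDerivAt).differentiableAt.differentiableWithinAt
  · exact continuous_conjJ.comp_continuousOn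
      (hF.1.continuousOn.comp (by fun_prop) hmap)
  · rw [Complex.conj_ofReal, add_comm, hF.apply_add (by norm_num) t half_mul_I_mem, flow_apply,
      flow_apply, conjJ_mapIso]
  · have e : conj c + c = ((0 : ℝ) : ℂ) := by
      rw [hc, map_mul, Complex.conj_ofReal, Complex.conj_I]; simp
    simp only
    rw [e, hF.2, U.flow.map_zero_apply, conjJ_conjJ]

end InvolutionGraph

theorem closed_involutionGraph [CompleteSpace E] {ζ η : ℕ → Complexification E}
    {ζ₀ η₀ : Complexification E} (h : ∀ n, U.InvolutionGraph (ζ n) (η n))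
    (h1 : Tendsto ζ atTop (𝓝 ζ₀)) (h2 : Tendsto η atTop (𝓝 η₀)) : U.InvolutionGraph ζ₀ η₀ := by
  simp only [involutionGraph_iff] at h ⊢
  choose F hF hη using h
  obtain ⟨F₀, hF₀, e⟩ := U.flow.exists_isContinuation_of_tendsto (by norm_num) hF h1
    (θ₀ := conjJ η₀) (by
      have := (continuous_conjJ.tendsto η₀).comp h2
      refine this.congr fun n => ?_
      rw [Function.comp_apply, hη, conjJ_conjJ])
  exact ⟨F₀, hF₀, by rw [e, conjJ_conjJ]⟩

variable (U) [CompleteSpace E]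

/-- The fixed points of the involution, as a closed real subspace. -/
def realSubmodule : ClosedSubmodule ℝ (Complexification E) where
  carrier := U.realPart
  add_mem' := InvolutionGraph.add
  zero_mem' := InvolutionGraph.zero
  smul_mem' c x hx := by
    have h := InvolutionGraph.smul (U := U) (ζ := x) (η := x) hx (c : ℂ)
    rw [Complex.conj_ofReal] at h
    exact h
  isClosed' := isClosed_of_closure_subset fun x hx => by
    obtain ⟨u, hu, hx⟩ := mem_closure_iff_seq_limit.1 hx
    exact closed_involutionGraph hu hx hx

variable {U}

theorem InvolutionGraph.exists_decomp {ζ η : Complexification E} (h : U.InvolutionGraph ζ η) :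
    ∃ a ∈ U.realPart, ∃ b ∈ U.realPart, ζ = a + Complex.I • b ∧ η = a - Complex.I • b := by
  refine ⟨(2⁻¹ : ℂ) • (ζ + η), ?_, (-(Complex.I / 2)) • (ζ + (-1 : ℂ) • η), ?_, ?_, ?_⟩
  · have := (h.add h.symm).smul 2⁻¹
    have e : conj (2⁻¹ : ℂ) = 2⁻¹ := by rw [map_inv₀, map_ofNat]
    rw [e, add_comm η ζ] at this
    exact this
  · have := (h.add (h.symm.smul (-1))).smul (-(Complex.I / 2))
    have e : conj (-(Complex.I / 2)) • (η + conj (-1 : ℂ) • ζ) =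
        (-(Complex.I / 2)) • (ζ + (-1 : ℂ) • η) := by
      simp only [map_neg, map_div₀, Complex.conj_I, map_ofNat, map_one]
      module
    rw [e] at this
    exact this
  · match_scalars <;> apply Complex.ext <;> norm_num
  · match_scalars <;> apply Complex.ext <;> norm_num

variable (U)

open ClosedSubmodule in
/-- The fixed points of the involution form a standard subspace. -/
noncomputable def standardSubspace : StandardSubspace (Complexification E) where
  toClosedSubmodule := U.realSubmodule
  IsSeparating := by
    rw [eq_bot_iff]
    rintro x ⟨h1, h2⟩
    have h1' : U.InvolutionGraph x x := h1
    have h2' : x ∈ U.realSubmodule.mulI := h2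
    rw [mem_mapEquiv_iff, scalarSMulCLE_symm_apply, Units.smul_def, Units.val_inv_eq_inv_val,
      Complex.val_UnitI, Complex.inv_I] at h2'
    have h3 : U.InvolutionGraph (-Complex.I • x) (-Complex.I • x) := h2'
    -- Conjugate linearity gives `I x = -x`, against `I x = x`.
    have h4 := h3.smul Complex.I
    rw [smul_smul, smul_smul] at h4
    have h5 := h1'.unique (by simpa using h4)
    have h6 : x = 0 := by
      have h7 : (2 : ℂ) • x = 0 := by rw [two_smul]; nth_rewrite 1 [h5]; simp
      exact (smul_eq_zero.1 h7).resolve_left two_ne_zero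
    simp [h6]
  IsCyclic := by
    let D : Submodule ℂ (Complexification E) :=
      { carrier := U.domI
        add_mem' := fun ⟨_, ha⟩ ⟨_, hb⟩ => ⟨_, ha.add hb⟩
        zero_mem' := ⟨_, InvolutionGraph.zero⟩
        smul_mem' := fun c _ ⟨_, ha⟩ => ⟨_, ha.smul c⟩ }
    -- A vector orthogonal to the domain is orthogonal to all smoothed vectors, hence zero.
    have hD : D.topologicalClosure = ⊤ := by
      rw [Submodule.topologicalClosure_eq_top_iff, Submodule.eq_bot_iff]
      intro w hw
      refine U.flow.eq_zero_of_inner_isContinuation (s := 1 / 2) fun ζ F hF => ?_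
      exact (Submodule.mem_orthogonal' _ _).1 hw ζ ⟨_, U.involutionGraph_iff.2 ⟨F, hF, rfl⟩⟩
    have hle : (D : Set (Complexification E)) ⊆
        (U.realSubmodule ⊔ U.realSubmodule.mulI : ClosedSubmodule ℝ (Complexification E)) := by
      rintro ζ ⟨η, hη⟩
      obtain ⟨a, ha, b, hb, rfl, -⟩ := hη.exists_decomp
      refine Submodule.add_mem (U.realSubmodule ⊔ U.realSubmodule.mulI).toSubmodule ?_ ?_
      · exact (le_sup_left : U.realSubmodule ≤ U.realSubmodule ⊔ U.realSubmodule.mulI) ha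
      · refine (le_sup_right : U.realSubmodule.mulI ≤ U.realSubmodule ⊔ U.realSubmodule.mulI) ?_
        rw [mem_mapEquiv_iff, scalarSMulCLE_symm_apply, Units.smul_def, Units.val_inv_eq_inv_val,
          Complex.val_UnitI, smul_smul, inv_mul_cancel₀ Complex.I_ne_zero, one_smul]
        exact hb
    rw [eq_top_iff]
    intro x _
    have hx : x ∈ D.topologicalClosure := by rw [hD]; trivial
    exact closure_minimal hle (ClosedSubmodule.isClosed _) hx

theorem mem_involutionGraph_standardSubspace {ζ η : Complexification E} :
    (ζ, η) ∈ U.standardSubspace.involutionGraph ↔ U.InvolutionGraph ζ η := by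
  constructor
  · rintro ⟨a, ha, b, hb, h⟩
    have ha' : U.InvolutionGraph a a := ha
    have hb' : U.InvolutionGraph b b := hb
    have := ha'.add (hb'.smul Complex.I)
    rw [Complex.conj_I, neg_smul, ← sub_eq_add_neg] at this
    obtain ⟨rfl, rfl⟩ := Prod.mk.inj h
    exact this
  · intro h
    obtain ⟨a, ha, b, hb, rfl, rfl⟩ := h.exists_decomp
    exact ⟨a, ha, b, hb, rfl⟩

/-- A complex linear map sends `a ± i b` to `T a ± i T b`; exchanging the entries of the pair
amounts to replacing `T b` by `-T b`. -/
theorem commutesWithI_of_mapsTo {T : Complexification E →L[ℂ] Complexification E}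
    (hT : ∀ x ∈ U.standardSubspace.toClosedSubmodule,
      T x ∈ U.standardSubspace.toClosedSubmodule) : U.CommutesWithI T := by
  intro ζ η h
  obtain ⟨a, ha, b, hb, rfl, rfl⟩ := h.exists_decomp
  rw [← mem_involutionGraph_standardSubspace]
  refine ⟨T a, hT a ha, -T b, ?_, ?_⟩
  · exact U.standardSubspace.toClosedSubmodule.toSubmodule.neg_mem (hT b hb)
  · simp [sub_eq_add_neg]

end OrthogonalRep

/-! ### From bounds tending to one to complete contractions. -/

namespace VonNeumannAlgebra

variable {K : Type u} [NormedAddCommGroup K] [InnerProductSpace ℂ K] [CompleteSpace K]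
variable {N : VonNeumannAlgebra K}

theorem TendstoIdStarStrongly.smul {ι : Type*} {l : Filter ι} {Φ : ι → N.Elem →ₗ[ℂ] N.Elem}
    (h : TendstoIdStarStrongly l Φ) {c : ι → ℝ} (hc : Tendsto c l (𝓝 1)) :
    TendstoIdStarStrongly l fun i => (c i : ℂ) • Φ i := by
  have hc' : Tendsto (fun i => (c i : ℂ)) l (𝓝 1) := by
    have := (Complex.continuous_ofReal.tendsto 1).comp hc
    rw [Complex.ofReal_one] at this
    exact this
  intro x v
  obtain ⟨h1, h2⟩ := h x v
  constructor
  · have := hc'.smul h1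
    rw [one_smul] at this
    exact this
  · have := hc'.smul h2
    rw [one_smul] at this
    refine this.congr fun i => ?_
    have e : star (((((c i : ℂ) • Φ i) x : N.Elem)) : K →L[ℂ] K) =
        (c i : ℂ) • star (Φ i x : K →L[ℂ] K) := by
      change star ((c i : ℂ) • (Φ i x : K →L[ℂ] K)) = _
      rw [star_smul]
      congr 1
      exact Complex.conj_ofReal _
    rw [e]
    rfl

theorem TendstoIdStarStrongly.comp_tendsto {ι ι' : Type*} {l : Filter ι} {l' : Filter ι'}
    {Φ : ι → N.Elem →ₗ[ℂ] N.Elem} (h : TendstoIdStarStrongly l Φ) {f : ι' → ι}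
    (hf : Tendsto f l' l) : TendstoIdStarStrongly l' fun i => Φ (f i) :=
  fun x v => ⟨(h x v).1.comp hf, (h x v).2.comp hf⟩

theorem IsFiniteRank.smul {Φ : N.Elem →ₗ[ℂ] N.Elem} (h : IsFiniteRank Φ) (c : ℂ) :
    IsFiniteRank (c • Φ) := by
  have : FiniteDimensional ℂ (LinearMap.range Φ) := h
  refine Submodule.finiteDimensional_of_le (S₂ := LinearMap.range Φ) ?_
  rintro _ ⟨x, rfl⟩
  exact Submodule.smul_mem _ c ⟨x, rfl⟩

theorem HasCMAP.cowlingHaagerup_eq_one (h : N.HasCMAP) : N.cowlingHaagerup = 1 := by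
  refine le_antisymm (sInf_le ⟨le_rfl, ENNReal.one_lt_top, ?_⟩) (le_sInf fun C hC => hC.1)
  obtain ⟨ι, i1, i2, i3, Φ, hΦ, ht⟩ := h
  refine ⟨ι, i1, i2, i3, Φ, fun i => ⟨(hΦ i).1, (hΦ i).2.1,
    (hΦ i).2.2.trans_lt ENNReal.one_lt_top⟩, ht, ?_⟩
  exact limsup_le_of_le (by isBoundedDefault) (Eventually.of_forall fun i => (hΦ i).2.2)

theorem tendsto_cbNorm_of_isCBBound [Nontrivial K] {ι : Type*} {l : Filter ι}
    {Φ : ι → N.Elem →ₗ[ℂ] N.Elem} (h1 : ∀ i, Φ i 1 = 1) {c : ι → ℝ} (hc : Tendsto c l (𝓝 1))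
    (h0 : ∀ i, 0 ≤ c i) (h : ∀ i, IsCBBound (Φ i) (c i)) :
    Tendsto (fun i => cbNorm (Φ i)) l (𝓝 1) := by
  have h2 : Tendsto (fun i => ENNReal.ofReal (c i)) l (𝓝 1) := by
    have := ENNReal.tendsto_ofReal hc
    rwa [ENNReal.ofReal_one] at this
  exact tendsto_of_tendsto_of_tendsto_of_le_of_le tendsto_const_nhds h2
    (fun i => one_le_cbNorm (h1 i)) fun i => (h i).cbNorm_le (h0 i)

/-- Dividing by the bounds `c j → 1` yields complete contractions without affecting the limit. The
factor `ℕ` is lifted so that the index set lies in the required universe. -/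
theorem hasCMAP_of_isCBBound {κ : Type u} [Preorder κ] [IsDirectedOrder κ] [Nonempty κ]
    {Φ : ℕ × κ → N.Elem →ₗ[ℂ] N.Elem} {c : ℕ → ℝ} (hc0 : ∀ j, 0 < c j)
    (hc1 : Tendsto c atTop (𝓝 1)) (hn : ∀ p, IsNormalMap (Φ p)) (hr : ∀ p, IsFiniteRank (Φ p))
    (hcb : ∀ p, IsCBBound (Φ p) (c p.1)) (hΦ : TendstoIdStarStrongly atTop Φ) : N.HasCMAP := by
  have hdir : IsDirectedOrder (ULift.{u} ℕ) :=
    ⟨fun a b => ⟨⟨max a.down b.down⟩, le_max_left a.down b.down, le_max_right a.down b.down⟩⟩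
  have hdir' : IsDirectedOrder (ULift.{u} ℕ × κ) := ⟨fun a b => by
    obtain ⟨x, h1, h2⟩ := hdir.directed a.1 b.1
    obtain ⟨y, h3, h4⟩ := directed_of (· ≤ ·) a.2 b.2
    exact ⟨(x, y), ⟨h1, h3⟩, ⟨h2, h4⟩⟩⟩
  have hfst : Tendsto (fun p : ℕ × κ => (c p.1)⁻¹) atTop (𝓝 1) := by
    rw [← prod_atTop_atTop_eq]
    have := (hc1.comp (tendsto_fst (g := (atTop : Filter κ)))).inv₀ one_ne_zero
    rw [inv_one] at this
    exact this
  let f : ULift.{u} ℕ × κ → ℕ × κ := fun p => (p.1.down, p.2)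
  have hf : Tendsto f atTop atTop := by
    rw [← prod_atTop_atTop_eq, ← prod_atTop_atTop_eq]
    refine Tendsto.prodMap ?_ tendsto_id
    exact tendsto_atTop.2 fun b => eventually_ge_atTop (ULift.up b)
  refine ⟨ULift.{u} ℕ × κ, _, hdir', inferInstance, _, fun p => ⟨?_, ?_, ?_⟩,
    (hΦ.smul hfst).comp_tendsto hf⟩
  · exact (hn _).smul _
  · exact (hr _).smul _
  · have h := (hcb (f p)).smul (((c (f p).1)⁻¹ : ℝ) : ℂ)
    have e : ‖(((c (f p).1)⁻¹ : ℝ) : ℂ)‖ * c (f p).1 = 1 := by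
      rw [Complex.norm_real, Real.norm_of_nonneg (inv_nonneg.2 (hc0 _).le),
        inv_mul_cancel₀ (hc0 _).ne']
    rw [e] at h
    exact (h.cbNorm_le zero_le_one).trans_eq ENNReal.ofReal_one

end VonNeumannAlgebra

/-! ### Assembly for the free Araki–Woods algebra. -/

open VonNeumannAlgebra Fock

namespace OrthogonalRep

variable {E : Type u} [NormedAddCommGroup E] [InnerProductSpace ℝ E] [CompleteSpace E]
variable (U : OrthogonalRep E)

theorem exists_isW_tensor (a : List (Complexification E)) (ha : ∀ e ∈ a, e ∈ U.domI) :
    ∃ x : (freeArakiWoods U).Elem, IsW (tensor a) x := by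
  choose! I hI using fun e (he : e ∈ U.domI) => he
  -- The Wick operator of the pairs `(e, I e)` lies in the algebra and creates the elementary tensor
  -- from the vacuum.
  have hw := U.standardSubspace.wick_mem (a.map fun e => (e, I e)) fun p hp => by
    obtain ⟨e, he, rfl⟩ := List.mem_map.1 hp
    exact U.mem_involutionGraph_standardSubspace.2 (hI e (ha e he))
  refine ⟨⟨_, hw⟩, ?_⟩
  change wick (a.map fun e => (e, I e)) (vacuum _) = tensor a
  rw [wick_vacuum, List.map_map]
  congr 1
  exact List.map_id' a

theorem isRadialMultiplier_radialMap {r : ℝ} {n : ℕ} {C : ℝ} (hC : 0 ≤ C)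
    (h : IsCBBound (U.standardSubspace.radialMap r n) C) :
    IsRadialMultiplier U (fun k => (StandardSubspace.truncSymbol r n k : ℂ))
      (U.standardSubspace.radialMap r n) where
  normal := U.standardSubspace.isNormalMap_radialMap r n
  cb := (h.cbNorm_le hC).trans_lt ENNReal.ofReal_lt_top
  exists_W := U.exists_isW_tensor
  map_W _ _ _ hx := U.standardSubspace.radialMap_eq_smul r n hx

end OrthogonalRep

theorem theoremA {HR : Type u} [NormedAddCommGroup HR] [InnerProductSpace ℝ HR]
    [CompleteSpace HR] [TopologicalSpace.SeparableSpace HR] (U : OrthogonalRep HR) :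
    (freeArakiWoods U).HasCMAP ∧
    (freeArakiWoods U).cowlingHaagerup = 1 ∧
    ∃ (φ : ℕ → ℕ → ℝ) (m : ℕ → (freeArakiWoods U).Elem →ₗ[ℂ] (freeArakiWoods U).Elem)
      (κ : Type u) (_ : Preorder κ) (_ : IsDirectedOrder κ) (_ : Nonempty κ)
      (T : κ → Complexification HR →L[ℂ] Complexification HR)
      (G : κ → (freeArakiWoods U).Elem →ₗ[ℂ] (freeArakiWoods U).Elem),
      (∀ n, (Function.support (φ n)).Finite ∧ IsRadialMultiplier U (fun k => (φ n k : ℂ)) (m n)) ∧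
      (∀ k, Tendsto (fun n => φ n k) atTop (𝓝 1)) ∧
      Tendsto (fun n => VonNeumannAlgebra.cbNorm (m n)) atTop (𝓝 1) ∧
      (∀ k, ‖T k‖ ≤ 1 ∧ FiniteDimensional ℂ (LinearMap.range (T k).toLinearMap) ∧
        U.CommutesWithI (T k) ∧ IsSecondQuantization U (T k) (G k)) ∧
      (∀ ξ, Tendsto (fun k => T k ξ) atTop (𝓝 ξ)) ∧
      (∀ p : ℕ × κ, VonNeumannAlgebra.IsNormalMap (m p.1 ∘ₗ G p.2) ∧
        VonNeumannAlgebra.IsFiniteRank (m p.1 ∘ₗ G p.2)) ∧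
      Tendsto (fun p : ℕ × κ => VonNeumannAlgebra.cbNorm (m p.1 ∘ₗ G p.2)) atTop (𝓝 1) ∧
      VonNeumannAlgebra.TendstoIdStarStrongly atTop
        (fun p : ℕ × κ => m p.1 ∘ₗ G p.2) := by
  set S := U.standardSubspace
  obtain ⟨r, n, hrn, hφ⟩ := S.exists_radial
  obtain ⟨κ, i1, i2, i3, T, hT, hTlim⟩ := S.exists_finiteRank_approximation
  choose G Q hGn hG1 hGcp hGcb hGs hQ hQn hGQ using fun k =>
    S.exists_secondQuantization (T k) (hT k).1 (hT k).2.2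
  set m : ℕ → S.freeAlgebra.Elem →ₗ[ℂ] S.freeAlgebra.Elem := fun j => S.radialMap (r j) (n j)
    with hm
  set c : ℕ → ℝ := fun j => 1 + 1 / (j + 1) with hc
  have hc0 : ∀ j, 0 < c j := fun j => by simp only [hc]; positivity
  have hc1 : Tendsto c atTop (𝓝 1) := by
    have := (tendsto_one_div_add_atTop_nhds_zero_nat (𝕜 := ℝ)).const_add 1
    rw [add_zero] at this
    exact this
  have hfst : Tendsto (fun p : ℕ × κ => c p.1) atTop (𝓝 1) := by
    rw [← prod_atTop_atTop_eq]
    exact hc1.comp tendsto_fst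
  have hmcb : ∀ j, IsCBBound (m j) (c j) := fun j => (hrn j).2.2.2
  have hm1 : ∀ j, m j 1 = 1 := fun j => S.radialMap_one (r j) (hrn j).2.2.1
  have hcb : ∀ p : ℕ × κ, IsCBBound (m p.1 ∘ₗ G p.2) (c p.1) := fun p => by
    have := (hmcb p.1).comp (hc0 p.1).le (hGcb p.2)
    rwa [mul_one] at this
  have hnormal : ∀ p : ℕ × κ, IsNormalMap (m p.1 ∘ₗ G p.2) := fun p =>
    (S.isNormalMap_radialMap _ _).comp (hGn p.2)
  have hrank : ∀ p : ℕ × κ, IsFiniteRank (m p.1 ∘ₗ G p.2) := fun p =>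
    S.isFiniteRank_radialMap_comp _ _ (hT p.2).2.1 (hQ p.2) (hGQ p.2)
  have hcomp1 : ∀ p : ℕ × κ, (m p.1 ∘ₗ G p.2) 1 = 1 := fun p => by
    rw [LinearMap.comp_apply, hG1, hm1]
  have hlim : TendstoIdStarStrongly atTop (fun p : ℕ × κ => m p.1 ∘ₗ G p.2) := by
    rw [← prod_atTop_atTop_eq]
    exact S.tendsto_radialMap_comp (fun j => ⟨(hrn j).1, (hrn j).2.1⟩) hmcb hφ hTlim hGcb hGs hQ
      hQn hGQ
  have hcmap : (freeArakiWoods U).HasCMAP := hasCMAP_of_isCBBound hc0 hc1 hnormal hrank hcb hlim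
  refine ⟨hcmap, hcmap.cowlingHaagerup_eq_one, fun j k => StandardSubspace.truncSymbol (r j) (n j) k, m, κ, i1, i2,
    i3, T, G, fun j => ⟨StandardSubspace.finite_support_truncSymbol _ _, U.isRadialMultiplier_radialMap (hc0 j).le
      (hmcb j)⟩, hφ, tendsto_cbNorm_of_isCBBound hm1 hc1 (fun j => (hc0 j).le) hmcb,
    fun k => ⟨(hT k).1, (hT k).2.1, U.commutesWithI_of_mapsTo (hT k).2.2, hGn k, hG1 k, hGcp k,
      Q k, hQ k, fun ξ x hx => ?_⟩, hTlim, fun p => ⟨hnormal p, hrank p⟩,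
    tendsto_cbNorm_of_isCBBound hcomp1 hfst (fun p => (hc0 _).le) hcb, hlim⟩
  have hx' : (x : Fock (Complexification HR) →L[ℂ] Fock (Complexification HR)) (vacuum _) = ξ := hx
  rw [← hx']
  exact hGQ k x
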